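/- Let $G$ be a finite group. Let $\Lambda_G$ be the commutative monoid (under concatenation) of unordered tuples $[\hat\gamma_1,\dots,\hat\gamma_q]$ of conjugacy classes of $G$ with $\gamma_1\cdots\gamma_q\in[G,G]$, and let $\mathbb{B}_G$ be the quotient of $\Lambda_G$ by the relations $[\hat 1]=0$ and $[\hat\gamma,\widehat{\gamma^{-1}}]=0$ for $\gamma\in G$; it is an abelian group. A homomorphism $f:H\to G$ induces $\mathbb{B}_f:\mathbb{B}_H\to\mathbb{B}_G$, $[\hat\gamma_1,\dots,\hat\gamma_q]\mapsto[\widehat{f(\gamma_1)},\dots,\widehat{f(\gamma_q)}]$. Let $R_{\mathbb{C}}G$ be the additive group of the complex representation ring, $\rho_0$ the trivial one-dimensional representation, $E_G=\langle \mathrm{Ind}_K^G\rho_0\mid K\le G\rangle\subseteq R_{\mathbb{C}}G$ and $\widetilde{R_{\mathbb{C}}G}=R_{\mathbb{C}}G/E_G$. For a subgroup $H\le G$, induction maps $E_H$ into $E_G$ and so induces $\widetilde{\mathrm{Ind}}{}^G_H:\widetilde{R_{\mathbb{C}}H}\to\widetilde{R_{\mathbb{C}}G}$. Let $G$ act effectively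 and by orientation-preserving maps on a closed connected oriented surface $S$ of genus $g$, the action being given on a finite $G$-CW decomposition of $S$. Each orbit of points with non-trivial stabilizer determines the conjugacy class $\hat\gamma$ of the generator $\gamma$ of the stabilizer of a point $x$ of the orbit that acts near $x$ as the rotation through $2\pi/|\langle\gamma\rangle|$; the collection of these classes over all such orbits is the singular orbit data of the action, and it has a class in $\mathbb{B}_G$. The action of $G$ on $H_1(S;\mathbb{R})$ preserves the intersection form and so, up to conjugation, factors through $U(g)\subset Sp_{2g}(\mathbb{R})$; let $\varphi$ be the resulting unitary representation. Let $$\theta:\mathbb{B}_G\to\widetilde{R_{\mathbb{C}}G}$$ be the homomorphism induced by $\varphi$: its graph consists of exactly the pairs (class in $\mathbb{B}_G$ of the singular orbit data of an action, class of its representation $\varphi$ modulo $E_G$). Then for every finite group $G$ and every subgroup $H\le G$ with inclusion $i:H\to G$, the homomorphisms $\theta$ for $H$ and for $G$ exist, and $$\theta\circ\mathbb{B}_i=\widetilde{\mathrm{Ind}}{}^G_H\circ\theta:\ \mathbb{B}_H\to\widetilde{R_{\mathbb{C}}G}.$$ -/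

import Mathlib

noncomputable section

namespace GeomRep

/-! ## The group `𝔹_G` of singular orbit data -/

section OrbitData

variable (G : Type*) [Group G]

/-- The image of a conjugacy class in `G / [G, G]`. -/
def classToAb : ConjClasses G → Abelianization G :=
  Quotient.lift (fun g : G => Abelianization.of g) (by
    intro a b hab
    obtain ⟨c, rfl⟩ := isConj_iff.mp hab
    simp [mul_comm])

/-- `Λ_G`: unordered tuples of conjugacy classes `[γ̂₁, …, γ̂_q]` with `γ₁ ⋯ γ_q ∈ [G, G]`. -/
def OrbitTuple : AddSubmonoid (Multiset (ConjClasses G)) where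
  carrier := {m | (m.map (classToAb G)).prod = 1}
  zero_mem' := by simp
  add_mem' := by
    intro a b ha hb
    change (Multiset.map _ _).prod = 1 at ha hb ⊢
    rw [Multiset.map_add, Multiset.prod_add, ha, hb, one_mul]

variable {G}

/-- The cancelling pair `[γ̂, γ̂⁻¹]`. -/
def cancellingPair (γ : G) : OrbitTuple G :=
  ⟨{ConjClasses.mk γ, ConjClasses.mk γ⁻¹}, by
    change (Multiset.map _ _).prod = 1
    simp only [Multiset.insert_eq_cons, Multiset.map_cons, Multiset.map_singleton,
      Multiset.prod_cons, Multiset.prod_singleton]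
    change Abelianization.of γ * Abelianization.of γ⁻¹ = 1
    simp⟩

/-- The tuple `[1̂]`, which is identified with the empty tuple. -/
def trivialTuple : OrbitTuple G :=
  ⟨{ConjClasses.mk 1}, by
    change (Multiset.map _ _).prod = 1
    simp only [Multiset.map_singleton, Multiset.prod_singleton]
    change Abelianization.of (1 : G) = 1
    simp⟩

variable (G)

/-- The congruence on `Λ_G` generated by `[1̂] ~ ∅` and `[γ̂, γ̂⁻¹] ~ ∅`. -/
def orbitCon : AddCon (OrbitTuple G) :=
  addConGen (fun x y => y = 0 ∧ (x = trivialTuple ∨ ∃ γ : G, x = cancellingPair γ))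

/-- `𝔹_G`, the quotient of `Λ_G` by the cancelling pairs. -/
def BGroup : Type _ := (orbitCon G).Quotient

instance : AddCommMonoid (BGroup G) := inferInstanceAs (AddCommMonoid (orbitCon G).Quotient)

/-- The class in `𝔹_G` of an element of `Λ_G`. -/
def BGroup.mk : OrbitTuple G →+ BGroup G := (orbitCon G).mk'

variable {G}

theorem BGroup.mk_pair (γ : G) : BGroup.mk G (cancellingPair γ) = 0 :=
  ((orbitCon G).eq).2 (AddConGen.Rel.of _ _ ⟨rfl, Or.inr ⟨γ, rfl⟩⟩)

theorem BGroup.mk_trivial : BGroup.mk G trivialTuple = 0 :=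
  ((orbitCon G).eq).2 (AddConGen.Rel.of _ _ ⟨rfl, Or.inl rfl⟩)

theorem BGroup.exists_add_eq_zero (m : Multiset (ConjClasses G)) :
    ∃ m' : Multiset (ConjClasses G), (m'.map (classToAb G)).prod = ((m.map (classToAb G)).prod)⁻¹ ∧
      ∃ h : m + m' ∈ OrbitTuple G, BGroup.mk G ⟨m + m', h⟩ = 0 := by
  induction m using Multiset.induction with
  | empty => exact ⟨0, by simp, (OrbitTuple G).zero_mem, by
      have : (⟨0 + 0, (OrbitTuple G).zero_mem⟩ : OrbitTuple G) = 0 := rfl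
      exact (congrArg (BGroup.mk G) this).trans (map_zero _)⟩
  | cons c m ih =>
    obtain ⟨m', h1, h2, h3⟩ := ih
    obtain ⟨γ, rfl⟩ := ConjClasses.mk_surjective c
    have hsum : (ConjClasses.mk γ ::ₘ m) + (ConjClasses.mk γ⁻¹ ::ₘ m') =
        ((cancellingPair γ : OrbitTuple G) : Multiset (ConjClasses G)) + (m + m') := by
      change _ = ({ConjClasses.mk γ, ConjClasses.mk γ⁻¹} : Multiset (ConjClasses G)) + (m + m')
      simp only [Multiset.insert_eq_cons, ← Multiset.singleton_add]
      abel
    refine ⟨ConjClasses.mk γ⁻¹ ::ₘ m', ?_, ?_, ?_⟩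
    · have h0 : classToAb G (ConjClasses.mk γ⁻¹) = (classToAb G (ConjClasses.mk γ))⁻¹ := by
        change Abelianization.of γ⁻¹ = (Abelianization.of γ)⁻¹
        simp
      simp [h1, h0, mul_comm]
    · rw [hsum]; exact add_mem (cancellingPair γ).2 h2
    · have : (⟨(ConjClasses.mk γ ::ₘ m) + (ConjClasses.mk γ⁻¹ ::ₘ m'),
          by rw [hsum]; exact add_mem (cancellingPair γ).2 h2⟩ : OrbitTuple G) =
          cancellingPair γ + ⟨m + m', h2⟩ := Subtype.ext hsum
      rw [this, map_add, h3, BGroup.mk_pair, add_zero]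

theorem BGroup.exists_neg (x : BGroup G) : ∃ y : BGroup G, y + x = 0 := by
  obtain ⟨m, rfl⟩ := AddCon.mk'_surjective x
  obtain ⟨m', h1, h2, h3⟩ := BGroup.exists_add_eq_zero (m : Multiset (ConjClasses G))
  have hm : ((m : Multiset (ConjClasses G)).map (classToAb G)).prod = 1 := m.2
  have hm' : m' ∈ OrbitTuple G := by
    change (m'.map (classToAb G)).prod = 1
    rw [h1, hm, inv_one]
  refine ⟨BGroup.mk G ⟨m', hm'⟩, ?_⟩
  change BGroup.mk G ⟨m', hm'⟩ + BGroup.mk G m = 0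
  rw [add_comm, ← map_add]
  exact h3

instance : Neg (BGroup G) := ⟨fun x => (BGroup.exists_neg x).choose⟩

instance : AddCommGroup (BGroup G) :=
  { (inferInstance : AddCommMonoid (BGroup G)) with
    neg_add_cancel := fun x => (BGroup.exists_neg x).choose_spec
    zsmul := zsmulRec }

variable {H : Type*} [Group H]

theorem classToAb_map (f : H →* G) (c : ConjClasses H) :
    classToAb G (ConjClasses.map f c) = Abelianization.map f (classToAb H c) := by
  obtain ⟨γ, rfl⟩ := ConjClasses.mk_surjective c
  rfl

/-- The map `Λ_H → Λ_G`, `[γ̂₁, …, γ̂_q] ↦ [f(γ₁)^, …, f(γ_q)^]`. -/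
def OrbitTuple.map (f : H →* G) : OrbitTuple H →+ OrbitTuple G where
  toFun m := ⟨(m : Multiset (ConjClasses H)).map (ConjClasses.map f), by
    have hm : ((m : Multiset (ConjClasses H)).map (classToAb H)).prod = 1 := m.2
    change (Multiset.map _ (Multiset.map _ _)).prod = 1
    rw [Multiset.map_map]
    have : (classToAb G ∘ ConjClasses.map f) = (Abelianization.map f) ∘ classToAb H :=
      funext (classToAb_map f)
    rw [this, ← Multiset.map_map, Multiset.prod_hom, hm, map_one]⟩
  map_zero' := rfl
  map_add' a b := Subtype.ext (Multiset.map_add _ _ _)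

/-- `𝔹_f : 𝔹_H → 𝔹_G`. -/
def BGroup.map (f : H →* G) : BGroup H →+ BGroup G :=
  (orbitCon H).lift ((BGroup.mk G).comp (OrbitTuple.map f)) (by
    refine AddCon.addConGen_le.2 ?_
    rintro x y ⟨rfl, rfl | ⟨γ, rfl⟩⟩
    · rw [AddCon.ker_rel, map_zero]
      have : OrbitTuple.map f (trivialTuple : OrbitTuple H) = trivialTuple :=
        Subtype.ext (by
          change Multiset.map (ConjClasses.map f) {ConjClasses.mk 1} = {ConjClasses.mk 1}
          rw [Multiset.map_singleton]
          change {ConjClasses.mk (f 1)} = _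
          rw [map_one])
      rw [AddMonoidHom.comp_apply, this, BGroup.mk_trivial]
    · rw [AddCon.ker_rel, map_zero]
      have : OrbitTuple.map f (cancellingPair γ) = cancellingPair (f γ) :=
        Subtype.ext (by
          change Multiset.map (ConjClasses.map f) {ConjClasses.mk γ, ConjClasses.mk γ⁻¹} =
            {ConjClasses.mk (f γ), ConjClasses.mk (f γ)⁻¹}
          rw [Multiset.insert_eq_cons, Multiset.map_cons, Multiset.map_singleton]
          change {ConjClasses.mk (f γ), ConjClasses.mk (f γ⁻¹)} = _
          rw [map_inv])
      rw [AddMonoidHom.comp_apply, this, BGroup.mk_pair])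

end OrbitData

/-! ## Actions on closed oriented surfaces -/

/-- An effective orientation preserving action of `G` on a closed connected oriented surface,
given on a `G`-CW decomposition of the surface. The cells are recorded by the oriented edges
(darts): `rot d` is the next dart, counterclockwise, with the same initial vertex as `d`, and
`rev d` is `d` with the opposite orientation. Vertices, edges and faces are the cycles of `rot`,
`rev` and `rot⁻¹ * rev`; the last permutation follows the boundary of the face to the left.
The conditions `edge_free` and `face_free` say that only the trivial element of `G` maps an
edge or a face to itself, so that the points with a nontrivial stabilizer are vertices. -/
structure GSurface (G : Type*) [Group G] where
  Dart : Type
  [fintypeDart : Fintype Dart]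
  [nonemptyDart : Nonempty Dart]
  [action : MulAction G Dart]
  rot : Equiv.Perm Dart
  rev : Equiv.Perm Dart
  rev_rev : ∀ d, rev (rev d) = d
  rev_ne : ∀ d, rev d ≠ d
  connected : ∀ d d', ∃ w ∈ Subgroup.closure {rot, rev}, w d = d'
  smul_rot : ∀ (a : G) (d : Dart), a • rot d = rot (a • d)
  smul_rev : ∀ (a : G) (d : Dart), a • rev d = rev (a • d)
  effective : ∀ a : G, (∀ d : Dart, a • d = d) → a = 1
  edge_free : ∀ (a : G) (d : Dart), a • d ≠ rev d
  face_free : ∀ (a : G) (d : Dart), (rot⁻¹ * rev).SameCycle d (a • d) → a = 1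

namespace GSurface

attribute [instance] fintypeDart nonemptyDart action

variable {G : Type*} [Group G] (s : GSurface G)

/-- The number of darts issuing from the initial vertex of `d`. -/
def valence (d : s.Dart) : ℕ := Function.minimalPeriod s.rot d

/-! ### The singular orbit data of an action -/

theorem valence_pos (d : s.Dart) : 0 < s.valence d :=
  Function.minimalPeriod_pos_of_mem_periodicPts
    (s.rot.injective.mem_periodicPts d)

/-- `a` maps `d` to the dart obtained from `d` by the least positive counterclockwise rotation
that is realized by an element of `G`. Hence `a` generates the stabilizer of the initial vertex of
`d`, and it acts there as the rotation through `2π / ν`, with `ν` the order of the stabilizer. -/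
def IsRotationGenerator (d : s.Dart) (a : G) : Prop :=
  ∃ k : ℕ, 0 < k ∧ a • d = (s.rot ^ k) d ∧
    ∀ j : ℕ, 0 < j → j < k → ∀ b : G, b • d ≠ (s.rot ^ j) d

theorem exists_isRotationGenerator (d : s.Dart) : ∃ a : G, s.IsRotationGenerator d a := by
  classical
  have h : ∃ k : ℕ, 0 < k ∧ ∃ a : G, a • d = (s.rot ^ k) d := by
    refine ⟨s.valence d, s.valence_pos d, 1, ?_⟩
    rw [one_smul, ← Equiv.Perm.iterate_eq_pow]
    exact (Function.iterate_minimalPeriod).symm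
  obtain ⟨h0, a, ha⟩ := Nat.find_spec h
  refine ⟨a, Nat.find h, h0, ha, fun j hj hlt b hb => Nat.find_min h hlt ⟨hj, b, hb⟩⟩

/-- The generator of the stabilizer of the initial vertex of `d` that acts as the rotation through
`2π / ν`. -/
def rotationGenerator (d : s.Dart) : G := (s.exists_isRotationGenerator d).choose

theorem smul_rot_zpow (a : G) (k : ℤ) (d : s.Dart) :
    a • (s.rot ^ k) d = (s.rot ^ k) (a • d) := by
  have h : Commute (MulAction.toPerm a : Equiv.Perm s.Dart) s.rot :=
    Equiv.ext fun d => s.smul_rot a d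
  exact congrArg (fun p : Equiv.Perm s.Dart => p d) (h.zpow_right k).eq

/-- Two darts are equivalent if their initial vertices lie in the same `G`-orbit. -/
def vertexOrbit : Setoid s.Dart where
  r d d' := ∃ (a : G) (k : ℤ), a • d = (s.rot ^ k) d'
  iseqv :=
    { refl := fun d => ⟨1, 0, by simp⟩
      symm := by
        rintro d d' ⟨a, k, h⟩
        refine ⟨a⁻¹, -k, ?_⟩
        have h' : d = (s.rot ^ k) (a⁻¹ • d') := by
          rw [← s.smul_rot_zpow, ← h, inv_smul_smul]
        rw [h', zpow_neg]
        simp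
      trans := by
        rintro d d' d'' ⟨a, k, h⟩ ⟨b, l, h'⟩
        refine ⟨b * a, k + l, ?_⟩
        rw [mul_smul, h, s.smul_rot_zpow, h', zpow_add, Equiv.Perm.mul_apply] }

/-- The singular orbit data: the multiset, over all `G`-orbits of vertices, of the conjugacy classes
of the rotation generators, which do not depend on the dart chosen in the orbit. Regular orbits
contribute the class of `1`. -/
def orbitData : Multiset (ConjClasses G) :=
  letI : Fintype (Quotient s.vertexOrbit) := Fintype.ofFinite _
  (Finset.univ : Finset (Quotient s.vertexOrbit)).val.map
    fun v => ConjClasses.mk (s.rotationGenerator v.out)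

/-! ### First homology, the intersection form and the unitary representation -/

/-- The real cellular `1`-cycles. A `1`-chain is a function on darts that is odd under reversal. -/
def cycles : Submodule ℝ (s.Dart → ℝ) where
  carrier := {z | (∀ d, z (s.rev d) = -z d) ∧
    ∀ d, ∑ i ∈ Finset.range (s.valence d), z ((s.rot ^ i) d) = 0}
  zero_mem' := by simp
  add_mem' := by
    rintro z w ⟨h1, h2⟩ ⟨h3, h4⟩
    refine ⟨fun d => ?_, fun d => ?_⟩
    · simp only [Pi.add_apply, h1, h3]; ring
    · simp only [Pi.add_apply, Finset.sum_add_distrib, h2, h4, add_zero]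
  smul_mem' := by
    rintro c z ⟨h1, h2⟩
    refine ⟨fun d => ?_, fun d => ?_⟩
    · simp only [Pi.smul_apply, h1, smul_neg]
    · simp only [Pi.smul_apply, ← Finset.smul_sum, h2, smul_zero]

/-- The boundaries of real cellular `2`-chains. A `2`-chain is a function `f` on darts that is
constant along the boundary of each face, `f d` being the coefficient of the face to the left
of `d`. -/
def boundaries : Submodule ℝ (s.Dart → ℝ) where
  carrier := {z | ∃ f : s.Dart → ℝ, (∀ d, f ((s.rot⁻¹ * s.rev) d) = f d) ∧
    ∀ d, z d = f d - f (s.rev d)}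
  zero_mem' := ⟨0, by simp, by simp⟩
  add_mem' := by
    rintro z w ⟨f, h1, h2⟩ ⟨g, h3, h4⟩
    refine ⟨f + g, fun d => ?_, fun d => ?_⟩
    · simp only [Pi.add_apply, h1, h3]
    · simp only [Pi.add_apply, h2, h4]; ring
  smul_mem' := by
    rintro c z ⟨f, h1, h2⟩
    refine ⟨c • f, fun d => ?_, fun d => ?_⟩
    · simp only [Pi.smul_apply, h1]
    · simp only [Pi.smul_apply, h2, smul_eq_mul]; ring

/-- The first homology `H₁(S; ℝ)`. -/
abbrev H1 : Type := s.cycles ⧸ s.boundaries.submoduleOf s.cycles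

/-- The homology class of a cycle. -/
def homologyClass : s.cycles →ₗ[ℝ] s.H1 := (s.boundaries.submoduleOf s.cycles).mkQ

theorem smul_rot_pow (a : G) (k : ℕ) (d : s.Dart) :
    a • (s.rot ^ k) d = (s.rot ^ k) (a • d) := by
  simpa using s.smul_rot_zpow a k d

theorem valence_smul (a : G) (d : s.Dart) : s.valence (a • d) = s.valence d := by
  refine Function.minimalPeriod_eq_minimalPeriod_iff.2 fun n => ?_
  simp only [Function.IsPeriodicPt, Function.IsFixedPt, Equiv.Perm.iterate_eq_pow,
    ← s.smul_rot_pow, smul_left_cancel_iff]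

/-- The action of `G` on cycles, `(a z)(d) = z(a⁻¹ d)`. -/
def cycleAction (a : G) (z : s.cycles) : s.cycles :=
  ⟨fun d => (z : s.Dart → ℝ) (a⁻¹ • d), by
    refine ⟨fun d => ?_, fun d => ?_⟩
    · change (z : s.Dart → ℝ) (a⁻¹ • s.rev d) = -(z : s.Dart → ℝ) (a⁻¹ • d)
      rw [s.smul_rev, z.2.1]
    · simp only [s.smul_rot_pow]
      rw [← s.valence_smul a⁻¹ d]
      exact z.2.2 _⟩

/-- The intersection number of two cycles. If `d₀, …, d_{m-1}` are the darts issuing from a vertex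
in counterclockwise order, this vertex contributes
`½ ∑_{i < j} (z(d_i) w(d_j) - z(d_j) w(d_i))`, which for cycles does not depend on the choice of
`d₀`; instead of choosing `d₀`, the sum takes the mean over all choices. -/
def intersection (z w : s.cycles) : ℝ :=
  ∑ d : s.Dart, (s.valence d : ℝ)⁻¹ *
    ∑ j ∈ Finset.range (s.valence d), ∑ i ∈ Finset.range j,
      ((z : s.Dart → ℝ) ((s.rot ^ i) d) * (w : s.Dart → ℝ) ((s.rot ^ j) d) -
        (z : s.Dart → ℝ) ((s.rot ^ j) d) * (w : s.Dart → ℝ) ((s.rot ^ i) d)) / 2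

/-- `ρ : G → U(g)` is the unitary representation of the action: the symplectic representation on
`H₁(S; ℝ)` with the intersection form factors through `U(g) ⊆ Sp_{2g}(ℝ)` as `ρ`. Here `ℂ^g` has
the symplectic form `Im ⟨x, y⟩` with `⟨x, y⟩ = ∑ conj(x_i) y_i`, which is positive on the pairs
`(x, i x)`. -/
def IsUnitaryRep {g : ℕ} (ρ : G →* Matrix.unitaryGroup (Fin g) ℂ) : Prop :=
  ∃ e : s.H1 ≃ₗ[ℝ] (Fin g → ℂ),
    (∀ z w : s.cycles, s.intersection z w =
      (dotProduct (star (e (s.homologyClass z))) (e (s.homologyClass w))).im) ∧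
    ∀ (a : G) (z : s.cycles), e (s.homologyClass (s.cycleAction a z)) =
      Matrix.mulVec (ρ a : Matrix (Fin g) (Fin g) ℂ) (e (s.homologyClass z))

end GSurface

/-! ## The representation ring and induction -/

section RepRing

/-- The additive group of the complex representation ring `R_ℂ G`, as the group of virtual
characters. -/
def RepRing (G : Type*) [Group G] : AddSubgroup (G → ℂ) :=
  AddSubgroup.closure {χ | ∃ (n : ℕ) (ρ : Representation ℂ G (Fin n → ℂ)), χ = ρ.character}

variable {G : Type*} [Group G]

theorem character_mem_repRing {V : Type*} [AddCommGroup V] [Module ℂ V] [FiniteDimensional ℂ V]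
    (ρ : Representation ℂ G V) : ρ.character ∈ RepRing G := by
  let e : V ≃ₗ[ℂ] (Fin (Module.finrank ℂ V) → ℂ) := (Module.finBasis ℂ V).equivFun
  let σ : Representation ℂ G (Fin (Module.finrank ℂ V) → ℂ) :=
    { toFun := fun g => e.conj (ρ g)
      map_one' := by rw [map_one]; exact e.conj_id
      map_mul' := fun a b => by rw [map_mul]; exact e.conj_comp (ρ b) (ρ a) }
  refine AddSubgroup.subset_closure ⟨_, σ, funext fun g => ?_⟩
  exact (LinearMap.trace_conj' (ρ g) e).symm

/-- The trivial one-dimensional character `ρ₀`. -/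
def trivialChar (G : Type*) [Group G] : RepRing G :=
  ⟨fun _ => 1, by
    have h := character_mem_repRing (Representation.trivial ℂ G ℂ)
    convert h using 1
    funext g
    simp [Representation.character]⟩

/-- The virtual character of a unitary representation. -/
def unitaryChar {g : ℕ} (ρ : G →* Matrix.unitaryGroup (Fin g) ℂ) : RepRing G :=
  ⟨fun a => Matrix.trace (ρ a : Matrix (Fin g) (Fin g) ℂ), by
    let σ : Representation ℂ G (Fin g → ℂ) :=
      ((Matrix.toLinAlgEquiv' : Matrix (Fin g) (Fin g) ℂ ≃ₐ[ℂ] _) : _ →* _).comp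
        ((Matrix.unitaryGroup (Fin g) ℂ).subtype.comp ρ)
    have h := character_mem_repRing σ
    convert h using 1
    funext a
    exact (Matrix.trace_toLin'_eq _).symm⟩

variable [Finite G]

open Classical in
/-- The induced class function, `g ↦ |H|⁻¹ ∑_{x ∈ G, x⁻¹ g x ∈ H} f(x⁻¹ g x)`. -/
def indFun (H : Subgroup G) : (H → ℂ) →+ (G → ℂ) where
  toFun f g := (Nat.card H : ℂ)⁻¹ *
    ∑ᶠ x : G, if h : x⁻¹ * g * x ∈ H then f ⟨x⁻¹ * g * x, h⟩ else 0
  map_zero' := by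
    funext g
    simp
  map_add' f f' := by
    funext g
    simp only [Pi.add_apply]
    rw [← mul_add, ← finsum_add_distrib (Set.toFinite _) (Set.toFinite _)]
    congr 2
    funext x
    split_ifs <;> simp

/-- The extension of `f` by zero from `H` to `G`. -/
def extendZero {M : Type*} [Zero M] (H : Subgroup G) (f : H → M) (x : G) : M :=
  open Classical in if h : x ∈ H then f ⟨x, h⟩ else 0

theorem indFun_apply [Fintype G] (H : Subgroup G) (f : H → ℂ) (g : G) :
    indFun H f g = (Nat.card H : ℂ)⁻¹ * ∑ x : G, extendZero H f (x⁻¹ * g * x) := by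
  change (Nat.card H : ℂ)⁻¹ * ∑ᶠ x : G, _ = _
  rw [finsum_eq_sum_of_fintype]
  rfl

theorem indFun_character_mem (H : Subgroup G) {n : ℕ} (ρ : Representation ℂ H (Fin n → ℂ)) :
    indFun H ρ.character ∈ RepRing G := by
  classical
  let _ : Fintype G := Fintype.ofFinite G
  let V := Fin n → ℂ
  have hc : (Nat.card H : ℂ) ≠ 0 := by exact_mod_cast Nat.card_pos.ne'
  -- the translation action on functions `G → V`
  let L : G →* ((G → V) →ₗ[ℂ] (G → V)) :=
    { toFun := fun g => LinearMap.funLeft ℂ V (fun x => g⁻¹ * x)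
      map_one' := by ext; simp [LinearMap.funLeft_apply]
      map_mul' := fun a b => by
        apply LinearMap.ext; intro f; funext x
        simp [LinearMap.funLeft_apply, Module.End.mul_apply, mul_assoc] }
  have hL : ∀ g f x, L g f x = f (g⁻¹ * x) := fun g f x => rfl
  -- the projection onto the equivariant functions
  let P : (G → V) →ₗ[ℂ] (G → V) := (Nat.card H : ℂ)⁻¹ • ∑ h : H,
    (LinearMap.pi fun x : G => (ρ h).comp (LinearMap.proj (R := ℂ) (φ := fun _ : G => V) (x * (h : G))))
  have hP : ∀ f x, P f x = (Nat.card H : ℂ)⁻¹ • ∑ h : H, ρ h (f (x * h)) := by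
    intro f x
    simp [P, LinearMap.sum_apply, Finset.sum_apply]
  have hPL : ∀ g, P ∘ₗ L g = L g ∘ₗ P := by
    intro g
    apply LinearMap.ext; intro f; funext x
    simp only [LinearMap.comp_apply, hP, hL, mul_assoc]
  have hequiv : ∀ f x (k : H), ρ k (P f (x * k)) = P f x := by
    intro f x k
    rw [hP, hP, map_smul, map_sum]
    congr 1
    refine Fintype.sum_equiv (Equiv.mulLeft k) _ _ fun h => ?_
    simp [map_mul, Module.End.mul_apply, mul_assoc]
  have hPP : P ∘ₗ P = P := by
    apply LinearMap.ext; intro f; funext x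
    rw [LinearMap.comp_apply, hP]
    simp only [hequiv]
    rw [Finset.sum_const, Finset.card_univ, ← Nat.card_eq_fintype_card, ← Nat.cast_smul_eq_nsmul ℂ,
      smul_smul, inv_mul_cancel₀ hc, one_smul]
  let W := LinearMap.range P
  let p : (G → V) →ₗ[ℂ] W := P.rangeRestrict
  let i : W →ₗ[ℂ] (G → V) := W.subtype
  have hip : i ∘ₗ p = P := rfl
  have hPi : P ∘ₗ i = i := by
    apply LinearMap.ext; rintro ⟨_, f, rfl⟩
    exact LinearMap.congr_fun hPP f
  have hpi : p ∘ₗ i = LinearMap.id := by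
    apply LinearMap.ext; intro w
    exact Subtype.ext (LinearMap.congr_fun hPi w)
  let σ : Representation ℂ G W :=
    { toFun := fun g => p ∘ₗ L g ∘ₗ i
      map_one' := by rw [map_one]; exact hpi
      map_mul' := fun a b => by
        change _ = (p ∘ₗ L a ∘ₗ i) ∘ₗ (p ∘ₗ L b ∘ₗ i)
        have : (p ∘ₗ L a ∘ₗ i) ∘ₗ (p ∘ₗ L b ∘ₗ i) = p ∘ₗ L a ∘ₗ ((i ∘ₗ p) ∘ₗ L b) ∘ₗ i := rfl
        rw [this, hip, hPL, LinearMap.comp_assoc, hPi, map_mul]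
        rfl }
  have key : indFun H ρ.character = σ.character := by
    funext g
    have h1 : σ.character g = LinearMap.trace ℂ (G → V) (L g ∘ₗ P) := by
      change LinearMap.trace ℂ W (p ∘ₗ (L g ∘ₗ i)) = _
      rw [LinearMap.trace_comp_comm']
      rfl
    rw [h1, indFun_apply,
      LinearMap.trace_eq_matrix_trace ℂ (Pi.basis fun _ : G => Pi.basisFun ℂ (Fin n)),
      Matrix.trace, Fintype.sum_sigma, Finset.mul_sum]
    refine Finset.sum_congr rfl fun x _ => ?_
    have h2 : ∀ j : Fin n, (LinearMap.toMatrix (Pi.basis fun _ : G => Pi.basisFun ℂ (Fin n))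
        (Pi.basis fun _ : G => Pi.basisFun ℂ (Fin n)) (L g ∘ₗ P)).diag ⟨x, j⟩ =
        (Nat.card H : ℂ)⁻¹ * ∑ h : H,
          if g⁻¹ * x * h = x then ρ h (Pi.single j 1) j else 0 := by
      intro j
      rw [Matrix.diag_apply, LinearMap.toMatrix_apply, Pi.basis_repr, Pi.basis_apply,
        Pi.basisFun_apply, Pi.basisFun_repr, LinearMap.comp_apply, hL, hP, Pi.smul_apply,
        Finset.sum_apply, smul_eq_mul]
      congr 1
      refine Finset.sum_congr rfl fun h _ => ?_
      split_ifs with hx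
      · rw [hx, Pi.single_eq_same]
      · rw [Pi.single_eq_of_ne hx, map_zero, Pi.zero_apply]
    simp only [h2]
    rw [← Finset.mul_sum, Finset.sum_comm]
    congr 1
    have h3 : ∀ h : H, (∑ j : Fin n, if g⁻¹ * x * h = x then ρ h (Pi.single j 1) j else 0) =
        if g⁻¹ * x * h = x then ρ.character h else 0 := by
      intro h
      split_ifs
      · rw [Representation.character, LinearMap.trace_eq_matrix_trace ℂ (Pi.basisFun ℂ (Fin n)),
          Matrix.trace]
        refine Finset.sum_congr rfl fun j _ => ?_
        rw [Matrix.diag_apply, LinearMap.toMatrix_apply, Pi.basisFun_apply, Pi.basisFun_repr]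
      · simp
    simp only [h3]
    have h4 : ∀ h : H, g⁻¹ * x * h = x ↔ (h : G) = x⁻¹ * g * x := by
      intro h
      constructor
      · intro e
        rw [mul_assoc x⁻¹ g x, eq_inv_mul_iff_mul_eq, ← inv_mul_eq_iff_eq_mul, ← mul_assoc]
        exact e
      · intro e
        rw [e]; group
    simp only [h4]
    unfold extendZero
    split_ifs with hx
    · rw [Finset.sum_eq_single ⟨_, hx⟩]
      · simp
      · intro b _ hb
        rw [if_neg fun e => hb (Subtype.ext e)]
      · simp
    · symm
      refine Finset.sum_eq_zero fun b _ => ?_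
      rw [if_neg]
      intro e
      exact hx (e ▸ b.2)
  rw [key]
  exact character_mem_repRing σ

/-- Induction `Ind_H^G : R_ℂ H → R_ℂ G`. -/
def ind (H : Subgroup G) : RepRing H →+ RepRing G :=
  ((indFun H).comp (RepRing H).subtype).codRestrict (RepRing G) (by
    have h : RepRing H ≤ (RepRing G).comap (indFun H) := by
      refine (AddSubgroup.closure_le _).2 ?_
      rintro _ ⟨n, ρ, rfl⟩
      exact indFun_character_mem H ρ
    exact fun χ => h χ.2)

variable (G) in
/-- `E_G`, the subgroup of `R_ℂ G` generated by all `Ind_K^G ρ₀`, `K ≤ G`. -/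
def permSubgroup : AddSubgroup (RepRing G) :=
  AddSubgroup.closure (Set.range fun K : Subgroup G => ind K (trivialChar K))

variable (G) in
/-- `R_ℂ G / E_G`. -/
abbrev RepQuot : Type _ := RepRing G ⧸ permSubgroup G

theorem ind_ind_trivialChar (H : Subgroup G) (K : Subgroup H) :
    ind H (ind K (trivialChar K)) = ind (K.map H.subtype) (trivialChar (K.map H.subtype)) := by
  classical
  let _ : Fintype G := Fintype.ofFinite G
  apply Subtype.ext
  funext g
  change indFun H (indFun K (fun _ => 1)) g = indFun (K.map H.subtype) (fun _ => 1) g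
  have hcard : Nat.card (K.map H.subtype) = Nat.card K :=
    Nat.card_congr (K.equivMapOfInjective _ H.subtype_injective).symm.toEquiv
  have hH : (Nat.card H : ℂ) ≠ 0 := by exact_mod_cast Nat.card_pos.ne'
  have hone : ∀ y : G, extendZero (K.map H.subtype) (fun _ => (1 : ℂ)) y =
      if y ∈ K.map H.subtype then 1 else 0 := by
    intro y
    unfold extendZero
    split_ifs <;> rfl
  have hstep : ∀ y : G, extendZero H (indFun K fun _ => 1) y = (Nat.card K : ℂ)⁻¹ *
      ∑ h : H, if (h : G)⁻¹ * y * h ∈ K.map H.subtype then (1 : ℂ) else 0 := by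
    intro y
    unfold extendZero
    split_ifs with hy
    · rw [indFun_apply]
      congr 1
      refine Finset.sum_congr rfl fun h _ => ?_
      have : (h : G)⁻¹ * y * h ∈ K.map H.subtype ↔ h⁻¹ * ⟨y, hy⟩ * h ∈ K := by
        constructor
        · rintro ⟨k, hk, e⟩
          have : k = h⁻¹ * ⟨y, hy⟩ * h := Subtype.ext e
          exact this ▸ hk
        · intro hk
          exact ⟨_, hk, rfl⟩
      unfold extendZero
      simp only [this]
      split_ifs <;> rfl
    · symm
      rw [Finset.sum_eq_zero, mul_zero]
      intro h _
      rw [if_neg]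
      rintro ⟨k, -, e⟩
      apply hy
      have e' : y = h * k * (h : G)⁻¹ := by
        have e2 : (k : G) = (h : G)⁻¹ * y * h := e
        rw [e2]; group
      rw [e']
      exact H.mul_mem (H.mul_mem h.2 k.2) (H.inv_mem h.2)
  rw [indFun_apply, indFun_apply, hcard]
  simp only [hstep, hone]
  rw [← Finset.mul_sum, Finset.sum_comm]
  have hconst : ∀ h : H, (∑ x : G, if (h : G)⁻¹ * (x⁻¹ * g * x) * h ∈ K.map H.subtype
      then (1 : ℂ) else 0) = ∑ x : G, if x⁻¹ * g * x ∈ K.map H.subtype then (1 : ℂ) else 0 := by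
    intro h
    refine Fintype.sum_equiv (Equiv.mulRight (h : G)) _ _ fun x => ?_
    have : (h : G)⁻¹ * (x⁻¹ * g * x) * h = (x * h)⁻¹ * g * (x * h) := by group
    rw [this]
    rfl
  simp only [hconst]
  rw [Finset.sum_const, Finset.card_univ, ← Nat.card_eq_fintype_card, nsmul_eq_mul]
  field_simp

/-- The map `R_ℂ H / E_H → R_ℂ G / E_G` induced by `Ind_H^G`. -/
def indQuot (H : Subgroup G) : RepQuot H →+ RepQuot G :=
  QuotientAddGroup.map _ _ (ind H) (by
    refine (AddSubgroup.closure_le _).2 ?_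
    rintro _ ⟨K, rfl⟩
    refine AddSubgroup.subset_closure ⟨K.map H.subtype, ?_⟩
    exact (ind_ind_trivialChar H K).symm)

/-- `θ : 𝔹_G → R_ℂ G / E_G` is the homomorphism induced by the unitary representations of surface
actions: its graph consists of all pairs formed by the class in `𝔹_G` of the singular orbit data
of an action and the class modulo `E_G` of the unitary representation of that action. In
particular every element of `𝔹_G` comes from an action, and `θ` is unique. -/
def IsTheta (θ : BGroup G →+ RepQuot G) : Prop :=
  ∀ (α : BGroup G) (x : RepQuot G), θ α = x ↔
    ∃ (s : GSurface G) (g : ℕ) (ρ : G →* Matrix.unitaryGroup (Fin g) ℂ) (m : OrbitTuple G),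
      s.IsUnitaryRep ρ ∧ (m : Multiset (ConjClasses G)) = s.orbitData ∧
        BGroup.mk G m = α ∧ QuotientAddGroup.mk (unitaryChar ρ) = x

end RepRing

end GeomRep

end

/-! The class of φ modulo E_G is determined by the values of its character away from the identity. A
virtual character that vanishes at every a ≠ 1 has an integral mean value, so it is a multiple of
the regular character Ind_1^G ρ₀, which lies in E_G. Hence `RepQuot G` embeds into the functions on
G modulo `nullFunctions G`, those that agree with an element of E_G off the identity
(`charClass_injective`).

In that quotient φ is computed by Eichler's trace formula (`trace_unitaryRep_eq_orbitData`): for a ≠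
1, tr φ(a) = 1 - ∑ `orbitSum` γ a, summed over the vertex orbits with rotation generators γ. If γ
has order ν and ζ = exp(2πi/ν), then `orbitSum` γ a adds 1/(ν(1 - ζ^q)) for each x in G with x⁻¹ a x
= γ^(-q). The constant 1 is a character in E_G, so only the orbit data matter. The identity 1/(1-u)
+ 1/(1-u⁻¹) = 1 shows that `orbitSum` γ + `orbitSum` γ⁻¹ is the character of Ind_⟨γ⟩ρ₀ off the
identity; this makes the formula descend to 𝔹_G as `orbitClass`. Up to a constant, `orbitSum` γ is
induced from ⟨γ⟩, so transitivity of induction (`indFun_orbitSum`) carries the function for H to the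
one for G, and the two composites agree.

For θ to exist, every action must have a unitary representation (`exists_isUnitaryRep`) and every
class must be realized by an action. The latter is done in `exists_orbitData` by gluing copies of a
polygon, one for each group element.

The trace formula is proved by linear algebra on functions on darts. Complex homology is the sum of
φ and its conjugate, and the Hermitian intersection form is positive on the first and negative on
the second. On each eigenspace of a, the difference of the two multiplicities is therefore a
signature and their sum is given by an Euler characteristic. The signature is the value of Meyer's
cocycle on the pair (rot, rev) (`meyer_eq_finrank_sub`). On a finite group this cocycle is the
coboundary of a weighted count of eigenvalues, with sawtooth weights (`meyer_eq_sum`). The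
involution rev has weight 0, and rot * rev drops out of the trace because a fixes no face. What
remains is a Fourier sum over the powers of rot that agree with a⁻¹ at some dart, and it is
evaluated vertex by vertex. -/

noncomputable section

namespace GeomRep

open Module
open scoped ComplexConjugate InnerProductSpace commutatorElement

/-! ## Indices and signatures of Hermitian forms -/

section Signature

variable {X Y : Type*} [AddCommGroup X] [Module ℂ X] [AddCommGroup Y] [Module ℂ Y]

/-- `q` is positive on the nonzero vectors of `P`. -/
def PosOn (q : X → ℝ) (P : Submodule ℂ X) : Prop := ∀ x ∈ P, x ≠ 0 → 0 < q x

/-- The maximal dimension of a subspace of `W` on which `q` is positive definite. -/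
def posIndex (q : X → ℝ) (W : Submodule ℂ X) : ℕ :=
  sSup {n | ∃ P : Submodule ℂ X, P ≤ W ∧ PosOn q P ∧ finrank ℂ P = n}

/-- The signature of `q` on `W`. -/
def signature (q : X → ℝ) (W : Submodule ℂ X) : ℤ := posIndex q W - posIndex (-q) W

/-- A positive subspace Q of W meets N only in 0, so dim Q + dim N ≤ dim W ≤ dim P + dim N. The
space N need be neither definite nor a complement of P. -/
theorem posIndex_eq [FiniteDimensional ℂ X] {q : X → ℝ} {W P N : Submodule ℂ X}
    (hW : P ⊔ N = W) (hP : PosOn q P) (hN : ∀ x ∈ N, q x ≤ 0) :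
    posIndex q W = finrank ℂ P := by
  refine IsGreatest.csSup_eq ⟨⟨P, hW ▸ le_sup_left, hP, rfl⟩, ?_⟩
  rintro _ ⟨Q, hQ, hq, rfl⟩
  have h0 : Q ⊓ N = ⊥ := by
    rw [eq_bot_iff]
    rintro x ⟨h1, h2⟩
    by_contra hx
    exact absurd (hq x h1 hx) (not_lt.2 (hN x h2))
  have h1 := Submodule.finrank_sup_add_finrank_inf_eq Q N
  have h2 := Submodule.finrank_sup_add_finrank_inf_eq P N
  have h3 : finrank ℂ ↥(Q ⊔ N) ≤ finrank ℂ ↥(P ⊔ N) :=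
    Submodule.finrank_mono (sup_le (hQ.trans hW.ge) le_sup_right)
  rw [h0, finrank_bot] at h1
  omega

theorem PosOn.finrank_le [FiniteDimensional ℂ X] {q : X → ℝ} {W P : Submodule ℂ X}
    (hP : PosOn q P) (h : P ≤ W) : finrank ℂ P ≤ posIndex q W := by
  -- The supremum in ℕ is meaningful only for a bounded set; dim X is a bound.
  refine le_csSup ⟨finrank ℂ X, ?_⟩ ⟨P, h, hP, rfl⟩
  rintro _ ⟨Q, -, -, rfl⟩
  exact Submodule.finrank_le Q

/-- A positive subspace of W meets the kernel of f trivially, and a positive subspace of W' lifts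
along a linear section. So f may have a kernel on W, on which the form then vanishes. -/
theorem posIndex_map {q : X → ℝ} {q' : Y → ℝ} {W : Submodule ℂ X} {W' : Submodule ℂ Y}
    (f : X →ₗ[ℂ] Y) (hW : W.map f = W') (h0 : q' 0 = 0) (hq : ∀ x ∈ W, q' (f x) = q x) :
    posIndex q W = posIndex q' W' := by
  unfold posIndex
  congr 1
  ext n
  constructor
  · rintro ⟨P, hP, hpos, rfl⟩
    refine ⟨P.map f, hW ▸ Submodule.map_mono hP, ?_, ?_⟩
    · rintro _ ⟨x, hx, rfl⟩ hne
      rw [hq x (hP hx)]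
      exact hpos x hx fun h => hne (by rw [h, map_zero])
    · rw [← LinearMap.range_domRestrict]
      refine LinearMap.finrank_range_of_inj ?_
      rw [← LinearMap.ker_eq_bot, eq_bot_iff]
      rintro ⟨x, hx⟩ h
      have h' : f x = 0 := h
      by_contra hne
      have := hpos x hx fun h => hne (by simp [h])
      rw [← hq x (hP hx), h', h0] at this
      exact lt_irrefl _ this
  · rintro ⟨P, hP, hpos, rfl⟩
    let φ : W →ₗ[ℂ] W' := f.restrict fun x hx => hW ▸ Submodule.mem_map_of_mem hx
    have hφ : LinearMap.range φ = ⊤ := by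
      rw [eq_top_iff]
      rintro ⟨y, hy⟩ -
      rw [← hW] at hy
      obtain ⟨x, hx, rfl⟩ := hy
      exact ⟨⟨x, hx⟩, rfl⟩
    obtain ⟨t, ht⟩ := φ.exists_rightInverse_of_surjective hφ
    let k : P →ₗ[ℂ] X := W.subtype ∘ₗ t ∘ₗ Submodule.inclusion hP
    have hk : ∀ y, f (k y) = y := fun y =>
      congrArg Subtype.val (LinearMap.congr_fun ht (Submodule.inclusion hP y))
    have hkW : ∀ y, k y ∈ W := fun y => (t _).2
    refine ⟨LinearMap.range k, ?_, ?_, ?_⟩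
    · rintro _ ⟨y, rfl⟩
      exact hkW y
    · rintro _ ⟨y, rfl⟩ hne
      rw [← hq _ (hkW y), hk]
      refine hpos _ y.2 fun h => hne ?_
      have : y = 0 := Subtype.ext h
      rw [this, map_zero]
    · refine LinearMap.finrank_range_of_inj fun y z h => Subtype.ext ?_
      rw [← hk y, ← hk z, h]

theorem signature_map {q : X → ℝ} {q' : Y → ℝ} {W : Submodule ℂ X} {W' : Submodule ℂ Y}
    (f : X →ₗ[ℂ] Y) (hW : W.map f = W') (h0 : q' 0 = 0) (hq : ∀ x ∈ W, q' (f x) = q x) :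
    signature q W = signature q' W' := by
  unfold signature
  rw [posIndex_map f hW h0 hq, posIndex_map (q := -q) (q' := -q') f hW (by simp [h0])
    (fun x hx => by simp [hq x hx])]

theorem posIndex_congr {q q' : X → ℝ} {W : Submodule ℂ X} (h : ∀ x ∈ W, q x = q' x) :
    posIndex q W = posIndex q' W := by
  unfold posIndex
  congr 1
  ext n
  constructor
  · rintro ⟨P, hP, hpos, rfl⟩
    exact ⟨P, hP, fun x hx hne => h x (hP hx) ▸ hpos x hx hne, rfl⟩
  · rintro ⟨P, hP, hpos, rfl⟩
    exact ⟨P, hP, fun x hx hne => (h x (hP hx)).symm ▸ hpos x hx hne, rfl⟩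

theorem signature_congr {q q' : X → ℝ} {W : Submodule ℂ X} (h : ∀ x ∈ W, q x = q' x) :
    signature q W = signature q' W := by
  unfold signature
  rw [posIndex_congr h, posIndex_congr (q := -q) (q' := -q') (fun x hx => by simp [h x hx])]

/-- Sesquilinear forms, conjugate linear in the first variable. -/
abbrev SesqForm (X : Type*) [AddCommGroup X] [Module ℂ X] := X →ₗ⋆[ℂ] X →ₗ[ℂ] ℂ

/-- The pullback of a form along a linear map. -/
def SesqForm.pull (B : SesqForm Y) (f : X →ₗ[ℂ] Y) : SesqForm X :=
  LinearMap.mk₂'ₛₗ (starRingEnd ℂ) (RingHom.id ℂ) (fun x y => B (f x) (f y))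
    (fun x x' y => by simp) (fun c x y => by simp [LinearMap.map_smulₛₗ])
    (fun x y y' => by simp) (fun c x y => by simp)

/-- The form is Hermitian. -/
def IsHermForm (B : SesqForm X) : Prop := ∀ x y, conj (B x y) = B y x

/-- The quadratic function of a form. -/
def quad (B : SesqForm X) (x : X) : ℝ := (B x x).re

/-- The radical of the restriction of a form to `W`. -/
def radOn (B : SesqForm X) (W : Submodule ℂ X) : Submodule ℂ X where
  carrier := {x | x ∈ W ∧ ∀ y ∈ W, B y x = 0}
  zero_mem' := ⟨W.zero_mem, by simp⟩
  add_mem' := fun ha hb => ⟨W.add_mem ha.1 hb.1, fun y hy => by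
    rw [map_add, ha.2 y hy, hb.2 y hy, add_zero]⟩
  smul_mem' := fun c _ ha => ⟨W.smul_mem c ha.1, fun y hy => by
    rw [map_smul, ha.2 y hy, smul_zero]⟩

/-- Declaring an arbitrary basis orthonormal turns the form into a symmetric operator; its
eigenvectors are orthogonal for the form as well. -/
theorem IsHermForm.exists_orthogonal_basis [FiniteDimensional ℂ X] {B : SesqForm X}
    (hB : IsHermForm B) : ∃ (b : Basis (Fin (finrank ℂ X)) ℂ X) (c : Fin (finrank ℂ X) → ℝ),
      ∀ i j, B (b i) (b j) = if i = j then (c j : ℂ) else 0 := by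
  classical
  set n := finrank ℂ X
  let e : Basis (Fin n) ℂ X := finBasis ℂ X
  let Φ : EuclideanSpace ℂ (Fin n) ≃ₗ[ℂ] X :=
    (WithLp.linearEquiv 2 ℂ (Fin n → ℂ)).trans e.equivFun.symm
  have hΦ : ∀ x, Φ x = ∑ i, x i • e i := fun x => e.equivFun_symm_apply _
  -- The Gram matrix of the form, as an operator.
  let T : EuclideanSpace ℂ (Fin n) →ₗ[ℂ] EuclideanSpace ℂ (Fin n) :=
    (WithLp.linearEquiv 2 ℂ (Fin n → ℂ)).symm.toLinearMap ∘ₗ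
      (LinearMap.pi fun i => (B (e i))) ∘ₗ Φ.toLinearMap
  have hT : ∀ x y, ⟪x, T y⟫_ℂ = B (Φ x) (Φ y) := by
    intro x y
    rw [PiLp.inner_apply, hΦ x, map_sum, LinearMap.sum_apply]
    refine Finset.sum_congr rfl fun i _ => ?_
    rw [LinearMap.map_smulₛₗ, LinearMap.smul_apply, smul_eq_mul, RCLike.inner_apply, mul_comm]
    rfl
  have hsym : T.IsSymmetric := by
    intro x y
    rw [hT, ← inner_conj_symm, hT, hB]
  have hn : finrank ℂ (EuclideanSpace ℂ (Fin n)) = n := by simp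
  let v := hsym.eigenvectorBasis hn
  refine ⟨v.toBasis.map Φ, hsym.eigenvalues hn, fun i j => ?_⟩
  rw [Basis.map_apply, Basis.map_apply, ← hT, OrthonormalBasis.coe_toBasis,
    hsym.apply_eigenvectorBasis hn, inner_smul_right]
  have := orthonormal_iff_ite.1 v.orthonormal i j
  rw [this]
  split_ifs <;> simp

/-- The vectors of an orthogonal basis are sorted by the sign of their squares; those of square 0
span the radical. -/
theorem IsHermForm.exists_splitting_top [FiniteDimensional ℂ X] {B : SesqForm X}
    (hB : IsHermForm B) : ∃ P N : Submodule ℂ X, PosOn (quad B) P ∧ PosOn (-quad B) N ∧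
      P ⊔ N ⊔ radOn B ⊤ = ⊤ ∧
      finrank ℂ P + finrank ℂ N + finrank ℂ (radOn B ⊤) = finrank ℂ X := by
  classical
  obtain ⟨b, c, h⟩ := hB.exists_orthogonal_basis
  have hbx : ∀ i x, B (b i) x = c i * b.repr x i := by
    intro i x
    conv_lhs => rw [← b.sum_repr x, map_sum]
    rw [Finset.sum_eq_single i]
    · rw [map_smul, h, if_pos rfl, smul_eq_mul, mul_comm]
    · intro j _ hj
      rw [map_smul, h, if_neg hj.symm, smul_zero]
    · simp
  have hq : ∀ x, quad B x = ∑ i, c i * Complex.normSq (b.repr x i) := by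
    intro x
    have : B x x = ∑ i, ((c i * Complex.normSq (b.repr x i) : ℝ) : ℂ) := by
      have h1 : B x = ∑ i, conj (b.repr x i) • B (b i) := by
        conv_lhs => rw [← b.sum_repr x, map_sum]
        exact Finset.sum_congr rfl fun i _ => LinearMap.map_smulₛₗ _ _ _
      rw [h1, LinearMap.sum_apply]
      refine Finset.sum_congr rfl fun i _ => ?_
      rw [LinearMap.smul_apply, hbx, smul_eq_mul, Complex.ofReal_mul,
        Complex.normSq_eq_conj_mul_self]
      ring
    rw [quad, this, ← Complex.ofReal_sum, Complex.ofReal_re]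
  have hspan : ∀ (S : Set (Fin (finrank ℂ X))) (x : X), x ∈ Submodule.span ℂ (b '' S) ↔
      ∀ i, i ∉ S → b.repr x i = 0 := by
    intro S x
    rw [Basis.mem_span_image]
    constructor
    · intro hs i hi
      by_contra hne
      exact hi (hs (Finsupp.mem_support_iff.2 hne))
    · intro hs i hi
      by_contra hne
      exact Finsupp.mem_support_iff.1 hi (hs i hne)
  have hcard : ∀ S : Set (Fin (finrank ℂ X)), finrank ℂ (Submodule.span ℂ (b '' S)) =
      (Finset.univ.filter fun i => i ∈ S).card := by
    intro S
    have h1 : LinearIndependent ℂ (fun i : S => b i) :=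
      b.linearIndependent.comp _ Subtype.val_injective
    have h2 := finrank_span_eq_card h1
    have h3 : Set.range (fun i : S => b i) = b '' S := by
      ext; simp
    rw [h3] at h2
    rw [h2, Fintype.card_subtype]
  have hrad : radOn B ⊤ = Submodule.span ℂ (b '' {i | c i = 0}) := by
    ext x
    rw [hspan]
    constructor
    · rintro ⟨-, hx⟩ i hi
      have := hx (b i) trivial
      rw [hbx] at this
      exact (mul_eq_zero.1 this).resolve_left (by exact_mod_cast hi)
    · intro hx
      refine ⟨trivial, fun y _ => ?_⟩
      rw [← b.sum_repr y, map_sum, LinearMap.sum_apply]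
      refine Finset.sum_eq_zero fun i _ => ?_
      rw [LinearMap.map_smulₛₗ, LinearMap.smul_apply, hbx]
      by_cases hi : c i = 0
      · simp [hi]
      · simp [hx i hi]
  have hdef : ∀ (d : Fin (finrank ℂ X) → ℝ) (x : X), x ≠ 0 → (∀ i, ¬ 0 < d i → b.repr x i = 0) →
      0 < ∑ i, d i * Complex.normSq (b.repr x i) := by
    intro d x hx hd
    have : ∃ i, b.repr x i ≠ 0 := by
      by_contra! hcon
      exact hx (b.repr.map_eq_zero_iff.1 (Finsupp.ext hcon))
    obtain ⟨i, hi⟩ := this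
    refine Finset.sum_pos' (fun j _ => ?_) ⟨i, Finset.mem_univ _, ?_⟩
    · by_cases hj : 0 < d j
      · exact mul_nonneg hj.le (Complex.normSq_nonneg _)
      · simp [hd j hj]
    · refine mul_pos ?_ (Complex.normSq_pos.2 hi)
      by_contra hcon
      exact hi (hd i hcon)
  refine ⟨Submodule.span ℂ (b '' {i | 0 < c i}), Submodule.span ℂ (b '' {i | c i < 0}), ?_, ?_, ?_, ?_⟩
  · intro x hx hne
    rw [hq]
    exact hdef c x hne ((hspan _ _).1 hx)
  · intro x hx hne
    rw [Pi.neg_apply, hq, ← Finset.sum_neg_distrib]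
    simp only [← neg_mul]
    exact hdef (fun i => - c i) x hne fun i hi => (hspan _ _).1 hx i (by simpa using hi)
  · rw [hrad, ← Submodule.span_union, ← Submodule.span_union, ← Set.image_union, ← Set.image_union]
    have : ({i | 0 < c i} ∪ {i | c i < 0} ∪ {i | c i = 0}) = Set.univ := by
      ext i
      simp only [Set.mem_union, Set.mem_ofPred_eq, Set.mem_univ, iff_true]
      rcases lt_trichotomy 0 (c i) with h | h | h
      · exact Or.inl (Or.inl h)
      · exact Or.inr h.symm
      · exact Or.inl (Or.inr h)
    rw [this, Set.image_univ, b.span_eq]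
  · rw [hrad, hcard, hcard, hcard]
    have h1 : Finset.card (Finset.univ : Finset (Fin (finrank ℂ X))) = finrank ℂ X := by simp
    rw [← Finset.card_union_of_disjoint, ← Finset.card_union_of_disjoint]
    · refine Eq.trans (congrArg Finset.card ?_) h1
      ext i
      simp only [Finset.mem_union, Finset.mem_filter, Finset.mem_univ, true_and, Set.mem_ofPred_eq,
        iff_true]
      rcases lt_trichotomy 0 (c i) with h | h | h
      · exact Or.inl (Or.inl h)
      · exact Or.inr h.symm
      · exact Or.inl (Or.inr h)
    · rw [Finset.disjoint_left]
      intro i hi hi'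
      simp only [Finset.mem_union, Finset.mem_filter, Finset.mem_univ, true_and,
        Set.mem_ofPred_eq] at hi hi'
      rcases hi with hi | hi <;> linarith
    · rw [Finset.disjoint_left]
      intro i hi hi'
      simp only [Finset.mem_filter, Finset.mem_univ, true_and, Set.mem_ofPred_eq] at hi hi'
      linarith

theorem IsHermForm.exists_splitting [FiniteDimensional ℂ X] {B : SesqForm X}
    (hB : IsHermForm B) (W : Submodule ℂ X) : ∃ P N : Submodule ℂ X,
      PosOn (quad B) P ∧ PosOn (-quad B) N ∧ P ⊔ N ⊔ radOn B W = W ∧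
      finrank ℂ P + finrank ℂ N + finrank ℂ (radOn B W) = finrank ℂ W := by
  let B' : SesqForm W := B.pull W.subtype
  have hB' : IsHermForm B' := fun x y => hB x y
  obtain ⟨P, N, hP, hN, hsup, hd⟩ := hB'.exists_splitting_top
  have hrad : (radOn B' ⊤).map W.subtype = radOn B W := by
    ext x
    constructor
    · rintro ⟨x, ⟨-, hx⟩, rfl⟩
      exact ⟨x.2, fun y hy => hx ⟨y, hy⟩ trivial⟩
    · rintro ⟨hx, hx'⟩
      exact ⟨⟨x, hx⟩, ⟨trivial, fun y _ => hx' y y.2⟩, rfl⟩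
  refine ⟨P.map W.subtype, N.map W.subtype, ?_, ?_, ?_, ?_⟩
  · rintro _ ⟨x, hx, rfl⟩ hne
    exact hP x hx fun h => hne (by simp [h])
  · rintro _ ⟨x, hx, rfl⟩ hne
    exact hN x hx fun h => hne (by simp [h])
  · rw [← hrad, ← Submodule.map_sup, ← Submodule.map_sup, hsup, Submodule.map_top,
      Submodule.range_subtype]
  · rw [← hrad, ← hd]
    congr 1
    · congr 1 <;> exact (Submodule.equivSubtypeMap W _).finrank_eq.symm
    · exact (Submodule.equivSubtypeMap W _).finrank_eq.symm

theorem quad_add {B : SesqForm X} (hB : IsHermForm B) (x y : X) :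
    quad B (x + y) = quad B x + quad B y + 2 * (B x y).re := by
  unfold quad
  have h1 : B (x + y) (x + y) = B x x + B x y + (B y x + B y y) := by simp
  rw [h1, ← hB x y]
  simp only [Complex.add_re, Complex.conj_re]
  ring

theorem quad_neg_form (B : SesqForm X) : quad (-B) = -quad B := by
  funext x
  simp [quad]

theorem IsHermForm.neg {B : SesqForm X} (hB : IsHermForm B) : IsHermForm (-B) := by
  intro x y
  simp [hB x y]

theorem IsHermForm.nonpos_sup_rad {B : SesqForm X} (hB : IsHermForm B) {W N : Submodule ℂ X}
    (hNW : N ≤ W) (hN : PosOn (-quad B) N) : ∀ x ∈ N ⊔ radOn B W, quad B x ≤ 0 := by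
  intro x hx
  obtain ⟨y, hy, z, hz, rfl⟩ := Submodule.mem_sup.1 hx
  rw [quad_add hB, hz.2 y (hNW hy)]
  have h1 : quad B z = 0 := by rw [quad, hz.2 z hz.1, Complex.zero_re]
  rw [h1]
  by_cases h0 : y = 0
  · simp [h0, quad]
  · have := hN y hy h0
    simp only [Pi.neg_apply] at this
    simp only [Complex.zero_re]
    linarith

theorem IsHermForm.exists_pos_nonpos [FiniteDimensional ℂ X] {B : SesqForm X}
    (hB : IsHermForm B) (W : Submodule ℂ X) : ∃ P N : Submodule ℂ X,
      PosOn (quad B) P ∧ (∀ x ∈ N, quad B x ≤ 0) ∧ P ⊔ N = W ∧ finrank ℂ P = posIndex (quad B) W := by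
  obtain ⟨P, N, hP, hN, hsup, hd⟩ := hB.exists_splitting W
  have hN' := hB.nonpos_sup_rad (W := W) (hsup ▸ le_sup_right.trans le_sup_left) hN
  have hW : P ⊔ (N ⊔ radOn B W) = W := by rw [← sup_assoc, hsup]
  exact ⟨P, N ⊔ radOn B W, hP, hN', hW, (posIndex_eq hW hP hN').symm⟩

/-- Sylvester's law of inertia: the positive and negative parts of one splitting realize both
maximal dimensions. -/
theorem IsHermForm.posIndex_add [FiniteDimensional ℂ X] {B : SesqForm X}
    (hB : IsHermForm B) (W : Submodule ℂ X) :
    posIndex (quad B) W + posIndex (-quad B) W + finrank ℂ (radOn B W) = finrank ℂ W := by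
  obtain ⟨P, N, hP, hN, hsup, hd⟩ := hB.exists_splitting W
  have hPW : P ≤ W := hsup ▸ le_sup_left.trans le_sup_left
  have hNW : N ≤ W := hsup ▸ le_sup_right.trans le_sup_left
  have h1 := posIndex_eq (W := W) (by rw [← sup_assoc, hsup]) hP (hB.nonpos_sup_rad hNW hN)
  have hrad : radOn (-B) W = radOn B W := by
    ext x
    simp [radOn]
  have h2 := posIndex_eq (q := -quad B) (W := W) (P := N) (N := P ⊔ radOn B W)
    (by rw [← sup_assoc, sup_comm N P, hsup]) hN (by
      have := hB.neg.nonpos_sup_rad hPW (by rwa [quad_neg_form, neg_neg])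
      rwa [quad_neg_form, hrad] at this)
  omega

/-- Let c be the codimension of W' = W ∩ I^⊥ in W. Intersecting with W' costs a definite subspace at
most c dimensions, so each index drops by at most c. On the other hand the radical grows by at least
c, since that of W' contains I and the radical of W. Counting dimensions, both indices drop by
exactly c and their difference is unchanged. -/
theorem signature_isotropic [FiniteDimensional ℂ X] {B : SesqForm X} (hB : IsHermForm B)
    {W W' I : Submodule ℂ X} (hI : I ≤ W) (hiso : ∀ x ∈ I, ∀ y ∈ I, B x y = 0)
    (hW' : ∀ x, x ∈ W' ↔ x ∈ W ∧ ∀ k ∈ I, B k x = 0) :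
    signature (quad B) W = signature (quad B) W' := by
  have hle : W' ≤ W := fun x hx => ((hW' x).1 hx).1
  have hIW' : I ≤ W' := fun x hx => (hW' x).2 ⟨hI hx, fun k hk => hiso k hk x hx⟩
  -- dimension of positive subspaces
  have hdim : ∀ {B : SesqForm X}, IsHermForm B → posIndex (quad B) W + finrank ℂ W' ≤
      posIndex (quad B) W' + finrank ℂ W := by
    intro B hB
    obtain ⟨P, N, hP, -, hsup, hd⟩ := hB.exists_pos_nonpos W
    have h1 := Submodule.finrank_sup_add_finrank_inf_eq P W'
    have h2 : finrank ℂ ↥(P ⊔ W') ≤ finrank ℂ W :=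
      Submodule.finrank_mono (sup_le (hsup ▸ le_sup_left) hle)
    have h3 : finrank ℂ ↥(P ⊓ W') ≤ posIndex (quad B) W' :=
      PosOn.finrank_le (fun x hx => hP x hx.1) inf_le_right
    omega
  have h1 := hdim hB
  have h2 := hdim hB.neg
  rw [quad_neg_form] at h2
  have h3 := hB.posIndex_add W
  have h4 := hB.posIndex_add W'
  -- the radical of the restriction
  have h5 : finrank ℂ ↥(I ⊔ radOn B W) ≤ finrank ℂ (radOn B W') := by
    refine Submodule.finrank_mono (sup_le (fun x hx => ⟨hIW' hx, fun y hy => ?_⟩)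
      fun x hx => ⟨(hW' x).2 ⟨hx.1, fun k hk => hx.2 k (hI hk)⟩, fun y hy => hx.2 y (hle hy)⟩)
    rw [← hB, ((hW' y).1 hy).2 x hx, map_zero]
  have h6 := Submodule.finrank_sup_add_finrank_inf_eq I (radOn B W)
  -- the codimension of the orthogonal complement
  have h7 : finrank ℂ W + finrank ℂ ↥(I ⊓ radOn B W) ≤ finrank ℂ W' + finrank ℂ I := by
    -- Vectors of I in the radical impose no condition on W, so W' is cut out by the functionals of
    -- a complement K.
    obtain ⟨K, hK⟩ := Submodule.exists_isCompl ((radOn B W).comap I.subtype)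
    let b := finBasis ℂ K
    let Ψ : W →ₗ[ℂ] (Fin (finrank ℂ K) → ℂ) :=
      LinearMap.pi fun i => (B (b i : I)).comp W.subtype
    have hker : (LinearMap.ker Ψ).map W.subtype = W' := by
      ext x
      rw [hW']
      constructor
      · rintro ⟨⟨x, hxW⟩, hx, rfl⟩
        refine ⟨hxW, fun k hk => ?_⟩
        have hkt : (⟨k, hk⟩ : I) ∈ (radOn B W).comap I.subtype ⊔ K := hK.sup_eq_top ▸ trivial
        obtain ⟨r, hr, t, ht, hrt⟩ := Submodule.mem_sup.1 hkt
        have hk' : k = r + t := by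
          have := congrArg Subtype.val hrt
          exact this.symm
        have hr' : B (r : X) x = 0 := by
          rw [← hB, (show (r : X) ∈ radOn B W from hr).2 x hxW, map_zero]
        have ht' : B (t : X) x = 0 := by
          have h8 : (t : X) = ∑ i, (b.repr ⟨t, ht⟩ i) • ((b i : I) : X) := by
            have h9 := congrArg (I.subtype ∘ₗ K.subtype) (b.sum_repr ⟨t, ht⟩)
            rw [map_sum] at h9
            simp only [map_smul] at h9
            exact h9.symm
          rw [h8, map_sum, LinearMap.sum_apply]
          refine Finset.sum_eq_zero fun i _ => ?_
          rw [LinearMap.map_smulₛₗ, LinearMap.smul_apply]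
          have : B ((b i : I) : X) x = 0 := congrFun hx i
          rw [this, smul_zero]
        change B k x = 0
        rw [hk', map_add, LinearMap.add_apply, hr', ht', add_zero]
      · rintro ⟨hx, hx'⟩
        refine ⟨⟨x, hx⟩, ?_, rfl⟩
        exact funext fun i => hx' _ (b i : I).2
    have h8 := LinearMap.finrank_range_add_finrank_ker Ψ
    have h9 : finrank ℂ (LinearMap.range Ψ) ≤ finrank ℂ K := by
      have := Submodule.finrank_le (LinearMap.range Ψ)
      simpa using this
    have h10 : finrank ℂ W' = finrank ℂ (LinearMap.ker Ψ) := by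
      rw [← hker]
      exact (Submodule.equivSubtypeMap W _).finrank_eq.symm
    have h11 := Submodule.finrank_add_eq_of_isCompl hK
    have h12 : finrank ℂ ↥((radOn B W).comap I.subtype) = finrank ℂ ↥(I ⊓ radOn B W) := by
      rw [(Submodule.equivSubtypeMap I _).finrank_eq, Submodule.map_comap_subtype]
    omega
  -- The relations h1 to h8 force equality in h1 and h2.
  unfold signature
  omega

theorem posIndex_prod [FiniteDimensional ℂ X] [FiniteDimensional ℂ Y] {B : SesqForm X}
    {B' : SesqForm Y} (hB : IsHermForm B) (hB' : IsHermForm B') (W : Submodule ℂ X)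
    (W' : Submodule ℂ Y) :
    posIndex (fun z : X × Y => quad B z.1 + quad B' z.2) (W.prod W') =
      posIndex (quad B) W + posIndex (quad B') W' := by
  obtain ⟨P, N, hP, hN, hsup, hd⟩ := hB.exists_pos_nonpos W
  obtain ⟨P', N', hP', hN', hsup', hd'⟩ := hB'.exists_pos_nonpos W'
  have hd2 : finrank ℂ (P.prod P') = finrank ℂ P + finrank ℂ P' := by
    rw [← Module.finrank_prod]
    exact LinearEquiv.finrank_eq
      { toFun := fun z => (⟨z.1.1, z.2.1⟩, ⟨z.1.2, z.2.2⟩)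
        invFun := fun z => ⟨(z.1, z.2), z.1.2, z.2.2⟩
        map_add' := fun _ _ => rfl
        map_smul' := fun _ _ => rfl }
  rw [posIndex_eq (P := P.prod P') (N := N.prod N'), hd2, hd, hd']
  · rw [Submodule.prod_sup_prod, hsup, hsup']
  · rintro ⟨x, y⟩ ⟨hx, hy⟩ hne
    have hx0 : 0 ≤ quad B x := by
      by_cases h : x = 0
      · simp [h, quad]
      · exact (hP x hx h).le
    have hy0 : 0 ≤ quad B' y := by
      by_cases h : y = 0
      · simp [h, quad]
      · exact (hP' y hy h).le
    by_cases h : x = 0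
    · have : y ≠ 0 := fun h' => hne (by rw [h, h']; rfl)
      exact add_pos_of_nonneg_of_pos hx0 (hP' y hy this)
    · exact add_pos_of_pos_of_nonneg (hP x hx h) hy0
  · rintro ⟨x, y⟩ ⟨hx, hy⟩
    exact add_nonpos (hN x hx) (hN' y hy)

theorem signature_prod [FiniteDimensional ℂ X] [FiniteDimensional ℂ Y] {B : SesqForm X}
    {B' : SesqForm Y} (hB : IsHermForm B) (hB' : IsHermForm B') (W : Submodule ℂ X)
    (W' : Submodule ℂ Y) :
    signature (fun z : X × Y => quad B z.1 + quad B' z.2) (W.prod W') =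
      signature (quad B) W + signature (quad B') W' := by
  have h : -(fun z : X × Y => quad B z.1 + quad B' z.2) =
      fun z : X × Y => quad (-B) z.1 + quad (-B') z.2 := by
    funext z
    simp only [quad_neg_form, Pi.neg_apply]
    ring
  unfold signature
  rw [h, posIndex_prod hB hB', posIndex_prod hB.neg hB'.neg, quad_neg_form, quad_neg_form]
  push_cast
  ring

end Signature

/-! ## Meyer's signature cocycle -/

section Meyer

variable {X Y : Type*} [AddCommGroup X] [Module ℂ X] [AddCommGroup Y] [Module ℂ Y]

/-- The orthogonal sum of two forms. -/
def SesqForm.prod (B : SesqForm X) (B' : SesqForm Y) : SesqForm (X × Y) :=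
  B.pull (LinearMap.fst ℂ X Y) + B'.pull (LinearMap.snd ℂ X Y)

theorem SesqForm.prod_apply (B : SesqForm X) (B' : SesqForm Y) (z w : X × Y) :
    B.prod B' z w = B z.1 w.1 + B' z.2 w.2 := rfl

theorem quad_prod (B : SesqForm X) (B' : SesqForm Y) :
    quad (B.prod B') = fun z => quad B z.1 + quad B' z.2 := rfl

theorem IsHermForm.prod {B : SesqForm X} {B' : SesqForm Y} (hB : IsHermForm B)
    (hB' : IsHermForm B') : IsHermForm (B.prod B') := fun z w => by
  rw [SesqForm.prod_apply, SesqForm.prod_apply, map_add, hB, hB']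

theorem quad_zero (B : SesqForm X) : quad B 0 = 0 := by simp [quad]

variable {V : Type*} [NormedAddCommGroup V] [InnerProductSpace ℂ V]

/-- The Hermitian form `2 Im ⟨x, A x⟩` of a unitary operator. -/
def twistForm (A : V ≃ₗᵢ[ℂ] V) : SesqForm V :=
  LinearMap.mk₂'ₛₗ (starRingEnd ℂ) (RingHom.id ℂ)
    (fun x y => -Complex.I * (⟪x, A y⟫_ℂ - ⟪A x, y⟫_ℂ))
    (fun x x' y => by simp only [map_add, inner_add_left]; ring)
    (fun c x y => by
      simp only [map_smul, inner_smul_left, smul_eq_mul]; ring)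
    (fun x y y' => by simp only [map_add, inner_add_right]; ring)
    (fun c x y => by
      simp only [map_smul, inner_smul_right, smul_eq_mul, RingHom.id_apply]; ring)

theorem twistForm_apply (A : V ≃ₗᵢ[ℂ] V) (x y : V) :
    twistForm A x y = -Complex.I * (⟪x, A y⟫_ℂ - ⟪A x, y⟫_ℂ) := rfl

theorem twistForm_herm (A : V ≃ₗᵢ[ℂ] V) : IsHermForm (twistForm A) := by
  intro x y
  simp only [twistForm_apply, map_mul, map_neg, map_sub, Complex.conj_I, inner_conj_symm]
  ring

/-- The translation part of the product of the rotations `A` about `u` and `B` about `v`. -/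
def rotProduct (A B : V ≃ₗᵢ[ℂ] V) : V × V →ₗ[ℂ] V :=
  (LinearMap.id - A.toLinearEquiv.toLinearMap) ∘ₗ LinearMap.fst ℂ V V +
    A.toLinearEquiv.toLinearMap ∘ₗ (LinearMap.id - B.toLinearEquiv.toLinearMap) ∘ₗ
      LinearMap.snd ℂ V V

theorem rotProduct_apply (A B : V ≃ₗᵢ[ℂ] V) (p : V × V) :
    rotProduct A B p = p.1 - A p.1 + (A p.2 - A (B p.2)) := by
  change p.1 - A p.1 + A (p.2 - B p.2) = _
  rw [map_sub]

/-- The central charge of the product of the rotations `A` about `u` and `B` about `v` in the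
Heisenberg group, as a Hermitian form in `(u, v)`. -/
def chargeForm (A B : V ≃ₗᵢ[ℂ] V) : SesqForm (V × V) :=
  (twistForm A).prod (twistForm B) -
    LinearMap.mk₂'ₛₗ (starRingEnd ℂ) (RingHom.id ℂ)
    (fun p p' => -Complex.I * (⟪p.1 - A p.1, A (p'.2 - B p'.2)⟫_ℂ -
      ⟪A (p.2 - B p.2), p'.1 - A p'.1⟫_ℂ))
    (fun x x' y => by
      simp only [map_add, map_sub, inner_add_left, inner_sub_left, Prod.fst_add, Prod.snd_add]
      ring)
    (fun c x y => by
      simp only [map_smul, map_sub, inner_smul_left, inner_sub_left, smul_eq_mul, Prod.smul_fst,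
        Prod.smul_snd]
      ring)
    (fun x y y' => by
      simp only [map_add, map_sub, inner_add_right, inner_sub_right, Prod.fst_add, Prod.snd_add]
      ring)
    (fun c x y => by
      simp only [map_smul, map_sub, inner_smul_right, inner_sub_right, smul_eq_mul, Prod.smul_fst,
        Prod.smul_snd, RingHom.id_apply]
      ring)

theorem chargeForm_apply (A B : V ≃ₗᵢ[ℂ] V) (p p' : V × V) :
    chargeForm A B p p' = twistForm A p.1 p'.1 + twistForm B p.2 p'.2 -
      -Complex.I * (⟪p.1 - A p.1, A (p'.2 - B p'.2)⟫_ℂ - ⟪A (p.2 - B p.2), p'.1 - A p'.1⟫_ℂ) := rfl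

theorem chargeForm_herm (A B : V ≃ₗᵢ[ℂ] V) : IsHermForm (chargeForm A B) := by
  intro x y
  rw [chargeForm_apply, chargeForm_apply, map_sub, map_add, twistForm_herm, twistForm_herm]
  simp only [map_mul, map_neg, map_sub, Complex.conj_I, inner_conj_symm]
  simp only [← map_sub]
  ring

/-- Two rotations about the same centre c compose to the rotation AB about c. Accordingly the
pairing with (c, c) sees only the translation part of the other pair, which is what makes the gluing
below work. -/
theorem chargeForm_diag (A B : V ≃ₗᵢ[ℂ] V) (c : V) (p : V × V) :
    chargeForm A B (c, c) p = Complex.I * ⟪c + A (B c), rotProduct A B p⟫_ℂ := by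
  rw [chargeForm_apply, rotProduct_apply, twistForm_apply, twistForm_apply]
  simp only [map_sub, inner_add_left, inner_add_right, inner_sub_left, inner_sub_right,
    LinearIsometryEquiv.inner_map_map]
  ring

/-- Meyer's signature cocycle of the unitary group. -/
def meyer (A B : V ≃ₗᵢ[ℂ] V) : ℤ :=
  signature (quad (chargeForm A B)) (LinearMap.ker (rotProduct A B))

/-- When the translation part vanishes, the two vectors in the cross term of the charge are
opposite, so the cross term is zero. -/
theorem meyer_eq (A B : V ≃ₗᵢ[ℂ] V) :
    meyer A B = signature (fun z : V × V => quad (twistForm A) z.1 + quad (twistForm B) z.2)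
      (LinearMap.ker (rotProduct A B)) := by
  refine signature_congr fun p hp => ?_
  rw [LinearMap.mem_ker, rotProduct_apply, ← map_sub] at hp
  have h : p.1 - A p.1 = -A (p.2 - B p.2) := eq_neg_of_add_eq_zero_left hp
  simp only [quad]
  rw [chargeForm_apply, h, inner_neg_left, inner_neg_right, sub_self, mul_zero, sub_zero,
    Complex.add_re]

/-- For unitary A a vector orthogonal to the range of 1 - A is fixed by A, so the range is the
orthogonal complement of the fixed vectors. -/
theorem exists_eq_sub_apply [FiniteDimensional ℂ V] (A : V ≃ₗᵢ[ℂ] V) (z : V)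
    (hz : ∀ k, A k = k → ⟪k, z⟫_ℂ = 0) : ∃ c, z = c - A c := by
  let T : V →ₗ[ℂ] V := LinearMap.id - A.toLinearEquiv.toLinearMap
  have hT : ∀ x, T x = x - A x := fun x => rfl
  have h : z ∈ LinearMap.range T := by
    rw [← Submodule.orthogonal_orthogonal (LinearMap.range T), Submodule.mem_orthogonal]
    intro k hk
    refine hz k ?_
    have h1 : ∀ x, ⟪x - A x, k⟫_ℂ = 0 := fun x => (Submodule.mem_orthogonal _ _).1 hk _ ⟨x, rfl⟩
    have h2 : ∀ x, ⟪A x, A k - k⟫_ℂ = 0 := by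
      intro x
      have := h1 x
      rw [inner_sub_left] at this
      rw [inner_sub_right, LinearIsometryEquiv.inner_map_map]
      exact this
    have h3 := h2 (A.symm (A k - k))
    rw [LinearIsometryEquiv.apply_symm_apply] at h3
    exact sub_eq_zero.1 (inner_self_eq_zero.1 h3)
  obtain ⟨c, hc⟩ := h
  exact ⟨c, by rw [← hc, hT]⟩

/-- If the translation part of (u, v) is that of AB about a centre c, then (u - c, v - c) has no
translation part and contributes to `meyer A B`, while (c, y) is the same problem with AB in place
of the pair. Such a c exists exactly on the orthogonal complement of the isotropic space of all ((k,
k), 0) with ABk = k, and `signature_isotropic` allows the restriction to it. -/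
theorem signature_glue [FiniteDimensional ℂ V] [FiniteDimensional ℂ Y] (A B : V ≃ₗᵢ[ℂ] V)
    {S : SesqForm Y} (hS : IsHermForm S) (l : Y →ₗ[ℂ] V) :
    signature (quad ((chargeForm A B).prod S))
        (LinearMap.ker (rotProduct A B ∘ₗ LinearMap.fst ℂ (V × V) Y +
          l ∘ₗ LinearMap.snd ℂ (V × V) Y)) =
      meyer A B + signature (quad ((twistForm (A * B)).prod S))
        (LinearMap.ker ((LinearMap.id - (A * B).toLinearEquiv.toLinearMap) ∘ₗ LinearMap.fst ℂ V Y +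
          l ∘ₗ LinearMap.snd ℂ V Y)) := by
  have hAB : ∀ c, (A * B) c = A (B c) := fun c => rfl
  set W := LinearMap.ker (rotProduct A B ∘ₗ LinearMap.fst ℂ (V × V) Y +
          l ∘ₗ LinearMap.snd ℂ (V × V) Y)
  have hW : ∀ z : (V × V) × Y, z ∈ W ↔ rotProduct A B z.1 + l z.2 = 0 := fun z => Iff.rfl
  set W₂ := LinearMap.ker ((LinearMap.id - (A * B).toLinearEquiv.toLinearMap) ∘ₗ
    LinearMap.fst ℂ V Y + l ∘ₗ LinearMap.snd ℂ V Y)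
  have hW₂ : ∀ z : V × Y, z ∈ W₂ ↔ (z.1 - A (B z.1)) + l z.2 = 0 := fun z => Iff.rfl
  rw [meyer, ← signature_prod (chargeForm_herm A B) ((twistForm_herm (A * B)).prod hS)]
  have hcc : ∀ c, rotProduct A B (c, c) = c - A (B c) := fun c => by
    rw [rotProduct_apply]; abel
  let δ : V →ₗ[ℂ] V × V := LinearMap.prod LinearMap.id LinearMap.id
  have hδ : ∀ c, δ c = (c, c) := fun c => rfl
  -- Puts the centre c back: a closed pair and (c, y) are sent to the pair translated by c, together
  -- with y.
  let f : (V × V) × (V × Y) →ₗ[ℂ] (V × V) × Y :=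
    LinearMap.prod (LinearMap.fst ℂ _ _ + δ ∘ₗ LinearMap.fst ℂ V Y ∘ₗ LinearMap.snd ℂ _ _)
      (LinearMap.snd ℂ V Y ∘ₗ LinearMap.snd ℂ _ _)
  have hf : ∀ z, f z = (z.1 + (z.2.1, z.2.1), z.2.2) := fun z => rfl
  let K : Submodule ℂ V := LinearMap.ker (LinearMap.id - (A * B).toLinearEquiv.toLinearMap)
  have hK : ∀ k, k ∈ K ↔ A (B k) = k := fun k => by
    rw [LinearMap.mem_ker, LinearMap.sub_apply, sub_eq_zero]
    exact eq_comm
  let I : Submodule ℂ ((V × V) × Y) := K.map (LinearMap.inl ℂ (V × V) Y ∘ₗ δ)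
  have hI : ∀ z, z ∈ I ↔ ∃ k, A (B k) = k ∧ ((k, k), 0) = z := fun z => by
    constructor
    · rintro ⟨k, hk, rfl⟩
      exact ⟨k, (hK k).1 hk, rfl⟩
    · rintro ⟨k, hk, rfl⟩
      exact ⟨k, (hK k).2 hk, rfl⟩
  have hpair : ∀ k z, A (B k) = k → (chargeForm A B).prod S ((k, k), 0) z =
      Complex.I * (2 * ⟪k, rotProduct A B z.1⟫_ℂ) := by
    intro k z hk
    rw [SesqForm.prod_apply, chargeForm_diag, hk, map_zero, LinearMap.zero_apply, add_zero,
      inner_add_left]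
    ring
  rw [signature_isotropic ((chargeForm_herm A B).prod hS) (W := W) (I := I)
    (W' := ((LinearMap.ker (rotProduct A B)).prod W₂).map f)]
  · refine (signature_map f rfl (quad_zero _) ?_).symm
    rintro ⟨p, c, y⟩ ⟨hp, hc⟩
    rw [hf]
    simp only [quad_prod]
    rw [quad_add (chargeForm_herm A B), ← chargeForm_herm A B, chargeForm_diag,
      LinearMap.mem_ker.1 hp, inner_zero_right]
    have : quad (chargeForm A B) (c, c) = quad (twistForm (A * B)) c := by
      rw [quad, quad, chargeForm_diag, hcc, twistForm_apply, hAB]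
      simp only [inner_add_left, inner_sub_right, LinearIsometryEquiv.inner_map_map]
      congr 1
      ring
    rw [this]
    simp
    ring
  · intro z hz
    obtain ⟨k, hk, rfl⟩ := (hI z).1 hz
    rw [hW, hcc, hk, sub_self, map_zero, add_zero]
  · intro z hz w hw
    obtain ⟨k, hk, rfl⟩ := (hI z).1 hz
    obtain ⟨k', hk', rfl⟩ := (hI w).1 hw
    rw [hpair _ _ hk, hcc, hk', sub_self, inner_zero_right, mul_zero, mul_zero]
  · intro z
    constructor
    · rintro ⟨⟨p, c, y⟩, ⟨hp, hc⟩, rfl⟩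
      have hc' := (hW₂ _).1 hc
      have hp' : rotProduct A B p = 0 := hp
      have hz : rotProduct A B (p + (c, c)) = c - A (B c) := by rw [map_add, hp', hcc, zero_add]
      refine ⟨?_, fun k hk => ?_⟩
      · rw [hW, hf, hz]
        exact hc'
      · obtain ⟨k, hk', rfl⟩ := (hI k).1 hk
        rw [hpair _ _ hk', hf, hz, inner_sub_right]
        have : ⟪k, A (B c)⟫_ℂ = ⟪k, c⟫_ℂ := by
          conv_lhs => rw [← hk']
          rw [LinearIsometryEquiv.inner_map_map, LinearIsometryEquiv.inner_map_map]
        rw [this, sub_self, mul_zero, mul_zero]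
    · rintro ⟨hz, hk⟩
      -- Orthogonality to I says that the translation part is orthogonal to the fixed vectors of AB,
      -- so AB has a centre c that produces it.
      obtain ⟨c, hc⟩ := exists_eq_sub_apply (A * B) (rotProduct A B z.1) (by
        intro k hk'
        have := hk ((k, k), 0) ((hI _).2 ⟨k, hk', rfl⟩)
        rw [hpair _ _ hk'] at this
        simpa using this)
      rw [hAB] at hc
      refine ⟨(z.1 - (c, c), (c, z.2)), ⟨?_, ?_⟩, ?_⟩
      · change rotProduct A B (z.1 - (c, c)) = 0
        rw [map_sub, hcc, hc, sub_self]
      · rw [SetLike.mem_coe, hW₂, ← hc]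
        exact hz
      · rw [hf]
        simp

/-- Both sides are the signature of the charge on the triples of centres for which the rotations A,
B, C have a product without translation part. On the left A and B are glued first, on the right B
and C. -/
theorem meyer_cocycle [FiniteDimensional ℂ V] (A B C : V ≃ₗᵢ[ℂ] V) :
    meyer A B + meyer (A * B) C = meyer B C + meyer A (B * C) := by
  have h1 := signature_glue A B (twistForm_herm C)
    ((A * B).toLinearEquiv.toLinearMap ∘ₗ (LinearMap.id - C.toLinearEquiv.toLinearMap))
  -- The closing condition for A, B, C is multiplied by A⁻¹, which turns it into one for B, C with A
  -- as the remaining factor.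
  have h2 := signature_glue B C (twistForm_herm A)
    (A⁻¹.toLinearEquiv.toLinearMap - LinearMap.id)
  have h3 : meyer (A * B) C = signature (quad ((twistForm (A * B)).prod (twistForm C)))
        (LinearMap.ker ((LinearMap.id - (A * B).toLinearEquiv.toLinearMap) ∘ₗ
          LinearMap.fst ℂ V V + ((A * B).toLinearEquiv.toLinearMap ∘ₗ
            (LinearMap.id - C.toLinearEquiv.toLinearMap)) ∘ₗ LinearMap.snd ℂ V V)) := meyer_eq _ _
  have hA : ∀ x, A⁻¹ (A x) = x := A.symm_apply_apply
  have hA' : ∀ x, A (A⁻¹ x) = x := A.apply_symm_apply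
  have h4 : signature (quad ((twistForm (B * C)).prod (twistForm A)))
        (LinearMap.ker ((LinearMap.id - (B * C).toLinearEquiv.toLinearMap) ∘ₗ
          LinearMap.fst ℂ V V + (A⁻¹.toLinearEquiv.toLinearMap - LinearMap.id) ∘ₗ
            LinearMap.snd ℂ V V)) = meyer A (B * C) := by
    rw [meyer_eq]
    refine signature_map (LinearEquiv.prodComm ℂ V V).toLinearMap ?_ (by simp [quad_zero]) ?_
    · ext ⟨u, c⟩
      simp only [Submodule.mem_map]
      constructor
      · rintro ⟨⟨c, u⟩, h, h'⟩
        obtain ⟨rfl, rfl⟩ := Prod.mk.inj h'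
        have h : (c - B (C c)) + (A⁻¹ u - u) = 0 := h
        rw [LinearMap.mem_ker, rotProduct_apply]
        have := congrArg A h
        rw [map_add, map_sub, map_sub, map_zero, hA'] at this
        change u - A u + (A c - A (B (C c))) = 0
        rw [← this]; abel
      · intro h
        refine ⟨(c, u), ?_, rfl⟩
        rw [LinearMap.mem_ker, rotProduct_apply] at h
        have := congrArg (A⁻¹ : V ≃ₗᵢ[ℂ] V) h
        rw [map_add, map_sub, map_sub, map_zero, hA, hA, hA] at this
        change (c - B (C c)) + (A⁻¹ u - u) = 0
        rw [← this]
        change _ = _ + (c - B (C c))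
        abel
    · rintro ⟨c, u⟩ -
      exact add_comm _ _
  rw [← h3] at h1
  rw [h4] at h2
  rw [← h1, ← h2]
  let f : (V × V) × V →ₗ[ℂ] (V × V) × V :=
    LinearMap.prod (LinearMap.prod (LinearMap.snd ℂ V V ∘ₗ LinearMap.fst ℂ (V × V) V)
      (LinearMap.snd ℂ (V × V) V)) (LinearMap.fst ℂ V V ∘ₗ LinearMap.fst ℂ (V × V) V)
  have hf : ∀ z, f z = ((z.1.2, z.2), z.1.1) := fun z => rfl
  refine signature_map f ?_ (quad_zero _) ?_
  · ext ⟨⟨v, w⟩, u⟩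
    constructor
    · rintro ⟨⟨⟨u, v⟩, w⟩, h, h'⟩
      rw [hf] at h'
      obtain ⟨h'', rfl⟩ := Prod.mk.inj h'
      obtain ⟨rfl, rfl⟩ := Prod.mk.inj h''
      have h : rotProduct A B (u, v) + A (B (w - C w)) = 0 := h
      change rotProduct B C (v, w) + (A⁻¹ u - u) = 0
      rw [rotProduct_apply] at h ⊢
      have := congrArg (A⁻¹ : V ≃ₗᵢ[ℂ] V) h
      simp only [map_add, map_sub, map_zero, hA] at this
      rw [← this]
      abel
    · intro h
      refine ⟨((u, v), w), ?_, rfl⟩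
      have h : rotProduct B C (v, w) + (A⁻¹ u - u) = 0 := h
      change rotProduct A B (u, v) + A (B (w - C w)) = 0
      rw [rotProduct_apply] at h ⊢
      have := congrArg A h
      simp only [map_add, map_sub, map_zero, hA'] at this
      simp only [map_sub]
      rw [← this]
      abel
  · rintro ⟨⟨u, v⟩, w⟩ h
    have h : rotProduct A B (u, v) + A (B (w - C w)) = 0 := h
    rw [rotProduct_apply, ← map_sub] at h
    have h' : u - A u = -(A (v - B v) + A (B (w - C w))) := by
      rw [eq_neg_iff_add_eq_zero, ← h]; abel
    rw [hf]
    simp only [quad_prod]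
    have e1 : quad (chargeForm A B) (u, v) = quad (twistForm A) u + quad (twistForm B) v -
        (-Complex.I * (⟪u - A u, A (v - B v)⟫_ℂ - ⟪A (v - B v), u - A u⟫_ℂ)).re := by
      simp only [quad, chargeForm_apply, Complex.sub_re, Complex.add_re]
    have e2 : quad (chargeForm B C) (v, w) = quad (twistForm B) v + quad (twistForm C) w -
        (-Complex.I * (⟪v - B v, B (w - C w)⟫_ℂ - ⟪B (w - C w), v - B v⟫_ℂ)).re := by
      simp only [quad, chargeForm_apply, Complex.sub_re, Complex.add_re]
    -- With u - Au replaced by means of the closing condition, the self-pairing of A(v - Bv) cancels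
    -- and A disappears by unitarity.
    have e3 : ⟪u - A u, A (v - B v)⟫_ℂ - ⟪A (v - B v), u - A u⟫_ℂ =
        ⟪v - B v, B (w - C w)⟫_ℂ - ⟪B (w - C w), v - B v⟫_ℂ := by
      rw [h', inner_neg_left, inner_neg_right, inner_add_left, inner_add_right]
      simp only [LinearIsometryEquiv.inner_map_map]
      ring
    rw [e1, e2, e3]
    ring

end Meyer

/-! ## Operators of finite order -/

section FiniteOrder

/-- The root of unity `exp (2πi / n)`. -/
def unityRoot (n : ℕ) : ℂ := Complex.exp (2 * Real.pi * Complex.I / n)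

theorem unityRoot_primitive (n : ℕ) [NeZero n] : IsPrimitiveRoot (unityRoot n) n :=
  Complex.isPrimitiveRoot_exp n (NeZero.ne n)

theorem unityRoot_ne_zero (n : ℕ) : unityRoot n ≠ 0 := Complex.exp_ne_zero _

theorem geom_sum_unityRoot (n : ℕ) {μ : ℂ} (hμ : μ ^ n = 1) :
    ∑ k ∈ Finset.range n, μ ^ k = if μ = 1 then (n : ℂ) else 0 := by
  split_ifs with h
  · simp [h]
  · have := mul_geom_sum μ n
    rw [hμ, sub_self] at this
    exact (mul_eq_zero.1 this).resolve_left (sub_ne_zero.2 h)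

variable {X : Type*} [AddCommGroup X] [Module ℂ X]

/-- The projection onto the eigenspace of the eigenvalue `exp (2πi j / n)` of an operator with
`T ^ n = 1`. -/
def eigenProj (T : End ℂ X) (n j : ℕ) : End ℂ X :=
  (n : ℂ)⁻¹ • ∑ k ∈ Finset.range n, ((unityRoot n)⁻¹ ^ (j * k)) • T ^ k

theorem eigenProj_commute {S T : End ℂ X} (h : Commute S T) (n j : ℕ) :
    Commute S (eigenProj T n j) := by
  unfold eigenProj
  refine Commute.smul_right (Commute.sum_right _ _ _ fun k _ => ?_) _
  exact Commute.smul_right (h.pow_right k) _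

theorem trace_eigenProj (T : End ℂ X) (S : End ℂ X) (n j : ℕ) :
    LinearMap.trace ℂ X (S * eigenProj T n j) = (n : ℂ)⁻¹ * ∑ k ∈ Finset.range n,
      (unityRoot n)⁻¹ ^ (j * k) * LinearMap.trace ℂ X (S * T ^ k) := by
  simp only [eigenProj, mul_smul_comm, Finset.mul_sum, map_smul, map_sum, smul_eq_mul]

variable {T : End ℂ X} {n : ℕ} [NeZero n]

theorem eigenProj_apply (T : End ℂ X) (n j : ℕ) (x : X) : eigenProj T n j x =
    (n : ℂ)⁻¹ • ∑ k ∈ Finset.range n, ((unityRoot n)⁻¹ ^ (j * k)) • (T ^ k) x := by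
  simp [eigenProj, LinearMap.sum_apply]

theorem apply_eigenProj (hT : T ^ n = 1) (j : ℕ) (x : X) :
    T (eigenProj T n j x) = unityRoot n ^ j • eigenProj T n j x := by
  have h1 := (unityRoot_primitive n).pow_eq_one
  rw [eigenProj_apply, map_smul, smul_comm (unityRoot n ^ j), map_sum]
  congr 1
  rw [Finset.smul_sum]
  let g : ℕ → X := fun k => unityRoot n ^ j • ((unityRoot n)⁻¹ ^ (j * k)) • (T ^ k) x
  have hg : ∀ k, T (((unityRoot n)⁻¹ ^ (j * k)) • (T ^ k) x) = g (k + 1) := by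
    intro k
    simp only [g]
    rw [map_smul, ← Module.End.mul_apply, ← pow_succ', smul_smul]
    congr 1
    rw [mul_add, mul_one, pow_add, mul_left_comm, ← mul_pow,
      mul_inv_cancel₀ (unityRoot_ne_zero n), one_pow, mul_one]
  simp only [hg]
  change _ = ∑ k ∈ Finset.range n, g k
  have h2 := Finset.sum_range_succ g n
  rw [Finset.sum_range_succ'] at h2
  -- The summands are periodic modulo n, so shifting the index by one does not change the sum.
  have h3 : g n = g 0 := by
    simp only [g]
    rw [hT, mul_comm j n, pow_mul, inv_pow, h1]
    simp
  rw [h3] at h2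
  exact add_right_cancel h2

theorem eigenProj_of_eigen {μ : ℂ} (hμ : μ ^ n = 1) {x : X} (hx : T x = μ • x) (j : ℕ) :
    eigenProj T n j x = if μ = unityRoot n ^ j then x else 0 := by
  have hk : ∀ k : ℕ, (T ^ k) x = μ ^ k • x := by
    intro k
    induction k with
    | zero => simp
    | succ k ih => rw [pow_succ', Module.End.mul_apply, ih, map_smul, hx, smul_smul, pow_succ]
  have h1 := (unityRoot_primitive n).pow_eq_one
  rw [eigenProj_apply]
  simp only [hk, smul_smul, ← Finset.sum_smul]
  have h2 : ∀ k, (unityRoot n)⁻¹ ^ (j * k) * μ ^ k = ((unityRoot n)⁻¹ ^ j * μ) ^ k := by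
    intro k
    rw [mul_pow, pow_mul]
  simp only [h2]
  rw [geom_sum_unityRoot]
  · have h3 : (unityRoot n)⁻¹ ^ j * μ = 1 ↔ μ = unityRoot n ^ j := by
      rw [inv_pow, inv_mul_eq_one₀ (pow_ne_zero _ (unityRoot_ne_zero n)), eq_comm]
    simp only [h3]
    split_ifs
    · rw [inv_mul_cancel₀ (Nat.cast_ne_zero.2 (NeZero.ne n)), one_smul]
    · rw [mul_zero, zero_smul]
  · rw [mul_pow, hμ, ← pow_mul, mul_comm j n, pow_mul, inv_pow, h1]
    simp

theorem sum_eigenProj (T : End ℂ X) (x : X) :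
    ∑ j ∈ Finset.range n, eigenProj T n j x = x := by
  simp only [eigenProj_apply]
  rw [← Finset.smul_sum, Finset.sum_comm]
  simp only [← Finset.sum_smul, mul_comm _ (_ : ℕ), pow_mul]
  have h1 := (unityRoot_primitive n)
  rw [Finset.sum_eq_single 0]
  · simp only [pow_zero, one_pow, Finset.sum_const, Finset.card_range, nsmul_eq_mul, mul_one,
      Module.End.one_apply, smul_smul]
    rw [inv_mul_cancel₀ (Nat.cast_ne_zero.2 (NeZero.ne n)), one_smul]
  · intro k hk hk0
    have hpow : (unityRoot n)⁻¹ ^ (k : ℕ) ≠ 1 := by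
      rw [inv_pow, Ne, inv_eq_one]
      exact h1.pow_ne_one_of_pos_of_lt hk0 (Finset.mem_range.1 hk)
    rw [geom_sum_unityRoot, if_neg hpow, zero_smul]
    rw [← pow_mul, mul_comm, pow_mul, inv_pow, h1.pow_eq_one, inv_one, one_pow]
  · intro h
    exact absurd (Finset.mem_range.2 (Nat.pos_of_ne_zero (NeZero.ne n))) h

theorem eigenProj_isProj (hT : T ^ n = 1) (j : ℕ) :
    LinearMap.IsProj (End.eigenspace T (unityRoot n ^ j)) (eigenProj T n j) where
  map_mem x := End.mem_eigenspace_iff.2 (apply_eigenProj hT j x)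
  map_id x hx := by
    rw [eigenProj_of_eigen (by
      rw [← pow_mul, mul_comm, pow_mul, (unityRoot_primitive n).pow_eq_one, one_pow])
      (End.mem_eigenspace_iff.1 hx), if_pos rfl]

theorem unityRoot_pow_inj {i j : ℕ} (hi : i < n) (hj : j < n)
    (h : unityRoot n ^ i = unityRoot n ^ j) : i = j :=
  (unityRoot_primitive n).pow_inj hi hj h

theorem eigenProj_eigenProj (hT : T ^ n = 1) {i j : ℕ} (hi : i < n) (hj : j < n) (x : X) :
    eigenProj T n i (eigenProj T n j x) = if i = j then eigenProj T n j x else 0 := by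
  rw [eigenProj_of_eigen (by
      rw [← pow_mul, mul_comm, pow_mul, (unityRoot_primitive n).pow_eq_one, one_pow])
      (apply_eigenProj hT j x)]
  by_cases h : i = j
  · simp [h]
  · rw [if_neg h, if_neg fun h' => h (unityRoot_pow_inj hj hi h').symm]

/-- The weighted sum of the dimensions of the eigenspaces of `T` in a subspace with a commuting
projection is a trace. -/
theorem sum_finrank_inf_eigenspace [FiniteDimensional ℂ X] (hT : T ^ n = 1) {S : End ℂ X}
    (hS : Commute S T) {W : Submodule ℂ X} (hW : LinearMap.IsProj W S) :
    ∑ j ∈ Finset.range n, unityRoot n ^ j *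
      (finrank ℂ ↥(End.eigenspace T (unityRoot n ^ j) ⊓ W) : ℂ) = LinearMap.trace ℂ X (T * S) := by
  have h1 : ∀ j, (finrank ℂ ↥(End.eigenspace T (unityRoot n ^ j) ⊓ W) : ℂ) =
      LinearMap.trace ℂ X (eigenProj T n j * S) := by
    intro j
    refine (LinearMap.IsProj.trace (p := End.eigenspace T (unityRoot n ^ j) ⊓ W)
      (f := eigenProj T n j * S) ⟨fun x => Submodule.mem_inf.2 ⟨?_, ?_⟩, ?_⟩).symm
    · exact (eigenProj_isProj hT j).map_mem _
    · rw [(eigenProj_commute hS n j).symm.eq]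
      exact hW.map_mem _
    · rintro x ⟨hx, hx'⟩
      rw [Module.End.mul_apply, hW.map_id x hx', (eigenProj_isProj hT j).map_id x hx]
  have h2 : T * S = ∑ j ∈ Finset.range n, unityRoot n ^ j • (eigenProj T n j * S) := by
    apply LinearMap.ext
    intro x
    rw [Module.End.mul_apply, ← sum_eigenProj (n := n) T (S x), map_sum, LinearMap.sum_apply]
    exact Finset.sum_congr rfl fun j _ => apply_eigenProj hT j _
  rw [h2, map_sum]
  refine Finset.sum_congr rfl fun j _ => ?_
  rw [h1, map_smul, smul_eq_mul]

theorem sum_finrank_eigenspace [FiniteDimensional ℂ X] (hT : T ^ n = 1) :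
    ∑ j ∈ Finset.range n, unityRoot n ^ j *
      (finrank ℂ (End.eigenspace T (unityRoot n ^ j)) : ℂ) = LinearMap.trace ℂ X T := by
  have := sum_finrank_inf_eigenspace hT (Commute.one_left T) (W := ⊤)
    ⟨fun _ => trivial, fun _ _ => rfl⟩
  rw [mul_one] at this
  rw [← this]
  refine Finset.sum_congr rfl fun j _ => ?_
  rw [(LinearEquiv.ofEq _ _ (inf_top_eq (End.eigenspace T (unityRoot n ^ j)))).finrank_eq]

/-- The sum of the eigenspaces with index in `J`. -/
def eigenSum (T : End ℂ X) (n : ℕ) (J : Finset ℕ) : Submodule ℂ X :=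
  LinearMap.range (∑ j ∈ J, eigenProj T n j)

theorem eigenProj_sum (hT : T ^ n = 1) {J : Finset ℕ} (hJ : J ⊆ Finset.range n) {i : ℕ}
    (hi : i < n) (x : X) : eigenProj T n i ((∑ j ∈ J, eigenProj T n j) x) =
      if i ∈ J then eigenProj T n i x else 0 := by
  rw [LinearMap.sum_apply, map_sum]
  rw [Finset.sum_congr rfl fun j hj => eigenProj_eigenProj hT hi (Finset.mem_range.1 (hJ hj)) x]
  simp

theorem eigenSum_isProj (hT : T ^ n = 1) {J : Finset ℕ} (hJ : J ⊆ Finset.range n) :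
    LinearMap.IsProj (eigenSum T n J) (∑ j ∈ J, eigenProj T n j) where
  map_mem x := ⟨x, rfl⟩
  map_id := by
    rintro _ ⟨x, rfl⟩
    conv_lhs => rw [LinearMap.sum_apply]
    conv_rhs => rw [LinearMap.sum_apply]
    refine Finset.sum_congr rfl fun i hi => ?_
    rw [eigenProj_sum hT hJ (Finset.mem_range.1 (hJ hi)), if_pos hi]

theorem finrank_eigenSum [FiniteDimensional ℂ X] (hT : T ^ n = 1) {J : Finset ℕ}
    (hJ : J ⊆ Finset.range n) :
    finrank ℂ (eigenSum T n J) = ∑ j ∈ J, finrank ℂ (End.eigenspace T (unityRoot n ^ j)) := by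
  have h := (eigenSum_isProj hT hJ).trace
  rw [map_sum] at h
  rw [Finset.sum_congr rfl fun j _ => (eigenProj_isProj hT j).trace] at h
  exact_mod_cast h.symm

end FiniteOrder

/-! ## The signature cocycle of a finite group -/

section FiniteCocycle

variable {V : Type*} [NormedAddCommGroup V] [InnerProductSpace ℂ V]

theorem quad_twistForm (A : V ≃ₗᵢ[ℂ] V) (x : V) : quad (twistForm A) x = 2 * (⟪x, A x⟫_ℂ).im := by
  have h := congrArg Complex.im (inner_conj_symm (A x) x)
  rw [Complex.conj_im] at h
  rw [quad, twistForm_apply, ← neg_mul_eq_neg_mul, Complex.neg_re, Complex.I_mul_re,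
    Complex.sub_im, ← h]
  ring

/-- The underlying endomorphism of a unitary operator. -/
abbrev unitaryEnd (A : V ≃ₗᵢ[ℂ] V) : End ℂ V := A.toLinearEquiv.toLinearMap

theorem unitaryEnd_pow (A : V ≃ₗᵢ[ℂ] V) (k : ℕ) : unitaryEnd A ^ k = unitaryEnd (A ^ k) := by
  induction k with
  | zero => rfl
  | succ k ih => rw [pow_succ, ih, pow_succ]; rfl

theorem norm_unityRoot (n : ℕ) [NeZero n] : ‖unityRoot n‖ = 1 :=
  Complex.norm_eq_one_of_pow_eq_one (unityRoot_primitive n).pow_eq_one (NeZero.ne n)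

/-- A unitary operator has orthogonal eigenspaces: for a unit eigenvalue, conjugation is inversion.
-/
theorem inner_eigenProj {A : V ≃ₗᵢ[ℂ] V} {n : ℕ} [NeZero n] (hA : A ^ n = 1) {i j : ℕ}
    (hi : i < n) (hj : j < n) (hij : i ≠ j) (x y : V) :
    ⟪eigenProj (unitaryEnd A) n i x, eigenProj (unitaryEnd A) n j y⟫_ℂ = 0 := by
  have hT : unitaryEnd A ^ n = 1 := by rw [unitaryEnd_pow, hA]; rfl
  have h1 : A (eigenProj (unitaryEnd A) n i x) = unityRoot n ^ i • eigenProj (unitaryEnd A) n i x :=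
    apply_eigenProj hT i x
  have h2 : A (eigenProj (unitaryEnd A) n j y) = unityRoot n ^ j • eigenProj (unitaryEnd A) n j y :=
    apply_eigenProj hT j y
  have h3 := A.inner_map_map (eigenProj (unitaryEnd A) n i x) (eigenProj (unitaryEnd A) n j y)
  rw [h1, h2, inner_smul_left, inner_smul_right] at h3
  by_contra hne
  rw [← mul_assoc] at h3
  have h4 := mul_right_cancel₀ hne (h3.trans (one_mul _).symm)
  rw [← Complex.inv_eq_conj (by rw [norm_pow, norm_unityRoot, one_pow]),
    inv_mul_eq_one₀ (pow_ne_zero _ (unityRoot_ne_zero n))] at h4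
  exact hij (unityRoot_pow_inj hi hj h4)

theorem quad_twistForm_pow {A : V ≃ₗᵢ[ℂ] V} {n : ℕ} [NeZero n] (hA : A ^ n = 1) (k : ℕ) (x : V) :
    quad (twistForm (A ^ k)) x = ∑ j ∈ Finset.range n,
      2 * (unityRoot n ^ (j * k)).im * ‖eigenProj (unitaryEnd A) n j x‖ ^ 2 := by
  have hT : unitaryEnd A ^ n = 1 := by rw [unitaryEnd_pow, hA]; rfl
  have hk : ∀ j, (A ^ k) (eigenProj (unitaryEnd A) n j x) =
      unityRoot n ^ (j * k) • eigenProj (unitaryEnd A) n j x := by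
    intro j
    have h1 := apply_eigenProj hT j x
    have : ∀ m : ℕ, (A ^ m) (eigenProj (unitaryEnd A) n j x) =
      unityRoot n ^ (j * m) • eigenProj (unitaryEnd A) n j x := by
      intro m
      induction m with
      | zero => simp
      | succ m ih =>
        rw [pow_succ']
        change A ((A ^ m) _) = _
        rw [ih, map_smul]
        change _ • (unitaryEnd A) _ = _
        rw [h1, smul_smul, mul_add, pow_add, mul_one]
    exact this k
  have h2 : ⟪x, (A ^ k) x⟫_ℂ = ∑ j ∈ Finset.range n,
      unityRoot n ^ (j * k) * (‖eigenProj (unitaryEnd A) n j x‖ ^ 2 : ℝ) := by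
    conv_lhs => rw [← sum_eigenProj (n := n) (unitaryEnd A) x, map_sum, sum_inner]
    refine Finset.sum_congr rfl fun i hi => ?_
    rw [inner_sum, Finset.sum_eq_single i]
    · rw [hk, inner_smul_right, inner_self_eq_norm_sq_to_K]
      simp
    · intro j hj hij
      rw [hk, inner_smul_right, inner_eigenProj hA (Finset.mem_range.1 hi)
        (Finset.mem_range.1 hj) hij.symm, mul_zero]
    · exact fun h => absurd hi h
  rw [quad_twistForm, h2, Complex.im_sum, Finset.mul_sum]
  refine Finset.sum_congr rfl fun j _ => ?_
  rw [Complex.im_mul_ofReal]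
  ring

/-- The coefficient of the signature form of the pair `(α, β)` of unit complex numbers. -/
def rotWeight (α β : ℂ) : ℝ := α.im * ‖1 - β‖ ^ 2 + β.im * ‖1 - α‖ ^ 2

/-- A and its power are diagonal in the same decomposition, so the form on the kernel splits over
the eigenspaces of A. On the eigenspace with eigenvalues (α, β) it is a multiple of `rotWeight α β`,
and the positive weights are counted. The values ε = 1 and ε = -1 give the two indices. -/
theorem posIndex_pow [FiniteDimensional ℂ V] {A : V ≃ₗᵢ[ℂ] V} {n : ℕ} [NeZero n] (hA : A ^ n = 1)
    (k : ℕ) (ε : ℝ) :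
    posIndex (fun z : V × V => ε * (quad (twistForm A) z.1 + quad (twistForm (A ^ k)) z.2))
      (LinearMap.ker (rotProduct A (A ^ k))) =
    ∑ j ∈ (Finset.range n).filter fun j => 0 < ε * rotWeight (unityRoot n ^ j) (unityRoot n ^ (j * k)),
      finrank ℂ (End.eigenspace (unitaryEnd A) (unityRoot n ^ j)) := by
  have hT : unitaryEnd A ^ n = 1 := by rw [unitaryEnd_pow, hA]; rfl
  set J := (Finset.range n).filter fun j =>
    0 < ε * rotWeight (unityRoot n ^ j) (unityRoot n ^ (j * k)) with hJ
  have hJn : J ⊆ Finset.range n := Finset.filter_subset _ _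
  set E := eigenProj (unitaryEnd A) n with hE
  have hEA : ∀ j x, E j (A x) = unityRoot n ^ j • E j x := by
    intro j x
    rw [← apply_eigenProj hT j x]
    exact (LinearMap.congr_fun (eigenProj_commute (Commute.refl (unitaryEnd A)) n j).eq x).symm
  have hEAk : ∀ j x, E j ((A ^ k) x) = unityRoot n ^ (j * k) • E j x := by
    intro j
    have : ∀ (m : ℕ) x, E j ((A ^ m) x) = unityRoot n ^ (j * m) • E j x := by
      intro m
      induction m with
      | zero => simp
      | succ m ih =>
        intro x
        rw [pow_succ']
        change E j (A ((A ^ m) x)) = _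
        rw [hEA, ih, smul_smul, mul_add, mul_one, pow_add, mul_comm]
    exact this k
  have hq : ∀ z : V × V, quad (twistForm A) z.1 + quad (twistForm (A ^ k)) z.2 =
      ∑ j ∈ Finset.range n, (2 * (unityRoot n ^ j).im * ‖E j z.1‖ ^ 2 +
        2 * (unityRoot n ^ (j * k)).im * ‖E j z.2‖ ^ 2) := by
    intro z
    rw [Finset.sum_add_distrib, ← quad_twistForm_pow hA k]
    have := quad_twistForm_pow hA 1 z.1
    simp only [mul_one] at this
    rw [← this, pow_one]
  have hunit : ∀ j : ℕ, ‖unityRoot n ^ j‖ = 1 := fun j => by rw [norm_pow, norm_unityRoot, one_pow]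
  -- The syzygy of the commuting operators 1 - A and A(1 - A^k); on eigenspaces with α ≠ 1 it
  -- parametrizes the whole kernel.
  let ψ : V →ₗ[ℂ] V × V := LinearMap.prod
    (-(unitaryEnd A * (LinearMap.id - unitaryEnd (A ^ k)))) (LinearMap.id - unitaryEnd A)
  have hψ : ∀ x, ψ x = (-A (x - (A ^ k) x), x - A x) := fun x => rfl
  have hcomm : ∀ x, A ((A ^ k) x) = (A ^ k) (A x) := by
    intro x
    change (A * A ^ k) x = (A ^ k * A) x
    rw [← pow_succ', ← pow_succ]
  have hψW : ∀ x, ψ x ∈ LinearMap.ker (rotProduct A (A ^ k)) := by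
    intro x
    rw [LinearMap.mem_ker, rotProduct_apply, hψ]
    simp only [map_sub, map_neg, hcomm]
    abel
  have hqψ : ∀ x, quad (twistForm A) (ψ x).1 + quad (twistForm (A ^ k)) (ψ x).2 =
      ∑ j ∈ Finset.range n, 2 * rotWeight (unityRoot n ^ j) (unityRoot n ^ (j * k)) *
        ‖E j x‖ ^ 2 := by
    intro x
    rw [hq]
    refine Finset.sum_congr rfl fun j _ => ?_
    have h1 : ‖E j (ψ x).1‖ = ‖1 - unityRoot n ^ (j * k)‖ * ‖E j x‖ := by
      have : E j (ψ x).1 = -(unityRoot n ^ j • (1 - unityRoot n ^ (j * k)) • E j x) := by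
        rw [hψ, map_neg, hEA, map_sub, hEAk, sub_smul, one_smul]
      rw [this, norm_neg, norm_smul, norm_smul, hunit, one_mul]
    have h2 : ‖E j (ψ x).2‖ = ‖1 - unityRoot n ^ j‖ * ‖E j x‖ := by
      have : E j (ψ x).2 = (1 - unityRoot n ^ j) • E j x := by
        rw [hψ, map_sub, hEA, sub_smul, one_smul]
      rw [this, norm_smul]
    rw [h1, h2, rotWeight]
    ring
  have hpos : ∀ x ∈ eigenSum (unitaryEnd A) n J, x ≠ 0 →
      0 < ε * (quad (twistForm A) (ψ x).1 + quad (twistForm (A ^ k)) (ψ x).2) := by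
    intro x hx hne
    have hx' := (eigenSum_isProj hT hJn).map_id x hx
    rw [hqψ, Finset.mul_sum]
    have hterm : ∀ j ∈ Finset.range n, E j x ≠ 0 → 0 < ε * (2 * rotWeight (unityRoot n ^ j)
        (unityRoot n ^ (j * k)) * ‖E j x‖ ^ 2) := by
      intro j hj hjx
      have hjJ : j ∈ J := by
        by_contra hcon
        apply hjx
        rw [← hx', hE, eigenProj_sum hT hJn (Finset.mem_range.1 hj), if_neg hcon]
      have h1 := (Finset.mem_filter.1 hjJ).2
      have h2 : 0 < ‖E j x‖ ^ 2 := by positivity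
      have := mul_pos h1 h2
      nlinarith
    have : ∃ j ∈ Finset.range n, E j x ≠ 0 := by
      by_contra! hcon
      apply hne
      rw [← sum_eigenProj (n := n) (unitaryEnd A) x]
      exact Finset.sum_eq_zero hcon
    obtain ⟨j, hj, hjx⟩ := this
    refine Finset.sum_pos' (fun i hi => ?_) ⟨j, hj, hterm j hj hjx⟩
    by_cases h : E i x = 0
    · simp [h]
    · exact (hterm i hi h).le
  have hrel : ∀ z ∈ LinearMap.ker (rotProduct A (A ^ k)), ∀ j, (1 - unityRoot n ^ j) • E j z.1 =
      -(unityRoot n ^ j • (1 - unityRoot n ^ (j * k)) • E j z.2) := by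
    intro z hz j
    rw [LinearMap.mem_ker, rotProduct_apply] at hz
    have := congrArg (E j) hz
    rw [map_add, map_sub, map_sub, hEA, hEA, hEA, hEAk, map_zero] at this
    rw [eq_neg_iff_add_eq_zero, ← this, sub_smul, sub_smul, smul_sub, one_smul, one_smul]
  -- The nonpositive part consists of the pairs whose second entry has no component in the positive
  -- eigenspaces.
  rw [posIndex_eq (P := (eigenSum (unitaryEnd A) n J).map ψ)
    (N := LinearMap.ker (rotProduct A (A ^ k)) ⊓
      LinearMap.ker ((∑ j ∈ J, E j) ∘ₗ LinearMap.snd ℂ V V)), ← finrank_eigenSum hT hJn,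
    ← LinearMap.range_domRestrict]
  · refine LinearMap.finrank_range_of_inj ?_
    rw [← LinearMap.ker_eq_bot, eq_bot_iff]
    rintro ⟨x, hx⟩ h
    have h' : ψ x = 0 := h
    by_contra hne
    have := hpos x hx fun h => hne (by simp [h])
    rw [h'] at this
    simp [quad_zero] at this
  · apply le_antisymm
    · refine sup_le ?_ inf_le_left
      rintro _ ⟨x, -, rfl⟩
      exact hψW x
    · intro z hz
      -- Inverts 1 - A on the positive part of the second entry, so that subtracting ψ x removes
      -- this part.
      let x : V := ∑ j ∈ J, (1 - unityRoot n ^ j)⁻¹ • E j z.2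
      have hx : x ∈ eigenSum (unitaryEnd A) n J := by
        refine Submodule.sum_mem _ fun j hj => Submodule.smul_mem _ _ ⟨E j z.2, ?_⟩
        rw [LinearMap.sum_apply, Finset.sum_eq_single j]
        · rw [hE, eigenProj_eigenProj hT (Finset.mem_range.1 (hJn hj))
            (Finset.mem_range.1 (hJn hj)), if_pos rfl]
        · intro i hi hij
          rw [hE, eigenProj_eigenProj hT (Finset.mem_range.1 (hJn hi))
            (Finset.mem_range.1 (hJn hj)), if_neg hij]
        · exact fun h => absurd hj h
      -- If α = 1 then β = 1 as well and the weight is zero, so such an index is not in J.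
      have hne : ∀ j ∈ J, (1 - unityRoot n ^ j) ≠ 0 := by
        intro j hj h0
        have h1 := (Finset.mem_filter.1 hj).2
        have h2 : unityRoot n ^ j = 1 := (sub_eq_zero.1 h0).symm
        rw [pow_mul, h2, rotWeight] at h1
        simp at h1
      have hEx : ∀ j ∈ J, E j (ψ x).2 = E j z.2 := by
        intro j hj
        have h1 : E j x = (1 - unityRoot n ^ j)⁻¹ • E j z.2 := by
          simp only [x]
          rw [map_sum, Finset.sum_eq_single j]
          · rw [map_smul, hE, eigenProj_eigenProj hT (Finset.mem_range.1 (hJn hj))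
              (Finset.mem_range.1 (hJn hj)), if_pos rfl]
          · intro i hi hij
            rw [map_smul, hE, eigenProj_eigenProj hT (Finset.mem_range.1 (hJn hj))
              (Finset.mem_range.1 (hJn hi)), if_neg hij.symm, smul_zero]
          · exact fun h => absurd hj h
        rw [hψ, map_sub, hEA, h1, smul_smul]
        nth_rewrite 1 [← one_smul ℂ ((1 - unityRoot n ^ j)⁻¹ • E j z.2)]
        rw [smul_smul, ← sub_smul, ← sub_mul, mul_inv_cancel₀ (hne j hj), one_smul]
      refine Submodule.mem_sup.2 ⟨ψ x, ⟨x, hx, rfl⟩, z - ψ x,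
        ⟨Submodule.sub_mem _ hz (hψW x), ?_⟩, by abel⟩
      rw [SetLike.mem_coe, LinearMap.mem_ker, LinearMap.comp_apply, LinearMap.snd_apply, LinearMap.sum_apply]
      refine Finset.sum_eq_zero fun j hj => ?_
      rw [Prod.snd_sub, map_sub, hEx j hj, sub_self]
  · rintro _ ⟨x, hx, rfl⟩ hne
    exact hpos x hx fun h => hne (by rw [h, map_zero])
  · rintro z ⟨hz, hz'⟩
    have hzJ : ∀ j ∈ J, E j z.2 = 0 := by
      intro j hj
      have h1 := congrArg (E j) (show (∑ j ∈ J, E j) z.2 = 0 from hz')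
      rw [hE, eigenProj_sum hT hJn (Finset.mem_range.1 (hJn hj)), if_pos hj, map_zero] at h1
      exact h1
    rw [hq, Finset.mul_sum]
    refine Finset.sum_nonpos fun j hj => ?_
    have h1 := congrArg (fun w => ‖w‖ ^ 2) (hrel z hz j)
    simp only [norm_neg, norm_smul, hunit, one_mul, mul_pow] at h1
    by_cases hα : unityRoot n ^ j = 1
    · rw [pow_mul, hα]
      simp
    · have h2 : 0 < ‖1 - unityRoot n ^ j‖ ^ 2 := by
        have : (1 - unityRoot n ^ j) ≠ 0 := fun h => hα (sub_eq_zero.1 h).symm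
        positivity
      by_cases hjJ : j ∈ J
      · rw [hzJ j hjJ, norm_zero] at h1
        have h3 : ‖E j z.1‖ ^ 2 = 0 := by
          refine (mul_eq_zero.1 (h1.trans ?_)).resolve_left h2.ne'
          simp
        rw [h3, hzJ j hjJ]
        simp
      · have h3 : ε * rotWeight (unityRoot n ^ j) (unityRoot n ^ (j * k)) ≤ 0 := by
          by_contra hcon
          exact hjJ (Finset.mem_filter.2 ⟨hj, not_le.1 hcon⟩)
        -- Multiplying by |1 - α|² allows the first entry to be eliminated through the kernel
        -- relation.
        have h4 : ‖1 - unityRoot n ^ j‖ ^ 2 * (ε * (2 * (unityRoot n ^ j).im * ‖E j z.1‖ ^ 2 +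
            2 * (unityRoot n ^ (j * k)).im * ‖E j z.2‖ ^ 2)) =
            2 * (ε * rotWeight (unityRoot n ^ j) (unityRoot n ^ (j * k))) * ‖E j z.2‖ ^ 2 := by
          rw [rotWeight]
          linear_combination (2 * ε * (unityRoot n ^ j).im) * h1
        by_contra hcon
        have h5 := mul_pos h2 (not_le.1 hcon)
        rw [h4] at h5
        have : 0 ≤ ‖E j z.2‖ ^ 2 := by positivity
        nlinarith

/-- The sawtooth function `1 - 2j/n` for `0 < j < n`, with value `0` at `0`. -/
def sawtooth (n j : ℕ) : ℝ := if j = 0 then 0 else 1 - 2 * j / n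

theorem unityRoot_pow_eq (n j : ℕ) :
    unityRoot n ^ j = Complex.exp ((2 * (Real.pi * j / n) : ℝ) * Complex.I) := by
  rw [unityRoot, ← Complex.exp_nat_mul]
  congr 1
  push_cast
  ring

theorem rotWeight_eq (n j l : ℕ) : rotWeight (unityRoot n ^ j) (unityRoot n ^ l) =
    8 * (Real.sin (Real.pi * j / n) * Real.sin (Real.pi * l / n) *
      Real.sin (Real.pi * (j + l) / n)) := by
  have him : ∀ x : ℝ, (Complex.exp ((2 * x : ℝ) * Complex.I)).im = 2 * Real.sin x * Real.cos x := by
    intro x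
    rw [Complex.exp_ofReal_mul_I_im, Real.sin_two_mul]
  have hnorm : ∀ x : ℝ, ‖1 - Complex.exp ((2 * x : ℝ) * Complex.I)‖ ^ 2 = 4 * Real.sin x ^ 2 := by
    intro x
    rw [← Complex.normSq_eq_norm_sq, Complex.normSq_apply, Complex.sub_re, Complex.sub_im,
      Complex.exp_ofReal_mul_I_im, Complex.exp_ofReal_mul_I_re, Complex.one_re, Complex.one_im,
      Real.cos_two_mul, Real.sin_two_mul, Real.cos_sq']
    linear_combination (4 * Real.sin x ^ 2) * Real.sin_sq_add_cos_sq x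
  rw [rotWeight, unityRoot_pow_eq, unityRoot_pow_eq, him, him, hnorm, hnorm]
  have : Real.pi * (j + l) / n = Real.pi * j / n + Real.pi * l / n := by ring
  rw [this, Real.sin_add]
  ring

/-- The first two sines are positive for 0 < j, l < n, so the sign is that of sin(π(j + l)/n),
namely 1, 0, -1 as j + l is below, equal to or above n. The sawtooth combination takes these same
values. If j or l is 0, both sides vanish. -/
theorem sign_rotWeight (n j l : ℕ) [NeZero n] (hj : j < n) (hl : l < n) :
    ((SignType.sign (rotWeight (unityRoot n ^ j) (unityRoot n ^ l)) : SignType) : ℝ) =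
      sawtooth n j + sawtooth n l - sawtooth n ((j + l) % n) := by
  have hn : (0 : ℝ) < n := Nat.cast_pos.2 (Nat.pos_of_ne_zero (NeZero.ne n))
  rw [rotWeight_eq]
  rcases Nat.eq_zero_or_pos j with rfl | hj0
  · simp [Nat.mod_eq_of_lt hl, sawtooth]
  rcases Nat.eq_zero_or_pos l with rfl | hl0
  · simp [Nat.mod_eq_of_lt hj, sawtooth]
  have hsin : ∀ m : ℕ, 0 < m → m < n → 0 < Real.sin (Real.pi * m / n) := by
    intro m hm hmn
    have hm' : (0 : ℝ) < m := Nat.cast_pos.2 hm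
    refine Real.sin_pos_of_pos_of_lt_pi (by positivity) ?_
    rw [div_lt_iff₀ hn]
    exact mul_lt_mul_of_pos_left (Nat.cast_lt.2 hmn) Real.pi_pos
  have h1 := hsin j hj0 hj
  have h2 := hsin l hl0 hl
  have h12 := mul_pos h1 h2
  have hsj : sawtooth n j = 1 - 2 * j / n := if_neg hj0.ne'
  have hsl : sawtooth n l = 1 - 2 * l / n := if_neg hl0.ne'
  rw [hsj, hsl, ← Nat.cast_add]
  rcases lt_trichotomy (j + l) n with h | h | h
  · have h3 := hsin (j + l) (by omega) h
    rw [sign_pos (by positivity), Nat.mod_eq_of_lt h, sawtooth, if_neg (by omega),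
      SignType.coe_one]
    push_cast
    field_simp
    ring
  · have hc : (j : ℝ) + l = n := by exact_mod_cast h
    rw [h, Nat.mod_self, sawtooth, if_pos rfl, mul_div_cancel_right₀ Real.pi hn.ne', Real.sin_pi,
      mul_zero, mul_zero, sign_zero]
    simp only [SignType.coe_zero]
    field_simp
    linarith
  · have hmod : (j + l) % n = j + l - n := by
      rw [Nat.mod_eq_sub_mod h.le, Nat.mod_eq_of_lt (by omega)]
    have h3 : Real.sin (Real.pi * (j + l : ℕ) / n) < 0 := by
      have h4 := hsin (j + l - n) (by omega) (by omega)
      have h5 : Real.pi * (j + l : ℕ) / n = Real.pi * (j + l - n : ℕ) / n + Real.pi := by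
        rw [Nat.cast_sub h.le]
        field_simp
        ring
      rw [h5, Real.sin_add_pi]
      linarith
    rw [sign_neg (by nlinarith), hmod, sawtooth, if_neg (by omega), Nat.cast_sub h.le,
      SignType.coe_neg_one]
    push_cast
    field_simp
    ring

/-- On each eigenspace the signature is the sign of the weight, which `sign_rotWeight` writes as a
coboundary of the sawtooth function. -/
theorem meyer_pow [FiniteDimensional ℂ V] {A : V ≃ₗᵢ[ℂ] V} {n : ℕ} [NeZero n] (hA : A ^ n = 1)
    (k : ℕ) : (meyer A (A ^ k) : ℝ) = ∑ j ∈ Finset.range n,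
      (sawtooth n j + sawtooth n (j * k % n) - sawtooth n (j * (k + 1) % n)) *
        finrank ℂ (End.eigenspace (unitaryEnd A) (unityRoot n ^ j)) := by
  rw [meyer_eq, signature]
  have h1 := posIndex_pow hA k 1
  have h2 := posIndex_pow hA k (-1)
  simp only [one_mul, neg_one_mul] at h1 h2
  have h3 : -(fun z : V × V => quad (twistForm A) z.1 + quad (twistForm (A ^ k)) z.2) =
    fun z : V × V => -(quad (twistForm A) z.1 + quad (twistForm (A ^ k)) z.2) := rfl
  rw [h3, h1, h2, Finset.sum_filter, Finset.sum_filter]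
  push_cast
  rw [← Finset.sum_sub_distrib]
  refine Finset.sum_congr rfl fun j hj => ?_
  have hj := Finset.mem_range.1 hj
  have hpow : unityRoot n ^ (j * k) = unityRoot n ^ (j * k % n) :=
    pow_eq_pow_mod _ (unityRoot_primitive n).pow_eq_one
  have h4 : (j + j * k % n) % n = j * (k + 1) % n := by
    rw [Nat.add_mod_mod]
    congr 1
    ring
  rw [hpow, ← h4, ← sign_rotWeight n j _ hj (Nat.mod_lt _ (Nat.pos_of_ne_zero (NeZero.ne n)))]
  rcases lt_trichotomy 0 (rotWeight (unityRoot n ^ j) (unityRoot n ^ (j * k % n))) with h | h | h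
  · rw [if_pos h, if_neg (by linarith), sign_pos h]; simp
  · rw [if_neg (by linarith), if_neg (by linarith), ← h]; simp
  · rw [if_neg (by linarith), if_pos (by linarith), sign_neg h]; simp

variable {Γ : Type*} [Group Γ] [Fintype Γ]

/-- The function on the finite group `Γ` whose coboundary is Meyer's cocycle. -/
def meyerDefect (π : Γ →* (V ≃ₗᵢ[ℂ] V)) (g : Γ) : ℝ :=
  (Fintype.card Γ : ℝ)⁻¹ * ∑ h : Γ, (meyer (π g) (π h) : ℝ)

/-- Averaging the cocycle identity over its third argument kills a 2-cocycle of a finite group with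
real coefficients. -/
theorem meyer_eq_defect [FiniteDimensional ℂ V] (π : Γ →* (V ≃ₗᵢ[ℂ] V)) (g h : Γ) :
    (meyer (π g) (π h) : ℝ) = meyerDefect π g + meyerDefect π h - meyerDefect π (g * h) := by
  have hc : (Fintype.card Γ : ℝ) ≠ 0 := Nat.cast_ne_zero.2 Fintype.card_ne_zero
  have h1 : ∑ k : Γ, ((meyer (π g) (π h) : ℝ) + meyer (π (g * h)) (π k)) =
      ∑ k : Γ, ((meyer (π h) (π k) : ℝ) + meyer (π g) (π (h * k))) := by
    refine Finset.sum_congr rfl fun k _ => ?_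
    rw [map_mul, map_mul]
    exact_mod_cast meyer_cocycle (π g) (π h) (π k)
  have h2 : ∑ k : Γ, (meyer (π g) (π (h * k)) : ℝ) = ∑ k : Γ, (meyer (π g) (π k) : ℝ) :=
    Fintype.sum_equiv (Equiv.mulLeft h) _ _ fun _ => rfl
  rw [Finset.sum_add_distrib, Finset.sum_add_distrib, h2, Finset.sum_const, Finset.card_univ,
    nsmul_eq_mul] at h1
  unfold meyerDefect
  field_simp
  linarith

/-- The values of the cocycle on (g, g^k) are summed over k. The coboundary expression telescopes to
n times the defect, and the sawtooth expression of `meyer_pow` telescopes in the same way. -/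
theorem meyerDefect_eq [FiniteDimensional ℂ V] (π : Γ →* (V ≃ₗᵢ[ℂ] V)) (g : Γ) {n : ℕ} [NeZero n]
    (hg : g ^ n = 1) : meyerDefect π g = ∑ j ∈ Finset.range n, sawtooth n j *
      finrank ℂ (End.eigenspace (unitaryEnd (π g)) (unityRoot n ^ j)) := by
  have hn : (n : ℝ) ≠ 0 := Nat.cast_ne_zero.2 (NeZero.ne n)
  have hA : π g ^ n = 1 := by rw [← map_pow, hg, map_one]
  have h1 : ∑ k ∈ Finset.range n, (meyer (π g) (π g ^ k) : ℝ) = n * meyerDefect π g := by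
    have : ∀ k, (meyer (π g) (π g ^ k) : ℝ) =
        meyerDefect π g - (meyerDefect π (g ^ (k + 1)) - meyerDefect π (g ^ k)) := by
      intro k
      rw [← map_pow, meyer_eq_defect, pow_succ']
      ring
    simp only [this]
    rw [Finset.sum_sub_distrib, Finset.sum_range_sub (fun k => meyerDefect π (g ^ k)), hg, pow_zero,
      sub_self, sub_zero, Finset.sum_const, Finset.card_range, nsmul_eq_mul]
  have h2 : ∑ k ∈ Finset.range n, (meyer (π g) (π g ^ k) : ℝ) = n * ∑ j ∈ Finset.range n,
      sawtooth n j * finrank ℂ (End.eigenspace (unitaryEnd (π g)) (unityRoot n ^ j)) := by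
    simp only [meyer_pow hA]
    rw [Finset.sum_comm, Finset.mul_sum]
    refine Finset.sum_congr rfl fun j _ => ?_
    rw [← Finset.sum_mul, ← mul_assoc]
    congr 1
    have : ∀ k, sawtooth n j + sawtooth n (j * k % n) - sawtooth n (j * (k + 1) % n) =
        sawtooth n j - (sawtooth n (j * (k + 1) % n) - sawtooth n (j * k % n)) := fun k => by ring
    simp only [this]
    rw [Finset.sum_sub_distrib, Finset.sum_range_sub (fun k => sawtooth n (j * k % n)),
      Nat.mul_mod_left, mul_zero, Nat.zero_mod, sub_self, sub_zero, Finset.sum_const,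
      Finset.card_range, nsmul_eq_mul]
  exact mul_left_cancel₀ hn (h1.symm.trans h2)

/-- An involution has zero defect: the eigenvalue 1 has weight 0 by convention, and -1 has weight 1
- 2·1/2 = 0. -/
theorem meyer_eq_sum [FiniteDimensional ℂ V] (π : Γ →* (V ≃ₗᵢ[ℂ] V)) (g h : Γ) {n : ℕ} [NeZero n]
    (hg : g ^ n = 1) (hh : h ^ 2 = 1) (hgh : (g * h) ^ n = 1) :
    (meyer (π g) (π h) : ℝ) = ∑ j ∈ Finset.range n, sawtooth n j *
      ((finrank ℂ (End.eigenspace (unitaryEnd (π g)) (unityRoot n ^ j)) : ℝ) -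
        finrank ℂ (End.eigenspace (unitaryEnd (π (g * h))) (unityRoot n ^ j))) := by
  have : meyerDefect π h = 0 := by
    rw [meyerDefect_eq π h hh, Finset.sum_range_succ, Finset.sum_range_one]
    simp [sawtooth]
  rw [meyer_eq_defect, this, meyerDefect_eq π g hg, meyerDefect_eq π (g * h) hgh, add_zero,
    ← Finset.sum_sub_distrib]
  exact Finset.sum_congr rfl fun j _ => (mul_sub _ _ _).symm

end FiniteCocycle

/-! ## Chains of a surface -/

namespace GSurface

variable {G : Type*} [Group G] (s : GSurface G)

theorem rot_pow_valence (d : s.Dart) : (s.rot ^ s.valence d) d = d := by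
  rw [← Equiv.Perm.iterate_eq_pow]
  exact Function.iterate_minimalPeriod

theorem rot_pow_eq_self_iff (d : s.Dart) (k : ℕ) : (s.rot ^ k) d = d ↔ s.valence d ∣ k := by
  rw [← Equiv.Perm.iterate_eq_pow]
  exact Function.isPeriodicPt_iff_minimalPeriod_dvd

theorem _root_.Finset.sum_range_mul_of_periodic {M : Type*} [AddCommMonoid M] {h : ℕ → M} {m : ℕ}
    (hm : ∀ j, h (j + m) = h j) (t : ℕ) :
    ∑ j ∈ Finset.range (m * t), h j = t • ∑ j ∈ Finset.range m, h j := by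
  induction t with
  | zero => simp
  | succ t ih =>
    rw [mul_add, mul_one, add_comm, Finset.sum_range_add, succ_nsmul', ← ih]
    congr 1
    exact Finset.sum_congr rfl fun j _ => by rw [add_comm, hm]

/-- Replaces a sum of vertex means by a plain sum over darts, without choosing a dart at each
vertex. -/
theorem sum_inv_valence {K : Type*} [Field K] [CharZero K] (g : s.Dart → K) :
    ∑ d, (s.valence d : K)⁻¹ * ∑ j ∈ Finset.range (s.valence d), g ((s.rot ^ j) d) = ∑ d, g d := by
  -- A common period of all vertices: every mean becomes a mean over N steps, and then the sums can
  -- be exchanged.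
  set N := orderOf s.rot
  have hN0 : 0 < N := orderOf_pos _
  have hN : (N : K) ≠ 0 := Nat.cast_ne_zero.2 hN0.ne'
  have h1 : ∀ d, (s.valence d : K)⁻¹ * ∑ j ∈ Finset.range (s.valence d), g ((s.rot ^ j) d) =
      (N : K)⁻¹ * ∑ j ∈ Finset.range N, g ((s.rot ^ j) d) := by
    intro d
    obtain ⟨t, ht⟩ : s.valence d ∣ N :=
      (s.rot_pow_eq_self_iff d N).1 (by rw [pow_orderOf_eq_one]; rfl)
    have hv : (s.valence d : K) ≠ 0 := Nat.cast_ne_zero.2 (s.valence_pos d).ne'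
    have ht0 : (t : K) ≠ 0 := Nat.cast_ne_zero.2 (by rintro rfl; omega)
    rw [ht, Finset.sum_range_mul_of_periodic (h := fun j => g ((s.rot ^ j) d)), nsmul_eq_mul]
    · push_cast
      field_simp
    · intro j
      rw [pow_add, Equiv.Perm.mul_apply, rot_pow_valence]
  simp only [h1]
  rw [← Finset.mul_sum, Finset.sum_comm]
  have h2 : ∀ j : ℕ, ∑ d, g ((s.rot ^ j) d) = ∑ d, g d := fun j =>
    Equiv.sum_comp (s.rot ^ j) g
  simp only [h2]
  rw [Finset.sum_const, Finset.card_range, nsmul_eq_mul, inv_mul_cancel_left₀ hN]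

theorem sum_sub_rot {K : Type*} [AddCommGroup K] (y : s.Dart → K) (d : s.Dart) :
    ∑ i ∈ Finset.range (s.valence d), (y ((s.rot ^ i) d) - y (s.rot ((s.rot ^ i) d))) = 0 := by
  have h : ∀ i, s.rot ((s.rot ^ i) d) = (s.rot ^ (i + 1)) d := fun i => by
    rw [pow_succ', Equiv.Perm.mul_apply]
  simp only [h]
  rw [Finset.sum_range_sub' (fun i => y ((s.rot ^ i) d)), rot_pow_valence, pow_zero,
    Equiv.Perm.one_apply, sub_self]

/-- Abel summation at each vertex: the partial sums of z and w telescope to y and x. The terms with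
the value at the initial dart drop out because a cycle sums to zero around a vertex. -/
theorem intersection_eq (z w : s.cycles) (y x : s.Dart → ℝ)
    (hz : ∀ d, (z : s.Dart → ℝ) d = y d - y (s.rot d))
    (hw : ∀ d, (w : s.Dart → ℝ) d = x d - x (s.rot d)) :
    s.intersection z w = (∑ d, (y d * x (s.rot d) - y (s.rot d) * x d)) / 2 := by
  have hsucc : ∀ d i, s.rot ((s.rot ^ i) d) = (s.rot ^ (i + 1)) d := fun d i => by
    rw [pow_succ', Equiv.Perm.mul_apply]
  rw [intersection, ← s.sum_inv_valence (fun d => y d * x (s.rot d) - y (s.rot d) * x d), Finset.sum_div]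
  refine Finset.sum_congr rfl fun d _ => ?_
  rw [mul_div_assoc]
  congr 1
  have h1 : ∀ j, ∑ i ∈ Finset.range j, (z : s.Dart → ℝ) ((s.rot ^ i) d) =
      y d - y ((s.rot ^ j) d) := by
    intro j
    simp only [hz, hsucc]
    rw [Finset.sum_range_sub' (fun i => y ((s.rot ^ i) d))]
    rfl
  have h2 : ∀ j, ∑ i ∈ Finset.range j, (w : s.Dart → ℝ) ((s.rot ^ i) d) =
      x d - x ((s.rot ^ j) d) := by
    intro j
    simp only [hw, hsucc]
    rw [Finset.sum_range_sub' (fun i => x ((s.rot ^ i) d))]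
    rfl
  have h3 : ∀ j, ∑ i ∈ Finset.range j, ((z : s.Dart → ℝ) ((s.rot ^ i) d) *
      (w : s.Dart → ℝ) ((s.rot ^ j) d) - (z : s.Dart → ℝ) ((s.rot ^ j) d) *
      (w : s.Dart → ℝ) ((s.rot ^ i) d)) / 2 =
      ((y d * (w : s.Dart → ℝ) ((s.rot ^ j) d) - x d * (z : s.Dart → ℝ) ((s.rot ^ j) d)) +
       (y ((s.rot ^ j) d) * x (s.rot ((s.rot ^ j) d)) -
        y (s.rot ((s.rot ^ j) d)) * x ((s.rot ^ j) d))) / 2 := by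
    intro j
    rw [← Finset.sum_div, Finset.sum_sub_distrib, ← Finset.sum_mul, ← Finset.mul_sum, h1, h2, hz, hw]
    ring
  simp only [h3]
  rw [← Finset.sum_div, Finset.sum_add_distrib, Finset.sum_sub_distrib, ← Finset.mul_sum,
    ← Finset.mul_sum, z.2.2, w.2.2]
  ring

/-- The complex functions on the darts. -/
abbrev Chain : Type := EuclideanSpace ℂ s.Dart

/-- The action of the permutations of the darts on functions. -/
def permAct : Equiv.Perm s.Dart →* (s.Chain ≃ₗᵢ[ℂ] s.Chain) where
  toFun p := LinearIsometryEquiv.piLpCongrLeft 2 ℂ ℂ p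
  map_one' := by ext; rfl
  map_mul' p q := by ext; rfl

theorem permAct_apply (p : Equiv.Perm s.Dart) (z : s.Chain) (d : s.Dart) :
    s.permAct p z d = z (p⁻¹ d) := rfl

theorem inner_chain (z w : s.Chain) : ⟪z, w⟫_ℂ = ∑ d, conj (z d) * w d := by
  rw [PiLp.inner_apply]
  exact Finset.sum_congr rfl fun d _ => by rw [RCLike.inner_apply, mul_comm]

/-- The complex cellular cycles. -/
def complexCycles : Submodule ℂ s.Chain where
  carrier := {z | (∀ d, z (s.rev d) = -z d) ∧
    ∀ d, ∑ i ∈ Finset.range (s.valence d), z ((s.rot ^ i) d) = 0}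
  zero_mem' := by simp
  add_mem' := by
    rintro z w ⟨h1, h2⟩ ⟨h3, h4⟩
    refine ⟨fun d => ?_, fun d => ?_⟩
    · simp only [PiLp.add_apply, h1, h3]; ring
    · simp only [PiLp.add_apply, Finset.sum_add_distrib, h2, h4, add_zero]
  smul_mem' := by
    rintro c z ⟨h1, h2⟩
    refine ⟨fun d => ?_, fun d => ?_⟩
    · simp only [PiLp.smul_apply, h1, smul_neg]
    · simp only [PiLp.smul_apply, ← Finset.smul_sum, h2, smul_zero]

/-- Cycles are orthogonal to the functions on the vertices. -/
theorem inner_eq_zero_of_cycle {z k : s.Chain} (hz : z ∈ s.complexCycles)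
    (hk : ∀ d, k (s.rot d) = k d) : ⟪k, z⟫_ℂ = 0 := by
  rw [inner_chain, ← s.sum_inv_valence]
  refine Finset.sum_eq_zero fun d _ => ?_
  have h : ∀ j : ℕ, k ((s.rot ^ j) d) = k d := by
    intro j
    induction j with
    | zero => rfl
    | succ j ih => rw [pow_succ', Equiv.Perm.mul_apply, hk, ih]
  simp only [h]
  rw [← Finset.mul_sum, hz.2, mul_zero, mul_zero]

/-- The vertex functions are the fixed vectors of the rotation operator, and cycles are orthogonal
to them. -/
theorem exists_eq_sub_rot {z : s.Chain} (hz : z ∈ s.complexCycles) :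
    ∃ u : s.Chain, ∀ d, z d = u d - u (s.rot d) := by
  obtain ⟨u, hu⟩ := exists_eq_sub_apply (s.permAct s.rot⁻¹) z fun k hk =>
    s.inner_eq_zero_of_cycle hz fun d => by
      conv_rhs => rw [← hk]
      rw [permAct_apply, inv_inv]
  refine ⟨u, fun d => ?_⟩
  conv_lhs => rw [hu]
  rw [PiLp.sub_apply, permAct_apply, inv_inv]

/-- The real part of a complex cycle. -/
def reCycle : s.complexCycles →ₗ[ℝ] s.cycles where
  toFun z := ⟨fun d => ((z : s.Chain) d).re, fun d => by
    change ((z : s.Chain) (s.rev d)).re = -((z : s.Chain) d).re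
    rw [z.2.1, Complex.neg_re], fun d => by
    rw [← Complex.re_sum, z.2.2, Complex.zero_re]⟩
  map_add' z w := Subtype.ext (funext fun d => by simp)
  map_smul' c z := Subtype.ext (funext fun d => by simp)

/-- The imaginary part of a complex cycle. -/
def imCycle : s.complexCycles →ₗ[ℝ] s.cycles where
  toFun z := ⟨fun d => ((z : s.Chain) d).im, fun d => by
    change ((z : s.Chain) (s.rev d)).im = -((z : s.Chain) d).im
    rw [z.2.1, Complex.neg_im], fun d => by
    rw [← Complex.im_sum, z.2.2, Complex.zero_im]⟩
  map_add' z w := Subtype.ext (funext fun d => by simp)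
  map_smul' c z := Subtype.ext (funext fun d => by simp)

/-- The complex cycle with given real and imaginary parts. -/
def mkCycle (x y : s.cycles) : s.complexCycles :=
  ⟨WithLp.toLp 2 fun d => ⟨(x : s.Dart → ℝ) d, (y : s.Dart → ℝ) d⟩, fun d => by
    apply Complex.ext <;> simp [x.2.1 d, y.2.1 d], fun d => by
    apply Complex.ext
    · rw [Complex.re_sum]; exact x.2.2 d
    · rw [Complex.im_sum]; exact y.2.2 d⟩

theorem reCycle_mkCycle (x y : s.cycles) : s.reCycle (s.mkCycle x y) = x := rfl

theorem imCycle_mkCycle (x y : s.cycles) : s.imCycle (s.mkCycle x y) = y := rfl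

/-- The complex linear extension of a real linear map on cycles. -/
def complexify {E : Type*} [AddCommGroup E] [Module ℂ E] (L : s.cycles →ₗ[ℝ] E) :
    s.complexCycles →ₗ[ℂ] E where
  toFun z := L (s.reCycle z) + Complex.I • L (s.imCycle z)
  map_add' z w := by simp only [map_add, smul_add]; abel
  map_smul' c z := by
    have h1 : s.reCycle (c • z) = c.re • s.reCycle z - c.im • s.imCycle z :=
      Subtype.ext (funext fun d => by
        change (c * (z : s.Chain) d).re = _
        rw [Complex.mul_re]; rfl)
    have h2 : s.imCycle (c • z) = c.re • s.imCycle z + c.im • s.reCycle z :=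
      Subtype.ext (funext fun d => by
        change (c * (z : s.Chain) d).im = _
        rw [Complex.mul_im]; rfl)
    have h3 : ∀ (r : ℝ) (x : E), r • x = (r : ℂ) • x := fun r x => (Complex.coe_smul r x).symm
    rw [h1, h2, map_sub, map_add, map_smul, map_smul, map_smul, map_smul]
    simp only [h3, smul_add, smul_smul, RingHom.id_apply]
    conv_rhs => rw [← Complex.re_add_im c]
    have h4 : ((c.re : ℂ) + c.im * Complex.I) * Complex.I = Complex.I * c.re - c.im := by
      linear_combination (c.im : ℂ) * Complex.I_mul_I
    rw [h4, add_smul, sub_smul, mul_comm (c.im : ℂ) Complex.I]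
    abel

theorem mem_boundaries_iff (z : s.cycles) : s.homologyClass z = 0 ↔
    ∃ f : s.Dart → ℝ, (∀ d, f ((s.rot⁻¹ * s.rev) d) = f d) ∧
      ∀ d, (z : s.Dart → ℝ) d = f d - f (s.rev d) := by
  rw [homologyClass, Submodule.mkQ_apply, Submodule.Quotient.mk_eq_zero]
  rfl

end GSurface

/-! ## The unitary representation of a surface action -/

theorem exists_compression {E : Type*} [NormedAddCommGroup E] [InnerProductSpace ℂ E]
    [FiniteDimensional ℂ E] (Z : Submodule ℂ E) (R : E →ₗ[ℂ] E) (c : ℂ) :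
    ∃ Q : E →ₗ[ℂ] Z, ∀ (z : Z) (x : E), ⟪z, Q x⟫_ℂ = c * ⟪(z : E), R x⟫_ℂ := by
  refine ⟨c • (LinearMap.adjoint Z.subtype ∘ₗ R), fun z x => ?_⟩
  rw [LinearMap.smul_apply, inner_smul_right, LinearMap.comp_apply, LinearMap.adjoint_inner_right]
  rfl

namespace GSurface

variable {G : Type*} [Group G] (s : GSurface G)

theorem rev_inv : s.rev⁻¹ = s.rev := by
  ext d
  rw [Equiv.Perm.inv_eq_iff_eq, s.rev_rev]

/-- The operator `y ↦ y ∘ rot`. -/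
def rotOp : s.Chain ≃ₗᵢ[ℂ] s.Chain := s.permAct s.rot⁻¹

theorem rotOp_apply (y : s.Chain) (d : s.Dart) : s.rotOp y d = y (s.rot d) := by
  rw [rotOp, permAct_apply, inv_inv]

/-- Complex conjugation of chains. -/
def conjChain (z : s.Chain) : s.Chain := WithLp.toLp 2 fun d => conj (z d)

theorem conjChain_apply (z : s.Chain) (d : s.Dart) : s.conjChain z d = conj (z d) := rfl

theorem inner_conjChain (z w : s.Chain) : ⟪s.conjChain z, s.conjChain w⟫_ℂ = conj ⟪z, w⟫_ℂ := by
  rw [inner_chain, inner_chain, map_sum]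
  simp [conjChain_apply]

theorem conjChain_conjChain (z : s.Chain) : s.conjChain (s.conjChain z) = z := by
  ext d
  simp [conjChain_apply]

theorem conjChain_mem {z : s.Chain} (hz : z ∈ s.complexCycles) :
    s.conjChain z ∈ s.complexCycles := by
  refine ⟨fun d => ?_, fun d => ?_⟩
  · simp only [conjChain_apply, hz.1, map_neg]
  · simp only [conjChain_apply]
    rw [← map_sum, hz.2, map_zero]

theorem permAct_toPerm_mem (a : G) {z : s.Chain} (hz : z ∈ s.complexCycles) :
    s.permAct (MulAction.toPerm a) z ∈ s.complexCycles := by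
  have h : ∀ d, s.permAct (MulAction.toPerm a) z d = z (a⁻¹ • d) := fun d => rfl
  refine ⟨fun d => ?_, fun d => ?_⟩
  · rw [h, h, s.smul_rev, hz.1]
  · simp only [h, s.smul_rot_pow]
    rw [← s.valence_smul a⁻¹ d]
    exact hz.2 _

theorem permAct_toPerm_rotOp (a : G) (y : s.Chain) :
    s.permAct (MulAction.toPerm a) (s.rotOp y) = s.rotOp (s.permAct (MulAction.toPerm a) y) := by
  ext d
  rw [rotOp_apply]
  change s.rotOp y (a⁻¹ • d) = y (a⁻¹ • s.rot d)
  rw [rotOp_apply, s.smul_rot]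

/-- Sesquilinear extension of the intersection form, as an operator on the cycles. -/
theorem exists_hermOp : ∃ N : End ℂ s.complexCycles, ∀ (z w : s.complexCycles) (y x : s.Chain),
    (z : s.Chain) = y - s.rotOp y → (w : s.Chain) = x - s.rotOp x →
      ⟪z, N w⟫_ℂ = Complex.I / 2 * (⟪y, s.rotOp x⟫_ℂ - ⟪s.rotOp y, x⟫_ℂ) := by
  let φ : s.Chain →ₗ[ℂ] s.Chain := LinearMap.id - unitaryEnd s.rotOp
  have hφ : ∀ y, φ y = y - s.rotOp y := fun y => rfl
  have hle : s.complexCycles ≤ LinearMap.range φ := by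
    intro z hz
    obtain ⟨u, hu⟩ := s.exists_eq_sub_rot hz
    refine ⟨u, ?_⟩
    ext d
    rw [hφ, PiLp.sub_apply, rotOp_apply, hu]
  obtain ⟨t, ht⟩ := φ.rangeRestrict.exists_rightInverse_of_surjective (LinearMap.range_rangeRestrict φ)
  let S : s.complexCycles →ₗ[ℂ] s.Chain := t ∘ₗ Submodule.inclusion hle
  have hS : ∀ z, φ (S z) = z := fun z =>
    congrArg Subtype.val (LinearMap.congr_fun ht (Submodule.inclusion hle z))
  -- For z = y - Ry, unitarity gives ⟨z, x + Rx⟩ = ⟨y, Rx⟩ - ⟨Ry, x⟩; so the form is the compression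
  -- of 1 + R to the cycles, precomposed with a choice of primitive.
  obtain ⟨Q, hQ⟩ := exists_compression s.complexCycles (LinearMap.id + unitaryEnd s.rotOp)
    (Complex.I / 2)
  refine ⟨Q ∘ₗ S, ?_⟩
  have key : ∀ (z w : s.complexCycles) (y : s.Chain), (z : s.Chain) = y - s.rotOp y →
      ⟪z, (Q ∘ₗ S) w⟫_ℂ =
      Complex.I / 2 * (⟪y, s.rotOp (S w)⟫_ℂ - ⟪s.rotOp y, S w⟫_ℂ) := by
    intro z w y hy
    rw [LinearMap.comp_apply, hQ]
    congr 1
    change ⟪(z : s.Chain), S w + s.rotOp (S w)⟫_ℂ = _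
    rw [hy, inner_sub_left, inner_add_right, inner_add_right, LinearIsometryEquiv.inner_map_map]
    ring
  intro z w y x hy hx
  rw [key z w y hy]
  congr 1
  -- the value does not depend on the choice of the primitive
  have h1 : s.rotOp (S w - x) = S w - x := by
    have h2 : (S w - x) - s.rotOp (S w - x) = 0 := by
      have h3 := (hφ (S w)).symm.trans (hS w)
      rw [map_sub]
      rw [hx] at h3
      rw [sub_sub_sub_comm, h3, sub_self]
    exact (sub_eq_zero.1 h2).symm
  have h4 : ⟪y, s.rotOp (S w - x)⟫_ℂ - ⟪s.rotOp y, S w - x⟫_ℂ = 0 := by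
    conv_lhs => rw [← h1]
    rw [LinearIsometryEquiv.inner_map_map, h1, h1, sub_self]
  rw [map_sub, inner_sub_right, inner_sub_right] at h4
  linear_combination h4

/-- A real cycle as a complex cycle. -/
def toComplex (z : s.cycles) : s.complexCycles := s.mkCycle z 0

theorem toComplex_apply (z : s.cycles) (d : s.Dart) :
    (s.toComplex z : s.Chain) d = ((z : s.Dart → ℝ) d : ℂ) := rfl

theorem exists_real_primitive (z : s.cycles) :
    ∃ y : s.Dart → ℝ, ∀ d, (z : s.Dart → ℝ) d = y d - y (s.rot d) := by
  obtain ⟨u, hu⟩ := s.exists_eq_sub_rot (s.toComplex z).2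
  refine ⟨fun d => (u d).re, fun d => ?_⟩
  have := congrArg Complex.re (hu d)
  rwa [toComplex_apply, Complex.ofReal_re, Complex.sub_re] at this

/-- This version is visibly linear in w and needs a primitive of z only. -/
theorem intersection_eq_sum (z w : s.cycles) (y : s.Dart → ℝ)
    (hz : ∀ d, (z : s.Dart → ℝ) d = y d - y (s.rot d)) :
    s.intersection z w = -(∑ d, (y d + y (s.rot d)) * (w : s.Dart → ℝ) d) / 2 := by
  obtain ⟨x, hw⟩ := s.exists_real_primitive w
  rw [s.intersection_eq z w y x hz hw]
  congr 1
  have h1 : ∑ d, y (s.rot d) * x (s.rot d) = ∑ d, y d * x d :=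
    Equiv.sum_comp s.rot fun d => y d * x d
  have h2 : ∑ d, (y d + y (s.rot d)) * (w : s.Dart → ℝ) d =
      ∑ d, (y (s.rot d) * x d - y d * x (s.rot d)) + (∑ d, y d * x d -
        ∑ d, y (s.rot d) * x (s.rot d)) := by
    rw [← Finset.sum_sub_distrib, ← Finset.sum_add_distrib]
    exact Finset.sum_congr rfl fun d _ => by rw [hw]; ring
  rw [h2, h1, sub_self, add_zero, ← Finset.sum_neg_distrib]
  exact Finset.sum_congr rfl fun d _ => by ring

/-- A boundary z = f - f ∘ rev has the primitive y = -f ∘ rev. Then y + y ∘ rot is even under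
reversal while w is odd, so their pairing is zero. -/
theorem intersection_boundary {z : s.cycles} (hz : s.homologyClass z = 0) (w : s.cycles) :
    s.intersection z w = 0 := by
  obtain ⟨f, h1, h2⟩ := (s.mem_boundaries_iff z).1 hz
  have h3 : ∀ d, f (s.rev (s.rot d)) = f d := by
    intro d
    rw [← h1]
    simp [s.rev_rev]
  rw [s.intersection_eq_sum z w (fun d => -f (s.rev d)) (fun d => by rw [h2, h3]; ring)]
  have h4 : ∑ d, (-f (s.rev d) + -f (s.rev (s.rot d))) * (w : s.Dart → ℝ) d =
      -∑ d, (-f (s.rev d) + -f (s.rev (s.rot d))) * (w : s.Dart → ℝ) d := by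
    conv_lhs => rw [← Equiv.sum_comp s.rev]
    rw [← Finset.sum_neg_distrib]
    refine Finset.sum_congr rfl fun d _ => ?_
    rw [h3, h3, s.rev_rev, w.2.1]
    ring
  linarith

/-- The intersection form is nondegenerate. -/
theorem homologyClass_eq_zero {z : s.cycles} (hz : ∀ w, s.intersection z w = 0) :
    s.homologyClass z = 0 := by
  obtain ⟨y, hy⟩ := s.exists_real_primitive z
  let O : Submodule ℂ s.Chain := End.eigenspace (unitaryEnd (s.permAct s.rev)) (-1)
  let K : Submodule ℂ s.Chain := End.eigenspace (unitaryEnd s.rotOp) 1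
  have hO : ∀ w : s.Chain, w ∈ O ↔ ∀ d, w (s.rev d) = -w d := by
    intro w
    rw [End.mem_eigenspace_iff]
    constructor
    · intro h d
      have := congrArg (fun v : s.Chain => v d) h
      change w (s.rev⁻¹ d) = (-1 : ℂ) * w d at this
      rw [← s.rev_inv, this, neg_one_mul]
    · intro h
      ext d
      change w (s.rev⁻¹ d) = (-1 : ℂ) * w d
      rw [s.rev_inv, h, neg_one_mul]
  have hK : ∀ w : s.Chain, w ∈ K ↔ ∀ d, w (s.rot d) = w d := by
    intro w
    rw [End.mem_eigenspace_iff]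
    constructor
    · intro h d
      have := congrArg (fun v : s.Chain => v d) h
      change s.rotOp w d = (1 : ℂ) * w d at this
      rwa [rotOp_apply, one_mul] at this
    · intro h
      ext d
      change s.rotOp w d = (1 : ℂ) * w d
      rw [rotOp_apply, h, one_mul]
  -- The function against which `intersection_eq_sum` integrates cycles.
  let u : s.Chain := WithLp.toLp 2 fun d => ((y d + y (s.rot d) : ℝ) : ℂ)
  have hu : ∀ d, u d = ((y d + y (s.rot d) : ℝ) : ℂ) := fun d => rfl
  have hZ : ∀ w ∈ O ⊓ Kᗮ, w ∈ s.complexCycles := by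
    rintro w ⟨h1, h2⟩
    refine ⟨(hO w).1 h1, ?_⟩
    have h2 : w ∈ Kᗮ := h2
    obtain ⟨x, rfl⟩ := exists_eq_sub_apply s.rotOp w fun k hk => by
      refine (Submodule.mem_orthogonal _ _).1 h2 k ((hK k).2 fun d => ?_)
      rw [← rotOp_apply, hk]
    intro d
    simp only [PiLp.sub_apply, rotOp_apply]
    exact s.sum_sub_rot (fun d => x d) d
  have horth : u ∈ (O ⊓ Kᗮ)ᗮ := by
    rw [Submodule.mem_orthogonal']
    intro w hw
    have hr := s.intersection_eq_sum z (s.reCycle ⟨w, hZ w hw⟩) y hy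
    have hi := s.intersection_eq_sum z (s.imCycle ⟨w, hZ w hw⟩) y hy
    rw [hz] at hr hi
    have hr' : ∑ d, (y d + y (s.rot d)) * (w d).re = 0 := by
      change 0 = -(∑ d, (y d + y (s.rot d)) * (w d).re) / 2 at hr
      linarith
    have hi' : ∑ d, (y d + y (s.rot d)) * (w d).im = 0 := by
      change 0 = -(∑ d, (y d + y (s.rot d)) * (w d).im) / 2 at hi
      linarith
    rw [inner_chain]
    simp only [hu, Complex.conj_ofReal]
    apply Complex.ext
    · rw [Complex.re_sum]
      simpa only [Complex.re_ofReal_mul, Complex.zero_re] using hr'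
    · rw [Complex.im_sum]
      simpa only [Complex.im_ofReal_mul, Complex.zero_im] using hi'
  -- Cycles are the odd functions orthogonal to the vertex functions, so u is the sum of an even
  -- function e and a vertex function k.
  rw [← Submodule.orthogonal_orthogonal O, Submodule.inf_orthogonal,
    Submodule.orthogonal_orthogonal] at horth
  obtain ⟨e, he, k, hk, hek⟩ := Submodule.mem_sup.1 horth
  have he' : ∀ d, e (s.rev d) = e d := by
    have h1 : s.permAct s.rev e = e := by
      rw [← sub_eq_zero, ← inner_self_eq_zero (𝕜 := ℂ)]
      have hmem : s.permAct s.rev e - e ∈ O := by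
        rw [hO]
        intro d
        simp only [PiLp.sub_apply, permAct_apply]
        rw [s.rev_inv, s.rev_rev]
        ring
      have h2 := (Submodule.mem_orthogonal _ _).1 he _ hmem
      have h3 : ⟪s.permAct s.rev e - e, s.permAct s.rev e⟫_ℂ = 0 := by
        have h4 : ⟪e - s.permAct s.rev e, e⟫_ℂ = ⟪s.permAct s.rev e - e, s.permAct s.rev e⟫_ℂ := by
          have hrr : s.permAct s.rev (s.permAct s.rev e) = e := by
            ext d
            rw [permAct_apply, permAct_apply, s.rev_inv, s.rev_rev]
          rw [← (s.permAct s.rev).inner_map_map (e - s.permAct s.rev e), map_sub, hrr]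
        rw [← h4, ← neg_sub, inner_neg_left, h2, neg_zero]
      rw [inner_sub_right, h3, h2, sub_zero]
    intro d
    have := congrArg (fun v : s.Chain => v (s.rev d)) h1
    change e (s.rev⁻¹ (s.rev d)) = e (s.rev d) at this
    rw [← this, s.rev_inv, s.rev_rev]
  have hk' := (hK k).1 hk
  -- Primitives are unique up to vertex functions; subtracting half of k makes v + v ∘ rot even.
  let v : s.Dart → ℝ := fun d => y d - (k d).re / 2
  have hv1 : ∀ d, v d + v (s.rot d) = (e d).re := by
    intro d
    have := congrArg (fun v : s.Chain => (v d).re) hek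
    change (e d + k d).re = (u d).re at this
    rw [hu, Complex.ofReal_re, Complex.add_re] at this
    simp only [v]
    rw [hk']
    linarith
  have hv2 : ∀ d, v d - v (s.rot d) = (z : s.Dart → ℝ) d := by
    intro d
    simp only [v]
    rw [hk', hy]
    ring
  -- v + v ∘ rot is even and v - v ∘ rot = z is odd. Their difference gives v ∘ rot = v ∘ rev, hence
  -- v ∘ rev is constant along faces.
  have hv3 : ∀ d, v (s.rot d) = v (s.rev d) := by
    intro d
    have h1 := hv1 d
    have h2 := hv1 (s.rev d)
    have h3 := hv2 d
    have h4 := hv2 (s.rev d)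
    rw [he'] at h2
    rw [z.2.1] at h4
    linarith
  refine (s.mem_boundaries_iff z).2 ⟨fun d => -v (s.rev d), fun d => ?_, fun d => ?_⟩
  · change -v (s.rev (s.rot⁻¹ (s.rev d))) = -v (s.rev d)
    rw [← hv3]
    exact congrArg (fun d => -v d) (s.rot.apply_symm_apply _)
  · change _ = -v (s.rev d) - -v (s.rev (s.rev d))
    rw [s.rev_rev, ← hv2, hv3]
    ring

end GSurface

/-! ### Invariant complex structures from a Hermitian operator -/

section CompatibleStructure

variable {X : Type*} [NormedAddCommGroup X] [InnerProductSpace ℂ X]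

/-- The restriction of a unitary representation to an invariant subspace. -/
def restrictUnitary {Γ : Type*} [Group Γ] (π : Γ →* (X ≃ₗᵢ[ℂ] X)) (Z : Submodule ℂ X)
    (hZ : ∀ g, ∀ z ∈ Z, π g z ∈ Z) : Γ →* (Z ≃ₗᵢ[ℂ] Z) where
  toFun g :=
    { toFun := fun z => ⟨π g z, hZ g z z.2⟩
      invFun := fun z => ⟨π g⁻¹ z, hZ g⁻¹ z z.2⟩
      left_inv := fun z => Subtype.ext (by
        change (π g⁻¹ * π g) (z : X) = z
        rw [← map_mul, inv_mul_cancel, map_one]; rfl)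
      right_inv := fun z => Subtype.ext (by
        change (π g * π g⁻¹) (z : X) = z
        rw [← map_mul, mul_inv_cancel, map_one]; rfl)
      map_add' := fun z w => Subtype.ext (map_add (π g) (z : X) w)
      map_smul' := fun c z => Subtype.ext (map_smul (π g) c (z : X))
      norm_map' := fun z => (π g).norm_map (z : X) }
  map_one' := by
    ext z
    change π 1 (z : X) = z
    rw [map_one]; rfl
  map_mul' g h := by
    ext z
    change π (g * h) (z : X) = π g (π h (z : X))
    rw [map_mul]; rfl

/-- The positive part of a symmetric operator that anticommutes with a conjugation. -/
theorem exists_positive_part [FiniteDimensional ℂ X] {G : Type*} [Group G]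
    (A : G →* (X ≃ₗᵢ[ℂ] X)) (C : X →ₗ⋆[ℂ] X) (hC : ∀ z w, ⟪C z, C w⟫_ℂ = conj ⟪z, w⟫_ℂ)
    (hCC : ∀ z, C (C z) = z) {N : End ℂ X} (hN : N.IsSymmetric) (hNC : ∀ z, N (C z) = -C (N z))
    (hNA : ∀ a z, N (A a z) = A a (N z)) :
    ∃ (g : ℕ) (ρ : G →* Matrix.unitaryGroup (Fin g) ℂ) (ε : X →ₗ[ℂ] (Fin g → ℂ)),
      (∀ z w, C z = z → C w = w →
        ⟪z, N w⟫_ℂ = Complex.I * (dotProduct (star (ε z)) (ε w)).im) ∧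
      (∀ a z, ε (A a z) = Matrix.mulVec (ρ a : Matrix (Fin g) (Fin g) ℂ) (ε z)) ∧
      ∀ τ, ∃ z, C z = z ∧ ε z = τ := by
  classical
  have hn : finrank ℂ X = finrank ℂ X := rfl
  set v := hN.eigenvectorBasis hn
  set t := hN.eigenvalues hn
  have hv : ∀ i, N (v i) = (t i : ℂ) • v i := hN.apply_eigenvectorBasis hn
  -- Eigenvectors of N with different eigenvalues are orthogonal. Below this is used to restrict
  -- sums to the positive eigenvalues.
  have horth : ∀ i (x : X) (μ : ℝ), N x = (μ : ℂ) • x → ⟪v i, x⟫_ℂ ≠ 0 → t i = μ := by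
    intro i x μ hx hne
    have h1 := hN (v i) x
    rw [hv, hx, inner_smul_left, inner_smul_right, Complex.conj_ofReal] at h1
    exact_mod_cast mul_right_cancel₀ hne h1
  have hCv : ∀ i, N (C (v i)) = ((-t i : ℝ) : ℂ) • C (v i) := by
    intro i
    rw [hNC, hv, LinearMap.map_smulₛₗ, Complex.conj_ofReal, Complex.ofReal_neg, neg_smul]
  have hAv : ∀ a i, N (A a (v i)) = (t i : ℂ) • A a (v i) := by
    intro a i
    rw [hNA, hv, map_smul]
  let ι := {i : Fin (finrank ℂ X) // 0 < t i}
  let σ : Fin (Fintype.card ι) ≃ ι := (Fintype.equivFin ι).symm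
  have hsum : ∀ f : Fin (finrank ℂ X) → ℂ, (∀ i, f i ≠ 0 → 0 < t i) →
      ∑ k, f (σ k) = ∑ i, f i := by
    intro f hf
    rw [Equiv.sum_comp σ (fun i : ι => f i), ← Finset.sum_filter_of_ne (p := fun i => 0 < t i)
      (fun i _ => hf i)]
    exact (Finset.sum_subtype (Finset.univ.filter fun i => 0 < t i) (by simp) f).symm
  let M : G → Matrix (Fin (Fintype.card ι)) (Fin (Fintype.card ι)) ℂ := fun a =>
    Matrix.of fun k l => ⟪v (σ k), A a (v (σ l))⟫_ℂ
  have hM1 : M 1 = 1 := by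
    ext k l
    change ⟪v (σ k), A 1 (v (σ l))⟫_ℂ = _
    rw [map_one]
    change ⟪v (σ k), v (σ l)⟫_ℂ = _
    rw [orthonormal_iff_ite.1 v.orthonormal, Matrix.one_apply]
    simp only [Subtype.val_injective.eq_iff, σ.injective.eq_iff]
  have hMmul : ∀ a b, M (a * b) = M a * M b := by
    intro a b
    ext k l
    rw [Matrix.mul_apply]
    change ⟪v (σ k), A (a * b) (v (σ l))⟫_ℂ =
      ∑ m, ⟪v (σ k), A a (v (σ m))⟫_ℂ * ⟪v (σ m), A b (v (σ l))⟫_ℂ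
    rw [hsum (fun m => ⟪v (σ k), A a (v m)⟫_ℂ * ⟪v m, A b (v (σ l))⟫_ℂ)]
    · rw [map_mul]
      change ⟪v (σ k), A a (A b (v (σ l)))⟫_ℂ = _
      conv_lhs => rw [← v.sum_repr' (A b (v (σ l))), map_sum, inner_sum]
      refine Finset.sum_congr rfl fun m _ => ?_
      rw [map_smul, inner_smul_right, mul_comm]
    · intro m hm
      rw [horth m _ _ (hAv b (σ l)) (right_ne_zero_of_mul hm)]
      exact (σ l).2
  have hMstar : ∀ a, star (M a) = M a⁻¹ := by
    intro a
    ext k l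
    rw [Matrix.star_apply]
    change conj ⟪v (σ l), A a (v (σ k))⟫_ℂ = ⟪v (σ k), A a⁻¹ (v (σ l))⟫_ℂ
    rw [inner_conj_symm, ← (A a).inner_map_map (v (σ k))]
    congr 1
    change _ = (A a * A a⁻¹) _
    rw [← map_mul, mul_inv_cancel, map_one]
    rfl
  let ρ : G →* Matrix.unitaryGroup (Fin (Fintype.card ι)) ℂ :=
    { toFun := fun a => ⟨M a, by
        rw [Matrix.mem_unitaryGroup_iff, hMstar, ← hMmul, mul_inv_cancel, hM1]⟩
      map_one' := Subtype.ext hM1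
      map_mul' := fun a b => Subtype.ext (hMmul a b) }
  -- With P the positive part of the form, ⟨z, N w⟩ = P - conj P = 2i Im P on real vectors. The
  -- Hermitian product on the target must therefore be 2P, whence the factor √(2t).
  let r : Fin (finrank ℂ X) → ℂ := fun i => (Real.sqrt (2 * t i) : ℂ)
  have hr : ∀ i, 0 < t i → r i * r i = 2 * t i := by
    intro i hi
    simp only [r]
    rw [← Complex.ofReal_mul, Real.mul_self_sqrt (by positivity)]
    push_cast
    rfl
  let ε : X →ₗ[ℂ] (Fin (Fintype.card ι) → ℂ) :=
    LinearMap.pi fun k => r (σ k) • (innerₛₗ ℂ (v (σ k)))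
  have hε : ∀ z k, ε z k = r (σ k) * ⟪v (σ k), z⟫_ℂ := fun z k => rfl
  refine ⟨Fintype.card ι, ρ, ε, ?_, ?_, ?_⟩
  · intro z w hz hw
    have h1 : ⟪z, N w⟫_ℂ = ∑ i, (t i : ℂ) * (⟪z, v i⟫_ℂ * ⟪v i, w⟫_ℂ) := by
      rw [← v.sum_inner_mul_inner]
      refine Finset.sum_congr rfl fun i _ => ?_
      rw [← hN, hv, inner_smul_left, Complex.conj_ofReal]
      ring
    -- N anticommutes with C, so C carries negative eigenvectors to positive ones; on real vectors
    -- the negative part of the form is minus the conjugate of the positive part.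
    have h2 : ∑ j, (if t j < 0 then (t j : ℂ) * (⟪z, v j⟫_ℂ * ⟪v j, w⟫_ℂ) else 0) =
        ∑ i, (if 0 < t i then -(t i : ℂ) * conj (⟪z, v i⟫_ℂ * ⟪v i, w⟫_ℂ) else 0) := by
      have h3 : ∀ j, ⟪z, v j⟫_ℂ = ∑ i, conj (⟪z, v i⟫_ℂ * ⟪v i, C (v j)⟫_ℂ) := by
        intro j
        rw [← map_sum, v.sum_inner_mul_inner, ← hC, hz, hCC]
      have h4 : ∀ i, conj ⟪v i, w⟫_ℂ = ∑ j, conj ⟪v i, C (v j)⟫_ℂ * ⟪v j, w⟫_ℂ := by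
        intro i
        rw [← hC, hw, ← v.sum_inner_mul_inner]
        refine Finset.sum_congr rfl fun j _ => ?_
        rw [← hC (v i), hCC]
      have h5 : ∀ j, (if t j < 0 then (t j : ℂ) * (⟪z, v j⟫_ℂ * ⟪v j, w⟫_ℂ) else 0) =
          ∑ i, (if 0 < t i then -(t i : ℂ) * (conj ⟪z, v i⟫_ℂ *
            (conj ⟪v i, C (v j)⟫_ℂ * ⟪v j, w⟫_ℂ)) else 0) := by
        intro j
        rw [h3 j]
        by_cases hj : t j < 0
        · rw [if_pos hj, Finset.sum_mul, Finset.mul_sum]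
          refine Finset.sum_congr rfl fun i _ => ?_
          by_cases h0 : ⟪v i, C (v j)⟫_ℂ = 0
          · simp [h0]
          · have := horth i _ _ (hCv j) h0
            rw [if_pos (by linarith), this, map_mul]
            push_cast
            ring
        · rw [if_neg hj]
          symm
          refine Finset.sum_eq_zero fun i _ => ?_
          by_cases h0 : ⟪v i, C (v j)⟫_ℂ = 0
          · simp [h0]
          · have := horth i _ _ (hCv j) h0
            rw [if_neg (by linarith)]
      simp only [h5]
      rw [Finset.sum_comm]
      refine Finset.sum_congr rfl fun i _ => ?_
      split_ifs
      · rw [← Finset.mul_sum, ← Finset.mul_sum, ← h4, map_mul]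
      · simp
    set P : ℂ := ∑ i, (if 0 < t i then (t i : ℂ) * (⟪z, v i⟫_ℂ * ⟪v i, w⟫_ℂ) else 0) with hP
    have h3 : ⟪z, N w⟫_ℂ = P - conj P := by
      have h4 : conj P = -∑ i, (if 0 < t i then -(t i : ℂ) *
          conj (⟪z, v i⟫_ℂ * ⟪v i, w⟫_ℂ) else 0) := by
        rw [hP, map_sum, ← Finset.sum_neg_distrib]
        refine Finset.sum_congr rfl fun i _ => ?_
        split_ifs
        · rw [map_mul, Complex.conj_ofReal]; ring
        · simp
      rw [h4, ← h2, h1, sub_neg_eq_add, hP, ← Finset.sum_add_distrib]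
      refine Finset.sum_congr rfl fun i _ => ?_
      rcases lt_trichotomy 0 (t i) with h | h | h
      · rw [if_pos h, if_neg (by linarith), add_zero]
      · rw [← h]; simp
      · rw [if_neg (by linarith), if_pos h, zero_add]
    have h4 : dotProduct (star (ε z)) (ε w) = 2 * P := by
      rw [hP, Finset.mul_sum, ← hsum]
      · refine Finset.sum_congr rfl fun k _ => ?_
        rw [if_pos (σ k).2, Pi.star_apply, hε, hε, star_mul']
        have : star (r (σ k)) = r (σ k) := Complex.conj_ofReal _
        rw [this]
        have h6 : star ⟪v (σ k), z⟫_ℂ = ⟪z, v (σ k)⟫_ℂ := inner_conj_symm _ _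
        rw [h6]
        linear_combination (⟪z, v (σ k)⟫_ℂ * ⟪v (σ k), w⟫_ℂ) * hr _ (σ k).2
      · intro i hi
        by_contra hcon
        rw [if_neg hcon, mul_zero] at hi
        exact hi rfl
    rw [h3, h4, Complex.sub_conj]
    push_cast
    simp
    ring
  · intro a z
    funext k
    rw [hε, Matrix.mulVec, dotProduct]
    change _ = ∑ l, ⟪v (σ k), A a (v (σ l))⟫_ℂ * (r (σ l) * ⟪v (σ l), z⟫_ℂ)
    rw [hsum (fun l => ⟪v (σ k), A a (v l)⟫_ℂ * (r l * ⟪v l, z⟫_ℂ))]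
    · conv_lhs => rw [← v.sum_repr' z, map_sum, inner_sum, Finset.mul_sum]
      refine Finset.sum_congr rfl fun l _ => ?_
      rw [map_smul, inner_smul_right]
      by_cases h0 : ⟪v (σ k), A a (v l)⟫_ℂ = 0
      · simp [h0]
      -- A a preserves the eigenspaces of N, so rescaling by the eigenvalue commutes with the
      -- action.
      · have : r (σ k) = r l := by
          simp only [r]
          rw [horth _ _ _ (hAv a l) h0]
        rw [this]
        ring
    · intro l hl
      rw [← horth _ _ _ (hAv a l) (left_ne_zero_of_mul hl)]
      exact (σ k).2
  · intro τ
    -- C w lies in the negative part, where ε vanishes, so the real vector w + C w has the same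
    -- image as w.
    let w : X := ∑ k, (τ k / r (σ k)) • v (σ k)
    refine ⟨w + C w, by rw [map_add, hCC, add_comm], ?_⟩
    funext k
    have hrk : r (σ k) ≠ 0 := by
      intro h0
      have := hr _ (σ k).2
      rw [h0, mul_zero] at this
      have h2 : (t (σ k) : ℂ) = 0 := by
        rcases mul_eq_zero.1 this.symm with h | h
        · norm_num at h
        · exact h
      exact (σ k).2.ne' (by exact_mod_cast h2)
    have h1 : ⟪v (σ k), w⟫_ℂ = τ k / r (σ k) := by
      simp only [w]
      rw [inner_sum, Finset.sum_eq_single k]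
      · rw [inner_smul_right, orthonormal_iff_ite.1 v.orthonormal, if_pos rfl, mul_one]
      · intro l _ hl
        rw [inner_smul_right, orthonormal_iff_ite.1 v.orthonormal, if_neg, mul_zero]
        exact fun h => hl (σ.injective (Subtype.ext h)).symm
      · simp
    have h2 : ⟪v (σ k), C w⟫_ℂ = 0 := by
      simp only [w]
      rw [map_sum, inner_sum]
      refine Finset.sum_eq_zero fun l _ => ?_
      rw [LinearMap.map_smulₛₗ, inner_smul_right]
      by_contra hne
      have := horth _ _ _ (hCv _) (right_ne_zero_of_mul hne)
      have h3 := (σ k).2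
      have h4 := (σ l).2
      linarith
    rw [hε, inner_add_right, h1, h2, add_zero, mul_div_cancel₀ _ hrk]

end CompatibleStructure

namespace GSurface

variable {G : Type*} [Group G] (s : GSurface G)

/-- Every action has a unitary representation. -/
theorem exists_isUnitaryRep :
    ∃ (g : ℕ) (ρ : G →* Matrix.unitaryGroup (Fin g) ℂ), s.IsUnitaryRep ρ := by
  obtain ⟨N, hN⟩ := s.exists_hermOp
  let A₀ : G →* (s.Chain ≃ₗᵢ[ℂ] s.Chain) := s.permAct.comp (MulAction.toPermHom G s.Dart)
  have hA₀ : ∀ a z d, A₀ a z d = z (a⁻¹ • d) := fun a z d => rfl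
  let A := restrictUnitary A₀ s.complexCycles fun a z hz => s.permAct_toPerm_mem a hz
  have hA : ∀ a (z : s.complexCycles), (A a z : s.Chain) = A₀ a z := fun a z => rfl
  have hinner : ∀ z w : s.complexCycles, ⟪z, w⟫_ℂ = ⟪(z : s.Chain), (w : s.Chain)⟫_ℂ := fun _ _ => rfl
  let C : s.complexCycles →ₗ⋆[ℂ] s.complexCycles :=
    { toFun := fun z => ⟨s.conjChain z, s.conjChain_mem z.2⟩
      map_add' := fun z w => by
        ext d
        change conj ((z : s.Chain) d + (w : s.Chain) d) = _
        rw [map_add]; rfl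
      map_smul' := fun c z => by
        ext d
        change conj (c * (z : s.Chain) d) = _
        rw [map_mul]; rfl }
  have hCc : ∀ z : s.complexCycles, (C z : s.Chain) = s.conjChain z := fun z => rfl
  have hC : ∀ z w, ⟪C z, C w⟫_ℂ = conj ⟪z, w⟫_ℂ := fun z w => s.inner_conjChain _ _
  have hCC : ∀ z, C (C z) = z := fun z => Subtype.ext (s.conjChain_conjChain _)
  have hprim : ∀ z : s.complexCycles, ∃ y : s.Chain, (z : s.Chain) = y - s.rotOp y := by
    intro z
    obtain ⟨u, hu⟩ := s.exists_eq_sub_rot z.2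
    refine ⟨u, ?_⟩
    ext d
    rw [PiLp.sub_apply, rotOp_apply, hu]
  have hrotC : ∀ y, s.rotOp (s.conjChain y) = s.conjChain (s.rotOp y) := by
    intro y
    ext d
    rw [rotOp_apply, conjChain_apply, conjChain_apply, rotOp_apply]
  have hconjsub : ∀ x y, s.conjChain (x - y) = s.conjChain x - s.conjChain y := by
    intro x y
    ext d
    change conj (x d - y d) = _
    rw [map_sub]; rfl
  have hsym : LinearMap.IsSymmetric (𝕜 := ℂ) (E := s.complexCycles) N := by
    intro z w
    obtain ⟨y, hy⟩ := hprim z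
    obtain ⟨x, hx⟩ := hprim w
    rw [← inner_conj_symm, hN _ _ _ _ hx hy, hN _ _ _ _ hy hx]
    simp only [map_mul, map_sub, map_div₀, Complex.conj_I, inner_conj_symm, map_ofNat]
    ring
  have hNC : ∀ z, N (C z) = -C (N z) := by
    intro w
    refine ext_inner_left ℂ fun z => ?_
    obtain ⟨y, hy⟩ := hprim z
    obtain ⟨x, hx⟩ := hprim w
    have hx' : (C w : s.Chain) = s.conjChain x - s.rotOp (s.conjChain x) := by
      rw [hCc, hx, hconjsub, hrotC]
    have hy' : (C z : s.Chain) = s.conjChain y - s.rotOp (s.conjChain y) := by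
      rw [hCc, hy, hconjsub, hrotC]
    have h1 : ⟪z, C (N w)⟫_ℂ = conj ⟪C z, N w⟫_ℂ := by rw [← hC, hCC]
    rw [inner_neg_right, h1, hN _ _ _ _ hy hx', hN _ _ _ _ hy' hx, hrotC, hrotC]
    simp only [map_mul, map_sub, map_div₀, Complex.conj_I, map_ofNat, ← inner_conjChain,
      conjChain_conjChain]
    ring
  have hNA : ∀ a z, N (A a z) = A a (N z) := by
    intro a w
    refine ext_inner_left ℂ fun z => ?_
    obtain ⟨y, hy⟩ := hprim z
    obtain ⟨x, hx⟩ := hprim w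
    have hAA : ∀ u, A a (A a⁻¹ u) = u := fun u => by
      change (A a * A a⁻¹) u = u
      rw [← map_mul, mul_inv_cancel, map_one]; rfl
    have hAA₀ : ∀ u, A₀ a (A₀ a⁻¹ u) = u := fun u => by
      change (A₀ a * A₀ a⁻¹) u = u
      rw [← map_mul, mul_inv_cancel, map_one]; rfl
    have h1 : ⟪z, A a (N w)⟫_ℂ = ⟪A a⁻¹ z, N w⟫_ℂ := by
      refine Eq.trans ?_ (LinearIsometryEquiv.inner_map_map (𝕜 := ℂ) (E := s.complexCycles)
        (E' := s.complexCycles) (A a) (A a⁻¹ z) (N w))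
      rw [hAA]
    have hx' : (A a w : s.Chain) = A₀ a x - s.rotOp (A₀ a x) := by
      rw [hA, hx, map_sub]
      congr 1
      exact s.permAct_toPerm_rotOp a x
    have hy' : (A a⁻¹ z : s.Chain) = A₀ a⁻¹ y - s.rotOp (A₀ a⁻¹ y) := by
      rw [hA, hy, map_sub]
      congr 1
      exact s.permAct_toPerm_rotOp a⁻¹ y
    rw [h1, hN _ _ _ _ hy hx', hN _ _ _ _ hy' hx]
    congr 2
    · rw [← (A₀ a).inner_map_map (A₀ a⁻¹ y), hAA₀]
      exact congrArg (fun u => ⟪y, u⟫_ℂ) (s.permAct_toPerm_rotOp a x).symm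
    · rw [← (A₀ a).inner_map_map (s.rotOp (A₀ a⁻¹ y))]
      refine congrArg (fun u => ⟪u, A₀ a x⟫_ℂ) ?_
      refine Eq.trans ?_ (s.permAct_toPerm_rotOp a (A₀ a⁻¹ y)).symm
      change s.rotOp y = s.rotOp (A₀ a (A₀ a⁻¹ y))
      rw [hAA₀]
  obtain ⟨g, ρ, ε, h1, h2, h3⟩ := exists_positive_part (X := s.complexCycles) A C hC hCC hsym hNC hNA
  -- real cycles
  let J : s.cycles →ₗ[ℝ] s.complexCycles :=
    { toFun := s.toComplex
      map_add' := fun x y => by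
        ext d
        change (((x : s.Dart → ℝ) d + (y : s.Dart → ℝ) d : ℝ) : ℂ) = _
        rw [Complex.ofReal_add]; rfl
      map_smul' := fun c x => by
        ext d
        change ((c * (x : s.Dart → ℝ) d : ℝ) : ℂ) = c • ((x : s.Dart → ℝ) d : ℂ)
        rw [Complex.ofReal_mul, Complex.real_smul] }
  have hJ : ∀ x d, (J x : s.Chain) d = ((x : s.Dart → ℝ) d : ℂ) := fun x d => rfl
  have hCJ : ∀ x, C (J x) = J x := by
    intro x
    ext d
    rw [hCc, conjChain_apply, hJ, Complex.conj_ofReal]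
  have hreal : ∀ z, C z = z → J (s.reCycle z) = z := by
    intro z hz
    ext d
    have := congrArg (fun w : s.complexCycles => (w : s.Chain) d) hz
    exact Complex.conj_eq_iff_re.1 this
  have hint : ∀ z w, s.intersection z w = (dotProduct (star (ε (J z))) (ε (J w))).im := by
    intro z w
    obtain ⟨y, hy⟩ := s.exists_real_primitive z
    obtain ⟨x, hx⟩ := s.exists_real_primitive w
    let y' : s.Chain := WithLp.toLp 2 fun d => (y d : ℂ)
    let x' : s.Chain := WithLp.toLp 2 fun d => (x d : ℂ)
    have hy' : (J z : s.Chain) = y' - s.rotOp y' := by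
      ext d
      rw [PiLp.sub_apply, rotOp_apply, hJ, hy, Complex.ofReal_sub]
    have hx' : (J w : s.Chain) = x' - s.rotOp x' := by
      ext d
      rw [PiLp.sub_apply, rotOp_apply, hJ, hx, Complex.ofReal_sub]
    have h4 := h1 (J z) (J w) (hCJ z) (hCJ w)
    rw [hN _ _ _ _ hy' hx', inner_chain, inner_chain] at h4
    simp only [rotOp_apply] at h4
    have h5 : ∑ d, conj (y' d) * x' (s.rot d) - ∑ d, conj (y' (s.rot d)) * x' d =
        ((∑ d, (y d * x (s.rot d) - y (s.rot d) * x d) : ℝ) : ℂ) := by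
      rw [← Finset.sum_sub_distrib, Complex.ofReal_sum]
      refine Finset.sum_congr rfl fun d _ => ?_
      change conj (y d : ℂ) * x (s.rot d) - conj (y (s.rot d) : ℂ) * x d = _
      rw [Complex.conj_ofReal, Complex.conj_ofReal]
      push_cast
      ring
    rw [h5] at h4
    have h6 : Complex.I * ((s.intersection z w : ℝ) : ℂ) =
        Complex.I * ((dotProduct (star (ε (J z))) (ε (J w))).im : ℂ) := by
      rw [← h4, s.intersection_eq z w y x hy hx]
      push_cast
      ring
    exact_mod_cast mul_left_cancel₀ Complex.I_ne_zero h6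
  let E : s.cycles →ₗ[ℝ] (Fin g → ℂ) := (ε.restrictScalars ℝ) ∘ₗ J
  have hE : ∀ z, E z = ε (J z) := fun z => rfl
  have hsurj : Function.Surjective E := by
    intro τ
    obtain ⟨z, hz, hτ⟩ := h3 τ
    exact ⟨s.reCycle z, by rw [hE, hreal z hz, hτ]⟩
  have hker : s.boundaries.submoduleOf s.cycles = LinearMap.ker E := by
    ext z
    have h4 : z ∈ s.boundaries.submoduleOf s.cycles ↔ s.homologyClass z = 0 := by
      rw [homologyClass, Submodule.mkQ_apply, Submodule.Quotient.mk_eq_zero]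
    rw [h4, LinearMap.mem_ker]
    constructor
    · intro hz
      -- The intersection number of z with a cycle mapping to i E z is the squared norm of E z.
      obtain ⟨w, hw⟩ := hsurj (Complex.I • E z)
      have h5 := s.intersection_boundary hz w
      rw [hint, ← hE, ← hE, hw, dotProduct_smul, smul_eq_mul, Complex.I_mul_im] at h5
      have h6 : dotProduct (star (E z)) (E z) = ((∑ k, Complex.normSq (E z k) : ℝ) : ℂ) := by
        rw [Complex.ofReal_sum]
        exact Finset.sum_congr rfl fun k _ => (Complex.normSq_eq_conj_mul_self).symm
      rw [h6, Complex.ofReal_re, Finset.sum_eq_zero_iff_of_nonneg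
        (fun k _ => Complex.normSq_nonneg _)] at h5
      exact funext fun k => Complex.normSq_eq_zero.1 (h5 k (Finset.mem_univ k))
    · intro hz
      refine s.homologyClass_eq_zero fun w => ?_
      rw [hint, ← hE, hz]
      simp
  let e : s.H1 ≃ₗ[ℝ] (Fin g → ℂ) :=
    (Submodule.quotEquivOfEq _ _ hker).trans (E.quotKerEquivOfSurjective hsurj)
  have he : ∀ z, e (s.homologyClass z) = E z := fun z => rfl
  refine ⟨g, ρ, e, fun z w => ?_, fun a z => ?_⟩
  · rw [he, he, hint]; rfl
  · rw [he, he, hE, hE, ← h2]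
    rfl

end GSurface

/-! ## Signature and dimension of a combinatorial homology group -/

section CycleSpace

variable {V : Type*} [NormedAddCommGroup V] [InnerProductSpace ℂ V]
variable {Y : Type*} [AddCommGroup Y] [Module ℂ Y] [FiniteDimensional ℂ Y]

theorem finrank_submodule_prod (K₁ K₂ : Submodule ℂ Y) :
    finrank ℂ (K₁.prod K₂) = finrank ℂ K₁ + finrank ℂ K₂ := by
  rw [← Module.finrank_prod]
  exact LinearEquiv.finrank_eq
    { toFun := fun z => (⟨z.1.1, z.2.1⟩, ⟨z.1.2, z.2.2⟩)
      invFun := fun z => ⟨(z.1, z.2), z.1.2, z.2.2⟩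
      map_add' := fun _ _ => rfl
      map_smul' := fun _ _ => rfl }

theorem signature_sub_of_posDef {N : Y → ℝ} (h0 : N 0 = 0) (hN : ∀ y, y ≠ 0 → 0 < N y)
    (K₁ K₂ : Submodule ℂ Y) :
    signature (fun p : Y × Y => N p.1 - N p.2) (K₁.prod K₂) = finrank ℂ K₁ - finrank ℂ K₂ := by
  have hsup : K₁.prod ⊥ ⊔ Submodule.prod ⊥ K₂ = K₁.prod K₂ := by
    rw [Submodule.prod_sup_prod, sup_bot_eq, bot_sup_eq]
  have hnn : ∀ y, 0 ≤ N y := fun y => by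
    by_cases h : y = 0
    · rw [h, h0]
    · exact (hN y h).le
  have h1 : finrank ℂ (K₁.prod (⊥ : Submodule ℂ Y)) = finrank ℂ K₁ := by
    rw [finrank_submodule_prod, finrank_bot, add_zero]
  have h2 : finrank ℂ (Submodule.prod (⊥ : Submodule ℂ Y) K₂) = finrank ℂ K₂ := by
    rw [finrank_submodule_prod, finrank_bot, zero_add]
  unfold signature
  rw [posIndex_eq hsup, posIndex_eq ((sup_comm _ _).trans hsup), h1, h2]
  · rintro ⟨p, q⟩ ⟨hp, hq⟩ hne
    obtain rfl : p = 0 := by simpa using hp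
    have : q ≠ 0 := fun h => hne (by rw [h]; rfl)
    simpa [h0] using hN q this
  · rintro ⟨p, q⟩ ⟨hp, hq⟩
    obtain rfl : q = 0 := by simpa using hq
    simpa [h0] using hnn p
  · rintro ⟨p, q⟩ ⟨hp, hq⟩ hne
    obtain rfl : q = 0 := by simpa using hq
    have : p ≠ 0 := fun h => hne (by rw [h]; rfl)
    simpa [h0] using hN p this
  · rintro ⟨p, q⟩ ⟨hp, hq⟩
    obtain rfl : p = 0 := by simpa using hp
    simpa [h0] using hnn q

/-- The cycles of the permutation model with rotation `R` and reversal `τ`. -/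
def cycleSpace (R τ : V ≃ₗᵢ[ℂ] V) : Submodule ℂ V :=
  LinearMap.ker (LinearMap.id + unitaryEnd τ) ⊓ LinearMap.range (LinearMap.id - unitaryEnd R)

theorem mem_cycleSpace {R τ : V ≃ₗᵢ[ℂ] V} {z : V} :
    z ∈ cycleSpace R τ ↔ τ z = -z ∧ ∃ c, z = c - R c := by
  rw [cycleSpace, Submodule.mem_inf, LinearMap.mem_ker, LinearMap.mem_range]
  refine and_congr ?_ ⟨fun ⟨c, hc⟩ => ⟨c, hc.symm⟩, fun ⟨c, hc⟩ => ⟨c, hc.symm⟩⟩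
  change z + τ z = 0 ↔ _
  rw [add_comm, add_eq_zero_iff_eq_neg]

/-- The fixed vectors of a unitary operator. -/
def fixedSpace (R : V ≃ₗᵢ[ℂ] V) : Submodule ℂ V := LinearMap.ker (LinearMap.id - unitaryEnd R)

theorem mem_fixedSpace {R : V ≃ₗᵢ[ℂ] V} {z : V} : z ∈ fixedSpace R ↔ R z = z := by
  rw [fixedSpace, LinearMap.mem_ker]
  change z - R z = 0 ↔ _
  rw [sub_eq_zero, eq_comm]

/-- The boundaries of the permutation model. -/
def boundarySpace (R τ : V ≃ₗᵢ[ℂ] V) : Submodule ℂ V :=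
  (fixedSpace (R⁻¹ * τ)).map (LinearMap.id - unitaryEnd τ)

theorem mem_boundarySpace {R τ : V ≃ₗᵢ[ℂ] V} {z : V} :
    z ∈ boundarySpace R τ ↔ ∃ f, R⁻¹ (τ f) = f ∧ z = f - τ f := by
  rw [boundarySpace, Submodule.mem_map]
  exact ⟨fun ⟨f, hf, h⟩ => ⟨f, mem_fixedSpace.1 hf, h.symm⟩,
    fun ⟨f, hf, h⟩ => ⟨f, mem_fixedSpace.2 hf, h.symm⟩⟩

theorem finrank_map_add_finrank_inf_ker {X Y : Type*} [AddCommGroup X] [Module ℂ X]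
    [FiniteDimensional ℂ X] [AddCommGroup Y] [Module ℂ Y] (f : X →ₗ[ℂ] Y) (A : Submodule ℂ X) :
    finrank ℂ (A.map f) + finrank ℂ ↥(A ⊓ LinearMap.ker f) = finrank ℂ A := by
  have h := LinearMap.finrank_range_add_finrank_ker (f.domRestrict A)
  rw [LinearMap.range_domRestrict] at h
  have h2 : finrank ℂ (LinearMap.ker (f.domRestrict A)) = finrank ℂ ↥(A ⊓ LinearMap.ker f) := by
    rw [LinearMap.ker_domRestrict, ← Submodule.finrank_map_subtype_eq, Submodule.map_comap_subtype]
  omega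

/-- The Euler characteristic of the permutation model. -/
theorem finrank_cycleSpace [FiniteDimensional ℂ V] (R τ : V ≃ₗᵢ[ℂ] V) (hτ : τ * τ = 1) :
    finrank ℂ (cycleSpace R τ) + finrank ℂ (fixedSpace R) + finrank ℂ (fixedSpace (R⁻¹ * τ)) =
      finrank ℂ (boundarySpace R τ) + finrank ℂ (End.eigenspace (unitaryEnd τ) (-1)) +
        2 * finrank ℂ ↥(fixedSpace R ⊓ fixedSpace τ) := by
  have hττ : ∀ x, τ (τ x) = x := fun x => congrArg (fun p : V ≃ₗᵢ[ℂ] V => p x) hτ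
  have hR : ∀ x, R (R⁻¹ x) = x := fun x => R.apply_symm_apply x
  have hR' : ∀ x, R⁻¹ (R x) = x := fun x => R.symm_apply_apply x
  have hF : fixedSpace (R⁻¹ * τ) ⊓ fixedSpace τ = fixedSpace R ⊓ fixedSpace τ := by
    ext x
    simp only [Submodule.mem_inf, mem_fixedSpace]
    refine and_congr_left fun h => ?_
    change R⁻¹ (τ x) = x ↔ _
    rw [h]
    exact ⟨fun h => by rw [← h, hR, h], fun h => by rw [← h, hR', h]⟩
  have h1 := finrank_map_add_finrank_inf_ker (LinearMap.id - unitaryEnd τ) (fixedSpace (R⁻¹ * τ))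
  have h2 := finrank_map_add_finrank_inf_ker (LinearMap.id - unitaryEnd τ) (fixedSpace R)
  change finrank ℂ (boundarySpace R τ) + finrank ℂ ↥(fixedSpace (R⁻¹ * τ) ⊓ fixedSpace τ) = _ at h1
  change _ + finrank ℂ ↥(fixedSpace R ⊓ fixedSpace τ) = _ at h2
  rw [hF] at h1
  -- M is the space of coboundaries of vertex functions inside the odd functions.
  set M := (fixedSpace R).map (LinearMap.id - unitaryEnd τ) with hM
  have hMle : M ≤ End.eigenspace (unitaryEnd τ) (-1) := by
    rintro _ ⟨c, -, rfl⟩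
    rw [End.mem_eigenspace_iff]
    change τ (c - τ c) = (-1 : ℂ) • (c - τ c)
    rw [map_sub, hττ, neg_one_smul, neg_sub]
  have h3 := Submodule.finrank_add_inf_finrank_orthogonal hMle
  -- An odd function pairs with k - τk as twice with k, so orthogonality to the coboundaries is the
  -- cycle condition.
  have h4 : Mᗮ ⊓ End.eigenspace (unitaryEnd τ) (-1) = cycleSpace R τ := by
    ext z
    rw [Submodule.mem_inf, mem_cycleSpace, End.mem_eigenspace_iff, and_comm]
    have hz : unitaryEnd τ z = (-1 : ℂ) • z ↔ τ z = -z := by rw [neg_one_smul]; rfl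
    rw [hz]
    refine and_congr_right fun hz => ?_
    have hin : ∀ k, ⟪k - τ k, z⟫_ℂ = 2 * ⟪k, z⟫_ℂ := by
      intro k
      rw [inner_sub_left]
      have : ⟪τ k, z⟫_ℂ = - ⟪k, z⟫_ℂ := by
        rw [← τ.inner_map_map, hττ, hz, inner_neg_right]
      rw [this]; ring
    constructor
    · intro h
      refine exists_eq_sub_apply R z fun k hk => ?_
      have := (Submodule.mem_orthogonal _ _).1 h (k - τ k) ⟨k, mem_fixedSpace.2 hk, rfl⟩
      rw [hin] at this
      simpa using this
    · rintro ⟨c, rfl⟩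
      rw [Submodule.mem_orthogonal]
      rintro _ ⟨k, hk, rfl⟩
      refine (hin k).trans ?_
      have hk' : R k = k := mem_fixedSpace.1 hk
      have : ⟪k, R c⟫_ℂ = ⟪k, c⟫_ℂ := by
        conv_lhs => rw [← hk']
        exact R.inner_map_map _ _
      rw [inner_sub_right, this, sub_self, mul_zero]
  rw [h4] at h3
  omega

/-- In the kernel of `rotProduct R τ` the pair (u, v) satisfies u - R⁻¹u = v - τv, so this common
vector is odd and in the range of 1 - R: a cycle. The kernel maps onto the cycles in this way, and
by `hform` the Meyer form becomes the difference of two positive definite forms. -/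
theorem meyer_eq_finrank_sub (R τ : V ≃ₗᵢ[ℂ] V) (hτ : τ * τ = 1) {N : Y → ℝ}
    (h0 : N 0 = 0) (hN : ∀ y, y ≠ 0 → 0 < N y) (K₁ K₂ : Submodule ℂ Y) (Ψ₁ Ψ₂ : V →ₗ[ℂ] Y)
    (h₁ : ∀ z ∈ cycleSpace R τ, Ψ₁ z ∈ K₁) (h₂ : ∀ z ∈ cycleSpace R τ, Ψ₂ z ∈ K₂)
    (hsurj : ∀ p ∈ K₁, ∀ q ∈ K₂, ∃ z ∈ cycleSpace R τ, Ψ₁ z = p ∧ Ψ₂ z = q)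
    (hform : ∀ u, u - R⁻¹ u ∈ cycleSpace R τ →
      2 * (⟪u, R u⟫_ℂ).im = N (Ψ₁ (u - R⁻¹ u)) - N (Ψ₂ (u - R⁻¹ u))) :
    meyer R τ = finrank ℂ K₁ - finrank ℂ K₂ := by
  have hττ : ∀ x, τ (τ x) = x := fun x => congrArg (fun p : V ≃ₗᵢ[ℂ] V => p x) hτ
  have hR : ∀ x, R (R⁻¹ x) = x := fun x => R.apply_symm_apply x
  have hR' : ∀ x, R⁻¹ (R x) = x := fun x => R.symm_apply_apply x
  rw [meyer_eq, ← signature_sub_of_posDef h0 hN K₁ K₂]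
  let D : V × V →ₗ[ℂ] V := (LinearMap.id - unitaryEnd R⁻¹) ∘ₗ LinearMap.fst ℂ V V
  have hD : ∀ p, D p = p.1 - R⁻¹ p.1 := fun p => rfl
  have hker : ∀ p, p ∈ LinearMap.ker (rotProduct R τ) ↔ p.1 - R⁻¹ p.1 = p.2 - τ p.2 := by
    intro p
    have h : R⁻¹ p.1 - p.1 + (p.2 - τ p.2) = -(p.1 - R⁻¹ p.1 - (p.2 - τ p.2)) := by abel
    rw [LinearMap.mem_ker, rotProduct_apply, ← R⁻¹.injective.eq_iff, map_zero, map_add, map_sub,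
      map_sub, hR', hR', hR', h, neg_eq_zero, sub_eq_zero]
  have hcyc : ∀ p ∈ LinearMap.ker (rotProduct R τ), D p ∈ cycleSpace R τ := by
    intro p hp
    rw [mem_cycleSpace]
    refine ⟨?_, -R⁻¹ p.1, ?_⟩
    · rw [hD, (hker p).1 hp, map_sub, hττ, neg_sub]
    · rw [hD, map_neg, hR, neg_sub_neg]
  refine signature_map ((Ψ₁ ∘ₗ D).prod (Ψ₂ ∘ₗ D)) ?_ ?_ ?_
  · ext ⟨p, q⟩
    rw [Submodule.mem_map, Submodule.mem_prod]
    constructor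
    · rintro ⟨x, hx, h⟩
      have h' : (Ψ₁ (D x), Ψ₂ (D x)) = (p, q) := h
      rw [Prod.ext_iff] at h'
      obtain ⟨rfl, rfl⟩ : Ψ₁ (D x) = p ∧ Ψ₂ (D x) = q := h'
      exact ⟨h₁ _ (hcyc x hx), h₂ _ (hcyc x hx)⟩
    · rintro ⟨hp, hq⟩
      obtain ⟨z, hz, h3, h4⟩ := hsurj p hp q hq
      obtain ⟨h5, c, hc⟩ := mem_cycleSpace.1 hz
      have hDz : D (-R c, (2⁻¹ : ℂ) • z) = z := by
        rw [hD, map_neg, hR', hc, neg_sub_neg]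
      -- For z = c - Rc the first centre -Rc gives z back; the second is z/2 because z is odd.
      refine ⟨(-R c, (2⁻¹ : ℂ) • z), ?_, ?_⟩
      · rw [hker]
        refine (hDz : _).trans ?_
        change z = (2⁻¹ : ℂ) • z - τ ((2⁻¹ : ℂ) • z)
        rw [map_smul, h5, smul_neg, sub_neg_eq_add, ← add_smul]
        norm_num
      · change (Ψ₁ (D _), Ψ₂ (D _)) = _
        rw [hDz, h3, h4]
  · simp
  · intro p hp
    change N (Ψ₁ (D p)) - N (Ψ₂ (D p)) = _
    rw [hD, ← hform p.1 (hcyc p hp), quad_twistForm, quad_twistForm]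
    -- A unitary involution is self-adjoint, so it contributes nothing to the form.
    have h5 : (⟪p.2, τ p.2⟫_ℂ).im = 0 := by
      have h6 : conj ⟪p.2, τ p.2⟫_ℂ = ⟪p.2, τ p.2⟫_ℂ := by
        rw [inner_conj_symm, ← τ.inner_map_map, hττ]
      exact Complex.conj_eq_iff_im.1 h6
    rw [h5, mul_zero, add_zero]

theorem finrank_cycleSpace_eq [FiniteDimensional ℂ V] (R τ : V ≃ₗᵢ[ℂ] V) (K₁ K₂ : Submodule ℂ Y) (Ψ₁ Ψ₂ : V →ₗ[ℂ] Y)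
    (h₁ : ∀ z ∈ cycleSpace R τ, Ψ₁ z ∈ K₁) (h₂ : ∀ z ∈ cycleSpace R τ, Ψ₂ z ∈ K₂)
    (hsurj : ∀ p ∈ K₁, ∀ q ∈ K₂, ∃ z ∈ cycleSpace R τ, Ψ₁ z = p ∧ Ψ₂ z = q)
    (hker : ∀ z, z ∈ boundarySpace R τ ↔ z ∈ cycleSpace R τ ∧ Ψ₁ z = 0 ∧ Ψ₂ z = 0) :
    finrank ℂ (cycleSpace R τ) = finrank ℂ (boundarySpace R τ) + (finrank ℂ K₁ + finrank ℂ K₂) := by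
  rw [← finrank_map_add_finrank_inf_ker (Ψ₁.prod Ψ₂) (cycleSpace R τ)]
  have h3 : (cycleSpace R τ).map (Ψ₁.prod Ψ₂) = K₁.prod K₂ := by
    ext ⟨p, q⟩
    rw [Submodule.mem_map, Submodule.mem_prod]
    constructor
    · rintro ⟨x, hx, h⟩
      rw [← h]
      exact ⟨h₁ _ hx, h₂ _ hx⟩
    · rintro ⟨hp, hq⟩
      obtain ⟨z, hz, h3, h4⟩ := hsurj p hp q hq
      exact ⟨z, hz, Prod.ext h3 h4⟩
  have h4 : cycleSpace R τ ⊓ LinearMap.ker (Ψ₁.prod Ψ₂) = boundarySpace R τ := by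
    ext z
    rw [Submodule.mem_inf, LinearMap.mem_ker, hker, LinearMap.prod_apply, Prod.ext_iff]
    rfl
  rw [h3, h4, finrank_submodule_prod, add_comm]

end CycleSpace

/-! ### Signature and Euler characteristic on an invariant subspace -/

section RestrictedCycleSpace

variable {X : Type*} [NormedAddCommGroup X] [InnerProductSpace ℂ X] [FiniteDimensional ℂ X]
variable {Y : Type*} [AddCommGroup Y] [Module ℂ Y] [FiniteDimensional ℂ Y]

theorem finrank_eq_finrank_inf {X : Type*} [AddCommGroup X] [Module ℂ X] {W q : Submodule ℂ X}
    {p : Submodule ℂ W} (h : ∀ z : W, z ∈ p ↔ (z : X) ∈ q) :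
    finrank ℂ p = finrank ℂ ↥(W ⊓ q) := by
  have : p = q.comap W.subtype := Submodule.ext h
  rw [this, ← Submodule.finrank_map_subtype_eq, Submodule.map_comap_subtype]

/-- To be applied to W an eigenspace of a group element, where K₁ and K₂ are the eigenspaces in φ
and in its conjugate. The signature gives the difference of their dimensions and the Euler
characteristic their sum. The equivariant projection P keeps primitives and 2-chains inside W, so
cycles and boundaries of W are the intersections with W. -/
theorem finrank_homology_inf {Γ : Type*} [Group Γ] [Fintype Γ] (π : Γ →* (X ≃ₗᵢ[ℂ] X)) {r t : Γ}
    {n : ℕ} [NeZero n] (hr : r ^ n = 1) (ht : t * t = 1) (hrt : (r * t) ^ n = 1)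
    {W : Submodule ℂ X} (hW : ∀ g, ∀ z ∈ W, π g z ∈ W) {P : End ℂ X} (hP : LinearMap.IsProj W P)
    (hPπ : ∀ g z, P (π g z) = π g (P z))
    {N : Y → ℝ} (h0 : N 0 = 0) (hN : ∀ y, y ≠ 0 → 0 < N y) (K₁ K₂ : Submodule ℂ Y)
    (Ψ₁ Ψ₂ : X →ₗ[ℂ] Y)
    (h₁ : ∀ z ∈ W, z ∈ cycleSpace (π r) (π t) → Ψ₁ z ∈ K₁)
    (h₂ : ∀ z ∈ W, z ∈ cycleSpace (π r) (π t) → Ψ₂ z ∈ K₂)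
    (hsurj : ∀ p ∈ K₁, ∀ q ∈ K₂, ∃ z ∈ W, z ∈ cycleSpace (π r) (π t) ∧ Ψ₁ z = p ∧ Ψ₂ z = q)
    (hform : ∀ u, u - (π r)⁻¹ u ∈ cycleSpace (π r) (π t) →
      2 * (⟪u, π r u⟫_ℂ).im = N (Ψ₁ (u - (π r)⁻¹ u)) - N (Ψ₂ (u - (π r)⁻¹ u)))
    (hker : ∀ z, z ∈ boundarySpace (π r) (π t) ↔
      z ∈ cycleSpace (π r) (π t) ∧ Ψ₁ z = 0 ∧ Ψ₂ z = 0) :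
    (finrank ℂ K₁ : ℝ) - finrank ℂ K₂ = ∑ j ∈ Finset.range n, sawtooth n j *
      ((finrank ℂ ↥(W ⊓ End.eigenspace (unitaryEnd (π r)) (unityRoot n ^ j)) : ℝ) -
        finrank ℂ ↥(W ⊓ End.eigenspace (unitaryEnd (π (r * t))) (unityRoot n ^ j))) ∧
    finrank ℂ K₁ + finrank ℂ K₂ + finrank ℂ ↥(W ⊓ fixedSpace (π r)) +
        finrank ℂ ↥(W ⊓ fixedSpace (π (r⁻¹ * t))) =
      finrank ℂ ↥(W ⊓ End.eigenspace (unitaryEnd (π t)) (-1)) +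
        2 * finrank ℂ ↥(W ⊓ (fixedSpace (π r) ⊓ fixedSpace (π t))) := by
  set π' := restrictUnitary π W hW with hπ'
  have hval : ∀ g (z : W), (π' g z : X) = π g z := fun g z => rfl
  have hPid : ∀ z : W, P z = z := fun z => hP.map_id z z.2
  have hinv : (π r)⁻¹ = π r⁻¹ := (map_inv π r).symm
  have hinv' : (π' r)⁻¹ = π' r⁻¹ := (map_inv π' r).symm
  have htt : π' t * π' t = 1 := by rw [← map_mul, ht, map_one]
  have hcyc : ∀ z : W, z ∈ cycleSpace (π' r) (π' t) ↔ (z : X) ∈ cycleSpace (π r) (π t) := by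
    intro z
    rw [mem_cycleSpace, mem_cycleSpace]
    refine and_congr ⟨fun h => congrArg Subtype.val h, fun h => Subtype.ext h⟩ ?_
    constructor
    · rintro ⟨c, rfl⟩
      exact ⟨c, rfl⟩
    · rintro ⟨c, hc⟩
      refine ⟨⟨P c, hP.map_mem c⟩, Subtype.ext ?_⟩
      change (z : X) = P c - π r (P c)
      rw [← hPπ, ← map_sub, ← hc, hPid]
  have hbd : ∀ z : W, z ∈ boundarySpace (π' r) (π' t) ↔ (z : X) ∈ boundarySpace (π r) (π t) := by
    intro z
    rw [mem_boundarySpace, mem_boundarySpace, hinv, hinv']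
    constructor
    · rintro ⟨f, hf, rfl⟩
      exact ⟨f, congrArg Subtype.val hf, rfl⟩
    · rintro ⟨f, hf, hz⟩
      refine ⟨⟨P f, hP.map_mem f⟩, Subtype.ext ?_, Subtype.ext ?_⟩
      · change π r⁻¹ (π t (P f)) = P f
        rw [← hPπ, ← hPπ, hf]
      · change (z : X) = P f - π t (P f)
        rw [← hPπ, ← map_sub, ← hz, hPid]
  have heig : ∀ g μ, finrank ℂ (End.eigenspace (unitaryEnd (π' g)) μ) =
      finrank ℂ ↥(W ⊓ End.eigenspace (unitaryEnd (π g)) μ) := by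
    intro g μ
    refine finrank_eq_finrank_inf fun z => ?_
    rw [End.mem_eigenspace_iff, End.mem_eigenspace_iff]
    exact ⟨fun h => congrArg Subtype.val h, fun h => Subtype.ext h⟩
  have hfixmem : ∀ g (z : W), z ∈ fixedSpace (π' g) ↔ (z : X) ∈ fixedSpace (π g) := by
    intro g z
    rw [mem_fixedSpace, mem_fixedSpace]
    exact ⟨fun h => congrArg Subtype.val h, fun h => Subtype.ext h⟩
  have hfix : ∀ g, finrank ℂ (fixedSpace (π' g)) = finrank ℂ ↥(W ⊓ fixedSpace (π g)) :=
    fun g => finrank_eq_finrank_inf (hfixmem g)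
  have hfix2 : finrank ℂ ↥(fixedSpace (π' r) ⊓ fixedSpace (π' t)) =
      finrank ℂ ↥(W ⊓ (fixedSpace (π r) ⊓ fixedSpace (π t))) :=
    finrank_eq_finrank_inf fun z => by
      rw [Submodule.mem_inf, Submodule.mem_inf, hfixmem, hfixmem]
  let Φ₁ : W →ₗ[ℂ] Y := Ψ₁ ∘ₗ W.subtype
  let Φ₂ : W →ₗ[ℂ] Y := Ψ₂ ∘ₗ W.subtype
  have g₁ : ∀ z ∈ cycleSpace (π' r) (π' t), Φ₁ z ∈ K₁ := fun z hz => h₁ z z.2 ((hcyc z).1 hz)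
  have g₂ : ∀ z ∈ cycleSpace (π' r) (π' t), Φ₂ z ∈ K₂ := fun z hz => h₂ z z.2 ((hcyc z).1 hz)
  have gsurj : ∀ p ∈ K₁, ∀ q ∈ K₂, ∃ z ∈ cycleSpace (π' r) (π' t), Φ₁ z = p ∧ Φ₂ z = q := by
    intro p hp q hq
    obtain ⟨z, hzW, hz, h3, h4⟩ := hsurj p hp q hq
    exact ⟨⟨z, hzW⟩, (hcyc _).2 hz, h3, h4⟩
  constructor
  · have h3 := meyer_eq_finrank_sub (π' r) (π' t) htt h0 hN K₁ K₂ Φ₁ Φ₂ g₁ g₂ gsurj (by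
      intro u hu
      rw [hcyc, hinv'] at hu
      have := hform u (by rw [hinv]; exact hu)
      rw [hinv] at this
      rw [hinv']
      exact this)
    have h4 := meyer_eq_sum π' r t hr (by rw [pow_two, ht]) hrt
    rw [h3] at h4
    push_cast at h4
    rw [h4]
    simp only [heig]
  · have h3 := finrank_cycleSpace_eq (π' r) (π' t) K₁ K₂ Φ₁ Φ₂ g₁ g₂ gsurj (by
      intro z
      rw [hbd, hcyc]
      exact hker z)
    have h4 := finrank_cycleSpace (π' r) (π' t) htt
    rw [hinv', ← map_mul, hfix, hfix, heig, hfix2] at h4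
    omega

theorem map_eigenProj {X Y : Type*} [AddCommGroup X] [Module ℂ X] [AddCommGroup Y] [Module ℂ Y]
    {T : End ℂ X} {T' : End ℂ Y} {Z : Submodule ℂ X} {f : X →ₗ[ℂ] Y} (hZ : ∀ z ∈ Z, T z ∈ Z)
    (hf : ∀ z ∈ Z, f (T z) = T' (f z)) (n j : ℕ) {z : X} (hz : z ∈ Z) :
    f (eigenProj T n j z) = eigenProj T' n j (f z) := by
  have h : ∀ k : ℕ, (T ^ k) z ∈ Z ∧ f ((T ^ k) z) = (T' ^ k) (f z) := by
    intro k
    induction k with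
    | zero => exact ⟨hz, rfl⟩
    | succ k ih =>
      rw [pow_succ', pow_succ', Module.End.mul_apply, Module.End.mul_apply, hf _ ih.1, ih.2]
      exact ⟨hZ _ ih.1, rfl⟩
  rw [eigenProj_apply, eigenProj_apply, map_smul, map_sum]
  simp only [map_smul, (h _).2]

theorem eigenProj_mem {X : Type*} [AddCommGroup X] [Module ℂ X]
    {T : End ℂ X} {Z : Submodule ℂ X} (hZ : ∀ z ∈ Z, T z ∈ Z) (n j : ℕ) {z : X} (hz : z ∈ Z) :
    eigenProj T n j z ∈ Z := by
  have h : ∀ k : ℕ, (T ^ k) z ∈ Z := by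
    intro k
    induction k with
    | zero => exact hz
    | succ k ih =>
      rw [pow_succ', Module.End.mul_apply]
      exact hZ _ ih
  rw [eigenProj_apply]
  exact Z.smul_mem _ (Z.sum_mem fun k _ => Z.smul_mem _ (h k))

end RestrictedCycleSpace

/-! ### Complex homology of a surface in terms of permutation operators -/

namespace GSurface

variable {G : Type*} [Group G] (s : GSurface G)

/-- Summing to zero around every vertex amounts to being in the range of 1 - R, by
`exists_eq_sub_rot` in one direction and telescoping in the other. -/
theorem complexCycles_eq : s.complexCycles = cycleSpace (s.permAct s.rot) (s.permAct s.rev) := by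
  ext z
  have hrev : s.permAct s.rev z = -z ↔ ∀ d, z (s.rev d) = -z d := by
    have h0 : ∀ d, s.permAct s.rev z d = z (s.rev d) := fun d => by rw [permAct_apply, rev_inv]
    refine ⟨fun h d => ?_, fun h => ?_⟩
    · rw [← h0, h, PiLp.neg_apply]
    · ext d
      rw [h0, h, PiLp.neg_apply]
  rw [mem_cycleSpace, hrev]
  constructor
  · intro hz
    obtain ⟨u, hu⟩ := s.exists_eq_sub_rot hz
    refine ⟨hz.1, -s.rotOp u, ?_⟩
    ext d
    have hd : s.rot (s.rot⁻¹ d) = d := s.rot.apply_symm_apply d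
    rw [PiLp.sub_apply, map_neg, PiLp.neg_apply, PiLp.neg_apply, permAct_apply, rotOp_apply,
      rotOp_apply, hu, hd, neg_sub_neg]
  · rintro ⟨h, c, hc⟩
    refine ⟨h, fun d => ?_⟩
    have : ∀ d, z d = c d - c (s.rot⁻¹ d) := fun d => by rw [hc]; rfl
    have h2 := s.sum_sub_rot (fun d => c (s.rot⁻¹ d)) d
    rw [← neg_eq_zero, ← h2, ← Finset.sum_neg_distrib]
    refine Finset.sum_congr rfl fun i _ => ?_
    rw [this, neg_sub]
    congr 1
    exact congrArg c (s.rot.symm_apply_apply _).symm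

theorem trace_permAct (p : Equiv.Perm s.Dart) [DecidableEq s.Dart] :
    LinearMap.trace ℂ s.Chain (unitaryEnd (s.permAct p)) =
      (Finset.univ.filter fun d => p d = d).card := by
  rw [LinearMap.trace_eq_matrix_trace ℂ (EuclideanSpace.basisFun s.Dart ℂ).toBasis, Matrix.trace,
    Finset.card_filter, Nat.cast_sum]
  refine Finset.sum_congr rfl fun d _ => ?_
  rw [Matrix.diag_apply, LinearMap.toMatrix_apply, OrthonormalBasis.coe_toBasis,
    OrthonormalBasis.coe_toBasis_repr_apply, EuclideanSpace.basisFun_repr,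
    EuclideanSpace.basisFun_apply]
  change (s.permAct p (EuclideanSpace.single d 1)) d = _
  rw [permAct_apply, PiLp.single_apply, Nat.cast_ite, Nat.cast_one, Nat.cast_zero]
  refine if_congr ?_ rfl rfl
  rw [Equiv.Perm.inv_eq_iff_eq, eq_comm]

theorem face_invariant_iff {M : Type*} (f : s.Dart → M) :
    (∀ d, f ((s.rot⁻¹ * s.rev) d) = f d) ↔ ∀ d, f (s.rev (s.rot d)) = f d := by
  have h1 : ∀ d, (s.rot⁻¹ * s.rev) (s.rev (s.rot d)) = d := fun d => by
    rw [Equiv.Perm.mul_apply, s.rev_rev]; exact s.rot.symm_apply_apply d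
  have h2 : ∀ d, s.rev (s.rot ((s.rot⁻¹ * s.rev) d)) = d := fun d => by
    have : s.rot ((s.rot⁻¹ * s.rev) d) = s.rev d := s.rot.apply_symm_apply (s.rev d)
    rw [this, s.rev_rev]
  exact ⟨fun h d => by rw [← h (s.rev (s.rot d)), h1], fun h d => by rw [← h, h2]⟩

theorem mem_boundarySpace_iff (z : s.Chain) :
    z ∈ boundarySpace (s.permAct s.rot) (s.permAct s.rev) ↔ ∃ f : s.Dart → ℂ,
      (∀ d, f ((s.rot⁻¹ * s.rev) d) = f d) ∧ ∀ d, z d = f d - f (s.rev d) := by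
  rw [mem_boundarySpace]
  have h1 : ∀ (f : s.Chain) d, (s.permAct s.rot)⁻¹ (s.permAct s.rev f) d = f (s.rev (s.rot d)) := by
    intro f d
    rw [← map_inv, permAct_apply, permAct_apply, inv_inv, rev_inv]
  have h2 : ∀ (f : s.Chain) d, s.permAct s.rev f d = f (s.rev d) := fun f d => by
    rw [permAct_apply, rev_inv]
  constructor
  · rintro ⟨f, hf, rfl⟩
    refine ⟨f, (s.face_invariant_iff _).2 fun d => ?_, fun d => ?_⟩
    · rw [← h1, hf]
    · rw [PiLp.sub_apply, h2]
  · rintro ⟨f, hf, hz⟩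
    refine ⟨WithLp.toLp 2 f, ?_, ?_⟩
    · ext d
      rw [h1]
      exact (s.face_invariant_iff f).1 hf d
    · ext d
      rw [PiLp.sub_apply, h2, hz]

theorem boundarySpace_le : boundarySpace (s.permAct s.rot) (s.permAct s.rev) ≤ s.complexCycles := by
  intro z hz
  obtain ⟨f, hf, hz⟩ := (s.mem_boundarySpace_iff z).1 hz
  refine ⟨fun d => by rw [hz, hz, s.rev_rev, neg_sub], fun d => ?_⟩
  have h1 : ∀ d, f (s.rev d) = f (s.rot⁻¹ d) := fun d => by
    rw [← (s.face_invariant_iff f).1 hf (s.rot⁻¹ d)]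
    exact congrArg (fun x => f (s.rev x)) (s.rot.apply_symm_apply d).symm
  rw [← neg_eq_zero, ← s.sum_sub_rot (fun d => f (s.rot⁻¹ d)) d, ← Finset.sum_neg_distrib]
  refine Finset.sum_congr rfl fun i _ => ?_
  rw [hz, neg_sub, h1]
  congr 1
  exact congrArg f (s.rot.symm_apply_apply _).symm

/-- The complex homology splits into the representation and its conjugate. -/
theorem exists_homology_maps {g : ℕ} {ρ : G →* Matrix.unitaryGroup (Fin g) ℂ}
    (hρ : s.IsUnitaryRep ρ) : ∃ Ψ₁ Ψ₂ : s.Chain →ₗ[ℂ] (Fin g → ℂ),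
      (∀ a, ∀ z ∈ s.complexCycles, Ψ₁ (s.permAct (MulAction.toPerm a) z) =
        Matrix.mulVecLin (ρ a : Matrix (Fin g) (Fin g) ℂ) (Ψ₁ z)) ∧
      (∀ a, ∀ z ∈ s.complexCycles, Ψ₂ (s.permAct (MulAction.toPerm a) z) =
        Matrix.mulVecLin ((ρ a : Matrix (Fin g) (Fin g) ℂ).map star) (Ψ₂ z)) ∧
      (∀ p q, ∃ z ∈ s.complexCycles, Ψ₁ z = p ∧ Ψ₂ z = q) ∧
      (∀ u, u - s.rotOp u ∈ s.complexCycles → 2 * (⟪u, s.permAct s.rot u⟫_ℂ).im =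
        ∑ k, Complex.normSq (Ψ₁ (u - s.rotOp u) k) - ∑ k, Complex.normSq (Ψ₂ (u - s.rotOp u) k)) ∧
      ∀ z, z ∈ boundarySpace (s.permAct s.rot) (s.permAct s.rev) ↔
        z ∈ s.complexCycles ∧ Ψ₁ z = 0 ∧ Ψ₂ z = 0 := by
  obtain ⟨e, he, heq⟩ := hρ
  let L₁ : s.cycles →ₗ[ℝ] (Fin g → ℂ) := e.toLinearMap ∘ₗ s.homologyClass
  let L₂ : s.cycles →ₗ[ℝ] (Fin g → ℂ) :=
    { toFun := fun z => star (L₁ z)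
      map_add' := fun z w => by rw [map_add, star_add]
      map_smul' := fun c z => by
        funext k
        change conj (L₁ (c • z) k) = c • conj (L₁ z k)
        rw [map_smul, Pi.smul_apply, Complex.real_smul, Complex.real_smul, map_mul,
          Complex.conj_ofReal] }
  have hL₂ : ∀ z, L₂ z = star (L₁ z) := fun z => rfl
  have hL₁ : ∀ z, L₁ z = e (s.homologyClass z) := fun z => rfl
  -- The extension to all chains is arbitrary; only the values on cycles are used.
  obtain ⟨Ψ₁, hΨ₁⟩ := LinearMap.exists_extend (s.complexify L₁)
  obtain ⟨Ψ₂, hΨ₂⟩ := LinearMap.exists_extend (s.complexify L₂)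
  have h₁ : ∀ z : s.complexCycles, Ψ₁ z = L₁ (s.reCycle z) + Complex.I • L₁ (s.imCycle z) :=
    fun z => LinearMap.congr_fun hΨ₁ z
  have h₂ : ∀ z : s.complexCycles, Ψ₂ z = star (L₁ (s.reCycle z)) +
      Complex.I • star (L₁ (s.imCycle z)) := fun z => LinearMap.congr_fun hΨ₂ z
  have hact : ∀ (a : G) (z : s.complexCycles) (hz : s.permAct (MulAction.toPerm a) z ∈ s.complexCycles),
      L₁ (s.reCycle ⟨_, hz⟩) = Matrix.mulVec (ρ a : Matrix (Fin g) (Fin g) ℂ) (L₁ (s.reCycle z)) ∧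
      L₁ (s.imCycle ⟨_, hz⟩) = Matrix.mulVec (ρ a : Matrix (Fin g) (Fin g) ℂ) (L₁ (s.imCycle z)) :=
    fun a z hz => ⟨heq a (s.reCycle z), heq a (s.imCycle z)⟩
  have hL₁0 : ∀ z, L₁ z = 0 ↔ s.homologyClass z = 0 := fun z => e.map_eq_zero_iff
  have hstar : ∀ (M : Matrix (Fin g) (Fin g) ℂ) (p : Fin g → ℂ),
      star (M.mulVec p) = (M.map star).mulVec (star p) := by
    intro M p
    funext k
    simp [Matrix.mulVec, dotProduct]
  refine ⟨Ψ₁, Ψ₂, ?_, ?_, ?_, ?_, ?_⟩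
  · intro a z hz
    have hz' := s.permAct_toPerm_mem a hz
    have e1 := h₁ ⟨z, hz⟩
    have e2 := h₁ ⟨_, hz'⟩
    obtain ⟨h3, h4⟩ := hact a ⟨z, hz⟩ hz'
    rw [h3, h4] at e2
    refine e2.trans ?_
    change _ = Matrix.mulVecLin _ (Ψ₁ (⟨z, hz⟩ : s.complexCycles))
    rw [e1, map_add, map_smul]
    rfl
  · intro a z hz
    have hz' := s.permAct_toPerm_mem a hz
    have e1 := h₂ ⟨z, hz⟩
    have e2 := h₂ ⟨_, hz'⟩
    obtain ⟨h3, h4⟩ := hact a ⟨z, hz⟩ hz'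
    rw [h3, h4, hstar, hstar] at e2
    refine e2.trans ?_
    change _ = Matrix.mulVecLin _ (Ψ₂ (⟨z, hz⟩ : s.complexCycles))
    rw [e1, map_add, map_smul]
    rfl
  · intro p q
    have hsurj : ∀ y, ∃ z, L₁ z = y := by
      intro y
      obtain ⟨z, hz⟩ := Submodule.mkQ_surjective _ (e.symm y)
      refine ⟨z, ?_⟩
      rw [hL₁]
      exact (congrArg e hz).trans (e.apply_symm_apply y)
    -- Real and imaginary parts of the solution of L x + i L y = p, conj(L x) + i conj(L y) = q.
    obtain ⟨x, hx⟩ := hsurj ((2⁻¹ : ℂ) • (p + star q))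
    obtain ⟨y, hy⟩ := hsurj ((-(Complex.I / 2)) • (p - star q))
    refine ⟨s.mkCycle x y, (s.mkCycle x y).2, ?_, ?_⟩
    · rw [h₁, reCycle_mkCycle, imCycle_mkCycle, hx, hy]
      funext k
      simp only [Pi.add_apply, Pi.smul_apply, Pi.sub_apply, smul_eq_mul]
      linear_combination (-(1 / 2) * (p k - star q k)) * Complex.I_mul_I
    · rw [h₂, reCycle_mkCycle, imCycle_mkCycle, hx, hy]
      funext k
      have hI : conj (-(Complex.I / 2)) = Complex.I / 2 := by
        rw [map_neg, map_div₀, Complex.conj_I, map_ofNat]; ring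
      have h2 : conj ((2 : ℂ)⁻¹) = 2⁻¹ := by rw [map_inv₀, map_ofNat]
      have h3 : star ((2⁻¹ : ℂ) • (p + star q)) k = 2⁻¹ * (star (p k) + q k) := by
        change conj (2⁻¹ * (p k + star (q k))) = _
        rw [map_mul, h2, map_add]
        congr 2
        exact star_star (q k)
      have h4 : star ((-(Complex.I / 2)) • (p - star q)) k = Complex.I / 2 * (star (p k) - q k) := by
        change conj (-(Complex.I / 2) * (p k - star (q k))) = _
        rw [map_mul, hI, map_sub]
        congr 2
        exact star_star (q k)
      rw [Pi.add_apply, Pi.smul_apply, h3, h4, smul_eq_mul]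
      linear_combination (1 / 2 * (star (p k) - q k)) * Complex.I_mul_I
  · intro u hu
    have e1 := h₁ ⟨_, hu⟩
    have e2 := h₂ ⟨_, hu⟩
    have h3 := he (s.reCycle ⟨_, hu⟩) (s.imCycle ⟨_, hu⟩)
    rw [← hL₁, ← hL₁] at h3
    set p := L₁ (s.reCycle ⟨_, hu⟩)
    set q := L₁ (s.imCycle ⟨_, hu⟩)
    change Ψ₁ (u - s.rotOp u) = _ at e1
    change Ψ₂ (u - s.rotOp u) = _ at e2
    -- Componentwise |p + iq|² - |conj p + i conj q|² = -4 Im(conj p · q).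
    have h4 : ∑ k, Complex.normSq (Ψ₁ (u - s.rotOp u) k) -
        ∑ k, Complex.normSq (Ψ₂ (u - s.rotOp u) k) = -4 * (dotProduct (star p) q).im := by
      rw [e1, e2, ← Finset.sum_sub_distrib, dotProduct, Complex.im_sum, Finset.mul_sum]
      refine Finset.sum_congr rfl fun k _ => ?_
      have h5 : star (p k) = conj (p k) := rfl
      have h6 : star (q k) = conj (q k) := rfl
      simp only [Pi.add_apply, Pi.smul_apply, Pi.star_apply, smul_eq_mul, h5, h6,
        Complex.normSq_apply, Complex.add_re, Complex.add_im, Complex.mul_re, Complex.mul_im,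
        Complex.I_re, Complex.I_im, Complex.conj_re, Complex.conj_im]
      ring
    rw [h4, ← h3, s.intersection_eq _ _ (fun d => (u d).re) (fun d => (u d).im)]
    · have h5 : (⟪u, s.permAct s.rot u⟫_ℂ).im =
          ∑ d, ((u (s.rot d)).re * (u d).im - (u d).re * (u (s.rot d)).im) := by
        rw [inner_chain, ← Equiv.sum_comp s.rot, Complex.im_sum]
        refine Finset.sum_congr rfl fun d _ => ?_
        have h6 : s.permAct s.rot u (s.rot d) = u d := congrArg u (s.rot.symm_apply_apply d)
        rw [h6, Complex.mul_im, Complex.conj_re, Complex.conj_im]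
        ring
      rw [h5, Finset.mul_sum, Finset.sum_div, Finset.mul_sum]
      refine Finset.sum_congr rfl fun d _ => ?_
      ring
    · intro d
      change ((u - s.rotOp u) d).re = _
      rw [PiLp.sub_apply, rotOp_apply, Complex.sub_re]
    · intro d
      change ((u - s.rotOp u) d).im = _
      rw [PiLp.sub_apply, rotOp_apply, Complex.sub_im]
  · intro z
    have key : ∀ hz : z ∈ s.complexCycles, (Ψ₁ z = 0 ∧ Ψ₂ z = 0) ↔
        s.homologyClass (s.reCycle ⟨z, hz⟩) = 0 ∧ s.homologyClass (s.imCycle ⟨z, hz⟩) = 0 := by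
      intro hz
      have e1 := h₁ ⟨z, hz⟩
      have e2 := h₂ ⟨z, hz⟩
      rw [← hL₁0, ← hL₁0]
      set p := L₁ (s.reCycle ⟨z, hz⟩)
      set q := L₁ (s.imCycle ⟨z, hz⟩)
      change Ψ₁ z = _ at e1
      change Ψ₂ z = _ at e2
      rw [e1, e2]
      constructor
      · rintro ⟨h3, h4⟩
        have h5 : ∀ k, p k = 0 ∧ q k = 0 := by
          intro k
          have h6 : p k + Complex.I * q k = 0 := congrFun h3 k
          have h7 : conj (p k) + Complex.I * conj (q k) = 0 := congrFun h4 k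
          have h8 := congrArg conj h7
          rw [map_add, map_mul, Complex.conj_I, Complex.conj_conj, Complex.conj_conj, map_zero] at h8
          refine ⟨by linear_combination (h6 + h8) / 2, ?_⟩
          linear_combination (-(Complex.I) / 2) * (h6 - h8) + q k * Complex.I_mul_I
        exact ⟨funext fun k => (h5 k).1, funext fun k => (h5 k).2⟩
      · rintro ⟨h3, h4⟩
        rw [h3, h4]
        simp
    rw [mem_boundarySpace_iff]
    constructor
    · intro h
      have hz := s.boundarySpace_le ((s.mem_boundarySpace_iff z).2 h)
      obtain ⟨f, hf, hzf⟩ := h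
      refine ⟨hz, (key hz).2 ⟨?_, ?_⟩⟩
      · refine (s.mem_boundaries_iff _).2 ⟨fun d => (f d).re, fun d => congrArg Complex.re (hf d), fun d => ?_⟩
        change (z d).re = _
        rw [hzf, Complex.sub_re]
      · refine (s.mem_boundaries_iff _).2 ⟨fun d => (f d).im, fun d => congrArg Complex.im (hf d), fun d => ?_⟩
        change (z d).im = _
        rw [hzf, Complex.sub_im]
    · rintro ⟨hz, h⟩
      obtain ⟨h3, h4⟩ := (key hz).1 h
      obtain ⟨f, hf, hzf⟩ := (s.mem_boundaries_iff _).1 h3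
      obtain ⟨f', hf', hzf'⟩ := (s.mem_boundaries_iff _).1 h4
      refine ⟨fun d => ⟨f d, f' d⟩, fun d => Complex.ext (hf d) (hf' d), fun d => ?_⟩
      exact Complex.ext (hzf d) (hzf' d)

end GSurface

/-! ## The trace formula -/

theorem fixedSpace_eq_eigenspace {V : Type*} [NormedAddCommGroup V] [InnerProductSpace ℂ V]
    (A : V ≃ₗᵢ[ℂ] V) (n : ℕ) :
    fixedSpace A = End.eigenspace (unitaryEnd A) (unityRoot n ^ 0) := by
  ext z
  rw [mem_fixedSpace, End.mem_eigenspace_iff, pow_zero, one_smul]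
  rfl

theorem trace_eigenProj_eq_zero {X : Type*} [AddCommGroup X] [Module ℂ X] {S T : End ℂ X}
    (h : ∀ k : ℕ, LinearMap.trace ℂ X (S * T ^ k) = 0) (n j : ℕ) :
    LinearMap.trace ℂ X (S * eigenProj T n j) = 0 := by
  rw [trace_eigenProj]
  simp [h]

/-- Lets the index 0 be read as n, where the weight k/n becomes 1. -/
theorem eigenProj_self_right {X : Type*} [AddCommGroup X] [Module ℂ X] (T : End ℂ X) (n : ℕ)
    [NeZero n] : eigenProj T n n = eigenProj T n 0 := by
  unfold eigenProj
  congr 1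
  refine Finset.sum_congr rfl fun k _ => ?_
  rw [pow_mul, inv_pow, (unityRoot_primitive n).pow_eq_one]
  simp

/-- The Fourier coefficients `n⁻¹ ∑_{j = 1}^n (j / n) ζ^{-jl}` of the sawtooth function. -/
def rotCoeff (n l : ℕ) : ℂ :=
  (n : ℂ)⁻¹ * ∑ j ∈ Finset.range n, ((j + 1 : ℕ) / n : ℂ) * (unityRoot n)⁻¹ ^ ((j + 1) * l)

namespace GSurface

variable {G : Type*} [Group G] (s : GSurface G)

theorem trace_permAct_eq_zero {p : Equiv.Perm s.Dart} (h : ∀ d, p d ≠ d) :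
    LinearMap.trace ℂ s.Chain (unitaryEnd (s.permAct p)) = 0 := by
  classical
  rw [trace_permAct, Finset.filter_false_of_mem fun d _ => h d]
  simp

theorem commute_toPerm_rot (a : G) : Commute (MulAction.toPerm a : Equiv.Perm s.Dart) s.rot :=
  Equiv.ext fun d => s.smul_rot a d

theorem commute_toPerm_rev (a : G) : Commute (MulAction.toPerm a : Equiv.Perm s.Dart) s.rev :=
  Equiv.ext fun d => s.smul_rev a d

theorem smul_face_ne {a : G} (ha : a ≠ 1) (k : ℕ) (d : s.Dart) :
    a • ((s.rot⁻¹ * s.rev) ^ k) d ≠ d := by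
  intro h
  refine ha (s.face_free a (((s.rot⁻¹ * s.rev) ^ k) d) ?_)
  rw [h]
  exact ⟨-(k : ℤ), by rw [zpow_neg, zpow_natCast]; exact ((s.rot⁻¹ * s.rev) ^ k).symm_apply_apply d⟩

theorem smul_ne {a : G} (ha : a ≠ 1) (d : s.Dart) : a • d ≠ d := s.smul_face_ne ha 0 d

/-- rot * rev is conjugate under rev to the inverse of the face permutation, so it too has cycles
that no nontrivial group element preserves. -/
theorem smul_coface_ne {a : G} (ha : a ≠ 1) (k : ℕ) (d : s.Dart) :
    a • ((s.rot * s.rev) ^ k) d ≠ d := by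
  intro h
  have h1 : s.rot * s.rev = s.rev⁻¹ * (s.rot⁻¹ * s.rev)⁻¹ * s.rev := by
    rw [mul_inv_rev, inv_inv, s.rev_inv]
    have : s.rev * s.rev = 1 := Equiv.ext s.rev_rev
    rw [← mul_assoc s.rev s.rev, this, one_mul]
  have h2 : (s.rot * s.rev) ^ k = s.rev⁻¹ * ((s.rot⁻¹ * s.rev) ^ k)⁻¹ * s.rev := by
    have h3 := conj_pow (a := s.rev⁻¹) (b := (s.rot⁻¹ * s.rev)⁻¹) (i := k)
    rw [inv_inv] at h3
    rw [h1, h3, inv_pow]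
  have h4 : s.rev (((s.rot * s.rev) ^ k) d) = ((s.rot⁻¹ * s.rev) ^ k)⁻¹ (s.rev d) := by
    rw [h2]
    exact s.rev.apply_symm_apply _
  refine ha (s.face_free a (s.rev (((s.rot * s.rev) ^ k) d)) ?_)
  rw [s.smul_rev, h, h4]
  exact ⟨(k : ℤ), by rw [zpow_natCast]; exact ((s.rot⁻¹ * s.rev) ^ k).apply_symm_apply _⟩

/-- Invariance under rot and rev is invariance under the group they generate, which is transitive on
darts. -/
theorem mem_constants (z : s.Chain) :
    z ∈ fixedSpace (s.permAct s.rot) ⊓ fixedSpace (s.permAct s.rev) ↔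
      z ∈ Submodule.span ℂ {(WithLp.toLp 2 fun _ => 1 : s.Chain)} := by
  rw [Submodule.mem_inf, mem_fixedSpace, mem_fixedSpace, Submodule.mem_span_singleton]
  constructor
  · rintro ⟨h1, h2⟩
    have h3 : ∀ w ∈ Subgroup.closure {s.rot, s.rev}, s.permAct w z = z := by
      intro w hw
      induction hw using Subgroup.closure_induction with
      | mem x hx =>
        rcases hx with rfl | rfl
        · exact h1
        · exact h2
      | one => rw [map_one]; rfl
      | mul x y _ _ hx hy =>
        rw [map_mul]
        change s.permAct x (s.permAct y z) = z
        rw [hy, hx]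
      | inv x _ hx =>
        conv_lhs => rw [← hx]
        change (s.permAct x⁻¹ * s.permAct x) z = z
        rw [← map_mul, inv_mul_cancel, map_one]; rfl
    obtain ⟨d₀⟩ := s.nonemptyDart
    refine ⟨z d₀, ?_⟩
    ext d
    obtain ⟨w, hw, hwd⟩ := s.connected d d₀
    rw [PiLp.smul_apply, smul_eq_mul, mul_one]
    conv_lhs => rw [← h3 w hw]
    rw [permAct_apply, ← hwd]
    exact congrArg z (w.symm_apply_apply d)
  · rintro ⟨c, rfl⟩
    exact ⟨rfl, rfl⟩

/-- Both relations of `finrank_homology_inf` hold on every eigenspace of a. Weighted by the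
eigenvalues and summed, dimensions become traces of a times a spectral projection, that is, counts
of darts fixed by a times a power of rot, rev, the face permutation or rot * rev. Only the powers of
rot can give fixed darts; the constants add 1. -/
theorem trace_unitaryRep {g : ℕ} {ρ : G →* Matrix.unitaryGroup (Fin g) ℂ} (hρ : s.IsUnitaryRep ρ)
    {N : ℕ} [NeZero N] (hN : ∀ p : Equiv.Perm s.Dart, p ^ N = 1) {a : G} (ha : a ≠ 1)
    [DecidableEq s.Dart] : Matrix.trace (ρ a : Matrix (Fin g) (Fin g) ℂ) =
      1 - ∑ k ∈ Finset.range N, rotCoeff N k *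
        (Finset.univ.filter fun d : s.Dart => a • (s.rot ^ k) d = d).card := by
  classical
  obtain ⟨Ψ₁, Ψ₂, hE₁, hE₂, hsurj, hform, hker⟩ := s.exists_homology_maps hρ
  set p : Equiv.Perm s.Dart := MulAction.toPerm a
  set T : End ℂ s.Chain := unitaryEnd (s.permAct p)
  set R : End ℂ s.Chain := unitaryEnd (s.permAct s.rot)
  have hpow : ∀ q : Equiv.Perm s.Dart, unitaryEnd (s.permAct q) ^ N = 1 := by
    intro q
    rw [unitaryEnd_pow, ← map_pow, hN, map_one]; rfl
  have hmul : ∀ q q' : Equiv.Perm s.Dart, ∀ k : ℕ, unitaryEnd (s.permAct q) *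
      unitaryEnd (s.permAct q') ^ k = unitaryEnd (s.permAct (q * q' ^ k)) := by
    intro q q' k
    rw [unitaryEnd_pow, ← map_pow, map_mul]; rfl
  have hcomm : ∀ q : Equiv.Perm s.Dart, Commute p q → Commute (unitaryEnd (s.permAct q)) T := by
    intro q hq
    change unitaryEnd (s.permAct q * s.permAct p) = unitaryEnd (s.permAct p * s.permAct q)
    rw [← map_mul, ← map_mul, hq.eq]
  have hT : T ^ N = 1 := hpow p
  let M₁ : End ℂ (Fin g → ℂ) := Matrix.mulVecLin (ρ a : Matrix (Fin g) (Fin g) ℂ)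
  let M₂ : End ℂ (Fin g → ℂ) := Matrix.mulVecLin ((ρ a : Matrix (Fin g) (Fin g) ℂ).map star)
  have hTE : ∀ z ∈ s.complexCycles, T z ∈ s.complexCycles := fun z hz => s.permAct_toPerm_mem a hz
  have hEpow : ∀ M : End ℂ (Fin g → ℂ), ∀ Ψ : s.Chain →ₗ[ℂ] (Fin g → ℂ),
      (∀ z ∈ s.complexCycles, Ψ (T z) = M (Ψ z)) → (∀ y, ∃ z ∈ s.complexCycles, Ψ z = y) →
      M ^ N = 1 := by
    intro M Ψ hM hs
    have h : ∀ k : ℕ, ∀ z ∈ s.complexCycles, (T ^ k) z ∈ s.complexCycles ∧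
        Ψ ((T ^ k) z) = (M ^ k) (Ψ z) := by
      intro k z hz
      induction k with
      | zero => exact ⟨hz, rfl⟩
      | succ k ih =>
        rw [pow_succ', pow_succ', Module.End.mul_apply, Module.End.mul_apply, hM _ ih.1, ih.2]
        exact ⟨hTE _ ih.1, rfl⟩
    refine LinearMap.ext fun y => ?_
    obtain ⟨z, hz, rfl⟩ := hs y
    rw [← (h N z hz).2, hT]
    rfl
  have hM₁ : M₁ ^ N = 1 := hEpow M₁ Ψ₁ (hE₁ a) fun y =>
    let ⟨z, hz, h, _⟩ := hsurj y 0; ⟨z, hz, h⟩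
  have hM₂ : M₂ ^ N = 1 := hEpow M₂ Ψ₂ (hE₂ a) fun y =>
    let ⟨z, hz, _, h⟩ := hsurj 0 y; ⟨z, hz, h⟩
  -- the symmetries that commute with `a`
  let Γ : Subgroup (Equiv.Perm s.Dart) := Subgroup.centralizer {p}
  let _ : Fintype Γ := Fintype.ofFinite Γ
  let π : Γ →* (s.Chain ≃ₗᵢ[ℂ] s.Chain) := s.permAct.comp Γ.subtype
  let r : Γ := ⟨s.rot, Subgroup.mem_centralizer_singleton_iff.2 (s.commute_toPerm_rot a).eq.symm⟩
  let t : Γ := ⟨s.rev, Subgroup.mem_centralizer_singleton_iff.2 (s.commute_toPerm_rev a).eq.symm⟩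
  have hΓ : ∀ q : Γ, Commute (unitaryEnd (π q)) T := fun q =>
    hcomm q (Subgroup.mem_centralizer_singleton_iff.1 q.2).symm
  have hrinv : (π r)⁻¹ = s.rotOp := (map_inv s.permAct s.rot).symm
  let W : ℕ → Submodule ℂ s.Chain := fun j => End.eigenspace T (unityRoot N ^ j)
  have hW : ∀ j z, z ∈ W j ↔ T z = unityRoot N ^ j • z := fun j z => End.mem_eigenspace_iff
  have hcyc : ∀ z, z ∈ cycleSpace (π r) (π t) ↔ z ∈ s.complexCycles := fun z => by
    rw [complexCycles_eq]; exact Iff.rfl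
  -- W j is stable under the centralizer Γ of a; Γ is a finite group containing rot and rev, so the
  -- sawtooth formula applies to it.
  have key := fun j => finrank_homology_inf π (r := r) (t := t) (n := N) (Subtype.ext (hN _))
    (Subtype.ext (Equiv.ext s.rev_rev)) (Subtype.ext (hN _)) (W := W j)
    (fun q z hz => by
      rw [hW] at hz ⊢
      have h1 : T (unitaryEnd (π q) z) = unitaryEnd (π q) (T z) :=
        LinearMap.congr_fun (hΓ q).eq.symm z
      refine h1.trans ?_
      rw [hz, map_smul]; rfl)
    (eigenProj_isProj hT j)
    (fun q z => LinearMap.congr_fun (eigenProj_commute (hΓ q) N j).eq.symm z)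
    (N := fun y : Fin g → ℂ => ∑ k, Complex.normSq (y k)) (by simp)
    (fun y hy => by
      obtain ⟨k, hk⟩ := Function.ne_iff.1 hy
      exact Finset.sum_pos' (fun i _ => Complex.normSq_nonneg _)
        ⟨k, Finset.mem_univ k, Complex.normSq_pos.2 hk⟩)
    (End.eigenspace M₁ (unityRoot N ^ j)) (End.eigenspace M₂ (unityRoot N ^ j)) Ψ₁ Ψ₂
    (fun z hz hc => by
      rw [End.mem_eigenspace_iff, ← hE₁ a z ((hcyc z).1 hc), ← map_smul, ← (hW j z).1 hz]
      rfl)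
    (fun z hz hc => by
      rw [End.mem_eigenspace_iff, ← hE₂ a z ((hcyc z).1 hc), ← map_smul, ← (hW j z).1 hz]
      rfl)
    (fun y₁ hy₁ y₂ hy₂ => by
      obtain ⟨z, hz, h1, h2⟩ := hsurj y₁ y₂
      refine ⟨eigenProj T N j z, (eigenProj_isProj hT j).map_mem z,
        (hcyc _).2 (eigenProj_mem hTE N j hz), ?_, ?_⟩
      · rw [map_eigenProj hTE (hE₁ a) N j hz, h1]
        exact (eigenProj_isProj hM₁ j).map_id y₁ hy₁
      · rw [map_eigenProj hTE (hE₂ a) N j hz, h2]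
        exact (eigenProj_isProj hM₂ j).map_id y₂ hy₂)
    (fun u hu => by
      rw [hcyc, hrinv] at hu
      rw [hrinv]
      exact hform u hu)
    (fun z => by rw [hcyc]; exact hker z)
  -- the weighted sums of the dimensions are traces
  have hsum : ∀ (S : End ℂ s.Chain) (Z : Submodule ℂ s.Chain), Commute S T →
      LinearMap.IsProj Z S → ∑ j ∈ Finset.range N, unityRoot N ^ j *
        (finrank ℂ ↥(W j ⊓ Z) : ℂ) = LinearMap.trace ℂ s.Chain (T * S) :=
    fun S Z hS hZ => sum_finrank_inf_eigenspace hT hS hZ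
  have hface : ∀ k : ℕ, LinearMap.trace ℂ s.Chain
      (T * unitaryEnd (s.permAct (s.rot⁻¹ * s.rev)) ^ k) = 0 := fun k => by
    rw [hmul]
    exact s.trace_permAct_eq_zero fun d => s.smul_face_ne ha k d
  have hcoface : ∀ k : ℕ, LinearMap.trace ℂ s.Chain
      (T * unitaryEnd (s.permAct (s.rot * s.rev)) ^ k) = 0 := fun k => by
    rw [hmul]
    exact s.trace_permAct_eq_zero fun d => s.smul_coface_ne ha k d
  have htrT : LinearMap.trace ℂ s.Chain T = 0 := s.trace_permAct_eq_zero fun d => s.smul_ne ha d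
  have hcRot : Commute p s.rot := s.commute_toPerm_rot a
  have hcRev : Commute p s.rev := s.commute_toPerm_rev a
  have htau2 : unitaryEnd (s.permAct s.rev) ^ 2 = 1 := by
    rw [unitaryEnd_pow, ← map_pow, pow_two]
    have : s.rev * s.rev = 1 := Equiv.ext s.rev_rev
    rw [this, map_one]; rfl
  let τ : ℕ → ℂ := fun k => LinearMap.trace ℂ s.Chain (T * eigenProj R N k)
  have s1 : ∀ k, ∑ j ∈ Finset.range N, unityRoot N ^ j *
      (finrank ℂ ↥(W j ⊓ End.eigenspace (unitaryEnd (π r)) (unityRoot N ^ k)) : ℂ) = τ k :=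
    fun k => hsum _ _ (eigenProj_commute (hcomm _ hcRot).symm N k).symm
      (eigenProj_isProj (hpow s.rot) k)
  have s2 : ∀ k, ∑ j ∈ Finset.range N, unityRoot N ^ j *
      (finrank ℂ ↥(W j ⊓ End.eigenspace (unitaryEnd (π (r * t))) (unityRoot N ^ k)) : ℂ) = 0 :=
    fun k => (hsum _ _ (eigenProj_commute (hcomm _ (hcRot.mul_right hcRev)).symm N k).symm
      (eigenProj_isProj (hpow (s.rot * s.rev)) k)).trans (trace_eigenProj_eq_zero hcoface N k)
  have s3 : ∑ j ∈ Finset.range N, unityRoot N ^ j *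
      (finrank ℂ ↥(W j ⊓ fixedSpace (π r)) : ℂ) = τ 0 := by
    refine Eq.trans (Finset.sum_congr rfl fun j _ => ?_) (s1 0)
    rw [fixedSpace_eq_eigenspace (π r) N]
  have s4 : ∑ j ∈ Finset.range N, unityRoot N ^ j *
      (finrank ℂ ↥(W j ⊓ fixedSpace (π (r⁻¹ * t))) : ℂ) = 0 := by
    refine Eq.trans (Finset.sum_congr rfl fun j _ => ?_) ((hsum _ _ (eigenProj_commute (hcomm _ (hcRot.inv_right.mul_right hcRev)).symm N 0).symm
      (eigenProj_isProj (hpow (s.rot⁻¹ * s.rev)) 0)).trans (trace_eigenProj_eq_zero hface N 0))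
    rw [fixedSpace_eq_eigenspace (π (r⁻¹ * t)) N]
    rfl
  have hneg : unityRoot 2 ^ 1 = -1 := by
    rw [pow_one, unityRoot]
    have : (2 * (Real.pi : ℂ) * Complex.I / ((2 : ℕ) : ℂ)) = Real.pi * Complex.I := by
      push_cast; ring
    rw [this, Complex.exp_pi_mul_I]
  -- The odd functions are the image of the projection of rev with n = 2, j = 1; neither a nor a *
  -- rev fixes a dart.
  have s5 : ∑ j ∈ Finset.range N, unityRoot N ^ j *
      (finrank ℂ ↥(W j ⊓ End.eigenspace (unitaryEnd (π t)) (-1)) : ℂ) = 0 := by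
    rw [← hneg]
    refine (hsum _ _ (eigenProj_commute (hcomm _ hcRev).symm 2 1).symm
      (eigenProj_isProj htau2 1)).trans ?_
    have h0 : T * unitaryEnd (s.permAct s.rev) ^ 0 = T := mul_one T
    rw [trace_eigenProj, Finset.sum_range_succ, Finset.sum_range_one, h0, htrT, hmul, pow_one,
      s.trace_permAct_eq_zero fun d h => s.edge_free a (s.rev d) (h.trans (s.rev_rev d).symm)]
    simp
  -- The constants are fixed by a, hence occur for the eigenvalue 1 only.
  have s6 : ∑ j ∈ Finset.range N, unityRoot N ^ j *
      (finrank ℂ ↥(W j ⊓ (fixedSpace (π r) ⊓ fixedSpace (π t))) : ℂ) = 1 := by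
    have hc : fixedSpace (π r) ⊓ fixedSpace (π t) =
        Submodule.span ℂ {(WithLp.toLp 2 fun _ => 1 : s.Chain)} := Submodule.ext s.mem_constants
    rw [Finset.sum_eq_single 0]
    · have h0 : W 0 ⊓ (fixedSpace (π r) ⊓ fixedSpace (π t)) =
          Submodule.span ℂ {(WithLp.toLp 2 fun _ => 1 : s.Chain)} := by
        rw [hc]
        refine inf_eq_right.2 ((Submodule.span_singleton_le_iff_mem _ _).2 ?_)
        rw [hW, pow_zero, one_smul]
        rfl
      rw [h0, finrank_span_singleton]
      · simp
      · intro h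
        obtain ⟨d⟩ := s.nonemptyDart
        exact one_ne_zero (congrArg (fun y : s.Chain => y d) h)
    · intro j hj hj0
      have h0 : W j ⊓ (fixedSpace (π r) ⊓ fixedSpace (π t)) = ⊥ := by
        rw [hc, Submodule.eq_bot_iff]
        intro z hz
        obtain ⟨c, rfl⟩ := Submodule.mem_span_singleton.1 hz.2
        have h1 := (hW j _).1 hz.1
        have h2 : T (c • (WithLp.toLp 2 fun _ => 1 : s.Chain)) = c • WithLp.toLp 2 fun _ => 1 := rfl
        rw [h2] at h1
        by_contra hne
        have h3 : unityRoot N ^ j = unityRoot N ^ 0 := by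
          rw [pow_zero]
          by_contra hω
          refine hne ((smul_eq_zero.1 ?_).resolve_left (sub_ne_zero.2 hω))
          rw [sub_smul, ← h1, one_smul, sub_self]
        exact hj0 (unityRoot_pow_inj (Finset.mem_range.1 hj) (NeZero.pos N) h3)
      rw [h0, finrank_bot, Nat.cast_zero, mul_zero]
    · intro h
      exact absurd (Finset.mem_range.2 (NeZero.pos N)) h
  have t1 := sum_finrank_eigenspace hM₁
  have t2 := sum_finrank_eigenspace hM₂
  have htr : LinearMap.trace ℂ (Fin g → ℂ) M₁ = Matrix.trace (ρ a : Matrix (Fin g) (Fin g) ℂ) :=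
    Matrix.trace_toLin'_eq _
  rw [htr] at t1
  -- The signature relation: difference of the traces of φ and its conjugate.
  have e1 : Matrix.trace (ρ a : Matrix (Fin g) (Fin g) ℂ) - LinearMap.trace ℂ (Fin g → ℂ) M₂ =
      ∑ k ∈ Finset.range N, (sawtooth N k : ℂ) * τ k := by
    rw [← t1, ← t2, ← Finset.sum_sub_distrib]
    have h1 : ∀ j, unityRoot N ^ j * (finrank ℂ (End.eigenspace M₁ (unityRoot N ^ j)) : ℂ) -
        unityRoot N ^ j * (finrank ℂ (End.eigenspace M₂ (unityRoot N ^ j)) : ℂ) =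
        ∑ k ∈ Finset.range N, (sawtooth N k : ℂ) * (unityRoot N ^ j *
          (finrank ℂ ↥(W j ⊓ End.eigenspace (unitaryEnd (π r)) (unityRoot N ^ k)) : ℂ) -
          unityRoot N ^ j *
          (finrank ℂ ↥(W j ⊓ End.eigenspace (unitaryEnd (π (r * t))) (unityRoot N ^ k)) : ℂ)) := by
      intro j
      have h2 := congrArg (fun x : ℝ => (x : ℂ)) (key j).1
      push_cast at h2
      rw [← mul_sub, h2, Finset.mul_sum]
      exact Finset.sum_congr rfl fun k _ => by ring
    simp only [h1]
    rw [Finset.sum_comm]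
    refine Finset.sum_congr rfl fun k _ => ?_
    rw [← Finset.mul_sum, Finset.sum_sub_distrib, s1, s2, sub_zero]
  -- The Euler characteristic relation: sum of the two traces.
  have e2 : Matrix.trace (ρ a : Matrix (Fin g) (Fin g) ℂ) + LinearMap.trace ℂ (Fin g → ℂ) M₂ +
      τ 0 = 2 := by
    have h1 : ∀ j, unityRoot N ^ j * (finrank ℂ (End.eigenspace M₁ (unityRoot N ^ j)) : ℂ) +
        unityRoot N ^ j * (finrank ℂ (End.eigenspace M₂ (unityRoot N ^ j)) : ℂ) +
        unityRoot N ^ j * (finrank ℂ ↥(W j ⊓ fixedSpace (π r)) : ℂ) +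
        unityRoot N ^ j * (finrank ℂ ↥(W j ⊓ fixedSpace (π (r⁻¹ * t))) : ℂ) =
        unityRoot N ^ j * (finrank ℂ ↥(W j ⊓ End.eigenspace (unitaryEnd (π t)) (-1)) : ℂ) +
        2 * (unityRoot N ^ j *
          (finrank ℂ ↥(W j ⊓ (fixedSpace (π r) ⊓ fixedSpace (π t))) : ℂ)) := by
      intro j
      have h2 := congrArg (fun x : ℕ => (x : ℂ)) (key j).2
      push_cast at h2
      linear_combination unityRoot N ^ j * h2
    have h3 := Finset.sum_congr (rfl : Finset.range N = Finset.range N) fun j _ => h1 j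
    simp only [Finset.sum_add_distrib] at h3
    rw [← Finset.mul_sum, t1, t2, s3, s4, s5, s6] at h3
    linear_combination h3
  -- The spectral projections of rot add up to 1, and a fixes no dart.
  have e3 : ∑ k ∈ Finset.range N, τ k = 0 := by
    have h1 : ∑ k ∈ Finset.range N, eigenProj R N k = 1 := by
      refine LinearMap.ext fun x => ?_
      rw [LinearMap.sum_apply, sum_eigenProj]
      rfl
    rw [← map_sum, ← Finset.mul_sum, h1, mul_one, htrT]
  have e4 : ∑ k ∈ Finset.range N, (sawtooth N k : ℂ) * τ k =
      -2 * ∑ k ∈ Finset.range N, (k / N : ℂ) * τ k - τ 0 := by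
    have h1 : ∀ k, (sawtooth N k : ℂ) * τ k =
        τ k - 2 * ((k / N : ℂ) * τ k) - if k = 0 then τ 0 else 0 := by
      intro k
      unfold sawtooth
      split_ifs with hk
      · subst hk; simp
      · push_cast; ring
    simp only [h1]
    rw [Finset.sum_sub_distrib, Finset.sum_sub_distrib, e3, ← Finset.mul_sum, Finset.sum_ite_eq',
      if_pos (Finset.mem_range.2 (NeZero.pos N))]
    ring
  -- Summing over 1, …, N instead of 0, …, N - 1 gives the index 0 the weight 1; this absorbs the
  -- extra τ 0 coming from e2 and from the convention for the sawtooth at 0.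
  have e5 : ∑ j ∈ Finset.range N, ((j + 1 : ℕ) / N : ℂ) * τ (j + 1) =
      ∑ k ∈ Finset.range N, (k / N : ℂ) * τ k + τ 0 := by
    have h1 := Finset.sum_range_succ' (fun k : ℕ => (k / N : ℂ) * τ k) N
    rw [Finset.sum_range_succ] at h1
    have hN0 : (N : ℂ) ≠ 0 := Nat.cast_ne_zero.2 (NeZero.ne N)
    have h2 : τ N = τ 0 := by simp only [τ]; rw [eigenProj_self_right]
    rw [div_self hN0, one_mul, h2] at h1
    rw [h1]
    simp
  have e6 : ∑ j ∈ Finset.range N, ((j + 1 : ℕ) / N : ℂ) * τ (j + 1) =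
      ∑ k ∈ Finset.range N, rotCoeff N k *
        (Finset.univ.filter fun d : s.Dart => a • (s.rot ^ k) d = d).card := by
    have h1 : ∀ k : ℕ, LinearMap.trace ℂ s.Chain (T * R ^ k) =
        (Finset.univ.filter fun d : s.Dart => a • (s.rot ^ k) d = d).card := fun k => by
      rw [hmul, trace_permAct]
      rfl
    simp only [τ, trace_eigenProj, h1, rotCoeff, Finset.mul_sum, Finset.sum_mul]
    rw [Finset.sum_comm]
    refine Finset.sum_congr rfl fun k _ => Finset.sum_congr rfl fun j _ => ?_
    ring
  rw [← e6, e5]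
  rw [e4] at e1
  linear_combination (e1 + e2) / 2

end GSurface

/-! ## Summation over the orbits -/

theorem unityRoot_mul_pow (m t : ℕ) [NeZero t] : unityRoot (m * t) ^ t = unityRoot m := by
  have ht : (t : ℂ) ≠ 0 := Nat.cast_ne_zero.2 (NeZero.ne t)
  rw [unityRoot, unityRoot, ← Complex.exp_nat_mul]
  congr 1
  push_cast
  rw [mul_div_assoc', mul_comm (m : ℂ), mul_div_mul_left _ _ ht]

/-- Abel summation of ∑ j u^(-j), whose geometric part vanishes over a full period. -/
theorem rotCoeff_eq {n l : ℕ} [NeZero n] (h : unityRoot n ^ l ≠ 1) :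
    rotCoeff n l = ((n : ℂ) * (1 - unityRoot n ^ l))⁻¹ := by
  have hn : (n : ℂ) ≠ 0 := Nat.cast_ne_zero.2 (NeZero.ne n)
  set u := unityRoot n ^ l with hu
  have hu0 : u ≠ 0 := pow_ne_zero _ (unityRoot_ne_zero n)
  have hun : u ^ n = 1 := by
    rw [hu, ← pow_mul, mul_comm, pow_mul, (unityRoot_primitive n).pow_eq_one, one_pow]
  have h1 : ∀ m : ℕ, (1 - u) * ∑ j ∈ Finset.range m, ((j + 1 : ℕ) : ℂ) * u⁻¹ ^ (j + 1) =
      m * u⁻¹ ^ m - ∑ j ∈ Finset.range m, u⁻¹ ^ j := by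
    intro m
    induction m with
    | zero => simp
    | succ m ih =>
      rw [Finset.sum_range_succ, Finset.sum_range_succ, mul_add, ih]
      have : u * u⁻¹ ^ (m + 1) = u⁻¹ ^ m := by rw [pow_succ']; field_simp
      push_cast
      linear_combination (-((m : ℂ) + 1)) * this
  have h2 := h1 n
  have h3 : ∑ j ∈ Finset.range n, u⁻¹ ^ j = 0 := by
    rw [geom_sum_unityRoot n (by rw [inv_pow, hun, inv_one]), if_neg]
    rwa [inv_eq_one]
  rw [h3, inv_pow, hun, inv_one, mul_one, sub_zero] at h2
  have h4 : rotCoeff n l = (n : ℂ)⁻¹ * ((n : ℂ)⁻¹ *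
      ∑ j ∈ Finset.range n, ((j + 1 : ℕ) : ℂ) * u⁻¹ ^ (j + 1)) := by
    rw [rotCoeff]
    congr 1
    rw [Finset.mul_sum]
    refine Finset.sum_congr rfl fun j _ => ?_
    rw [hu, ← inv_pow, ← pow_mul, mul_comm l]
    ring
  have hne : 1 - u ≠ 0 := sub_ne_zero.2 (Ne.symm h)
  rw [h4, (eq_mul_inv_iff_mul_eq₀ hne).2 ((mul_comm _ _).trans h2), mul_inv, inv_mul_cancel_left₀ hn]

theorem _root_.Finset.sum_range_mul {M : Type*} [AddCommMonoid M] (f : ℕ → M) (m t : ℕ) :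
    ∑ k ∈ Finset.range (m * t), f k =
      ∑ s ∈ Finset.range t, ∑ i ∈ Finset.range m, f (m * s + i) := by
  induction t with
  | zero => simp
  | succ t ih => rw [mul_add, mul_one, Finset.sum_range_add, ih, Finset.sum_range_succ]

/-- The distribution relation. -/
theorem sum_rotCoeff (m t l : ℕ) [NeZero m] [NeZero t] :
    ∑ s ∈ Finset.range t, rotCoeff (m * t) (m * s + l) = rotCoeff m l := by
  have hm : (m : ℂ) ≠ 0 := Nat.cast_ne_zero.2 (NeZero.ne m)
  have ht : (t : ℂ) ≠ 0 := Nat.cast_ne_zero.2 (NeZero.ne t)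
  set ξ := (unityRoot (m * t))⁻¹ with hξ
  have hprim : IsPrimitiveRoot ξ (m * t) := (unityRoot_primitive (m * t)).inv
  have h1 : ∀ j : ℕ, ∑ s ∈ Finset.range t, ξ ^ (j * (m * s + l)) =
      if t ∣ j then (t : ℂ) * ξ ^ (j * l) else 0 := by
    intro j
    have h2 : ∀ s, ξ ^ (j * (m * s + l)) = (ξ ^ (m * j)) ^ s * ξ ^ (j * l) := by
      intro s
      rw [← pow_mul, ← pow_add]
      congr 1
      ring
    simp only [h2]
    rw [← Finset.sum_mul, geom_sum_unityRoot t (by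
      rw [← pow_mul, mul_right_comm, pow_mul, hprim.pow_eq_one, one_pow])]
    have h3 : ξ ^ (m * j) = 1 ↔ t ∣ j := by
      rw [hprim.pow_eq_one_iff_dvd, Nat.mul_dvd_mul_iff_left (NeZero.pos m)]
    simp only [h3, ite_mul, zero_mul]
  have h4 : ∑ s ∈ Finset.range t, rotCoeff (m * t) (m * s + l) = ((m * t : ℕ) : ℂ)⁻¹ *
      ∑ j ∈ Finset.range (m * t), ((j + 1 : ℕ) / (m * t : ℕ) : ℂ) *
        (if t ∣ j + 1 then (t : ℂ) * ξ ^ ((j + 1) * l) else 0) := by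
    simp only [rotCoeff, ← h1, Finset.mul_sum]
    rw [Finset.sum_comm]
  have h5 : ∀ i, ∑ j ∈ Finset.range t, (((t * i + j + 1 : ℕ)) / (m * t : ℕ) : ℂ) *
        (if t ∣ t * i + j + 1 then (t : ℂ) * ξ ^ ((t * i + j + 1) * l) else 0) =
      ((i + 1 : ℕ) / m : ℂ) * (t * (unityRoot m)⁻¹ ^ ((i + 1) * l)) := by
    intro i
    have ht1 : t - 1 + 1 = t := Nat.sub_add_cancel (NeZero.pos t)
    -- Within a block of t indices, only the last one makes the shifted index j + 1 divisible by t.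
    rw [Finset.sum_eq_single (t - 1)]
    · have h6 : t * i + (t - 1) + 1 = t * (i + 1) := by rw [add_assoc, ht1]; ring
      rw [h6, if_pos (dvd_mul_right t _), mul_assoc t, pow_mul, hξ, inv_pow, unityRoot_mul_pow]
      congr 1
      push_cast
      rw [mul_comm (m : ℂ), mul_div_mul_left _ _ ht]
    · intro j hj hne
      rw [if_neg, mul_zero]
      rw [add_assoc, Nat.dvd_add_right (dvd_mul_right t i)]
      intro hdvd
      have := Nat.le_of_dvd (Nat.succ_pos j) hdvd
      have := Finset.mem_range.1 hj
      omega
    · intro h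
      exact absurd (Finset.mem_range.2 (by omega)) h
  rw [h4, mul_comm m t, Finset.sum_range_mul]
  simp only [mul_comm t m]
  rw [Finset.sum_congr rfl fun i _ => h5 i, rotCoeff]
  have h7 : ∀ i : ℕ, ((i + 1 : ℕ) / m : ℂ) * (t * (unityRoot m)⁻¹ ^ ((i + 1) * l)) =
      t * (((i + 1 : ℕ) / m : ℂ) * (unityRoot m)⁻¹ ^ ((i + 1) * l)) := fun i => by ring
  simp only [h7]
  rw [← Finset.mul_sum, ← mul_assoc]
  congr 1
  push_cast
  field_simp

/-! ### Local contributions to the trace -/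

section OrbitChar

variable {G : Type*} [Group G]

open Classical in
/-- The local contribution of a rotation `γ` through `2π / ν` to the trace of `h`. -/
def rotSum (γ h : G) : ℂ :=
  ∑ q ∈ Finset.range (orderOf γ), if γ ^ q = h⁻¹ then rotCoeff (orderOf γ) q else 0

theorem rotSum_conj (c γ h : G) : rotSum (c * γ * c⁻¹) h = rotSum γ (c⁻¹ * h * c) := by
  have h1 : orderOf (c * γ * c⁻¹) = orderOf γ := by
    rw [← MulAut.conj_apply]
    exact orderOf_injective (MulAut.conj c).toMonoidHom (MulAut.conj c).injective γ
  classical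
  unfold rotSum
  rw [h1]
  refine Finset.sum_congr rfl fun q _ => if_congr ?_ rfl rfl
  rw [conj_pow, mul_inv_rev, mul_inv_rev, inv_inv]
  constructor
  · intro e; rw [← e]; group
  · intro e; rw [e]; group

variable [Fintype G]

/-- The sum of the local contributions of the points of an orbit. -/
def orbitSum (γ a : G) : ℂ := ∑ x : G, rotSum γ (x⁻¹ * a * x)

theorem orbitSum_conj (c γ a : G) : orbitSum (c * γ * c⁻¹) a = orbitSum γ a := by
  unfold orbitSum
  refine Fintype.sum_equiv (Equiv.mulRight c) _ _ fun x => ?_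
  rw [rotSum_conj]
  congr 1
  simp only [Equiv.coe_mulRight]
  group

/-- `orbitSum` as a function of the conjugacy class. -/
def orbitChar : ConjClasses G → G → ℂ :=
  Quotient.lift (fun γ : G => orbitSum γ) (by
    intro γ γ' h
    obtain ⟨c, rfl⟩ := isConj_iff.1 h
    exact funext fun a => (orbitSum_conj c γ a).symm)

theorem orbitChar_mk (γ : G) : orbitChar (ConjClasses.mk γ) = orbitSum γ := rfl

end OrbitChar

/-! ### Eichler's trace formula in terms of orbit data -/

namespace GSurface

variable {G : Type*} [Group G] (s : GSurface G)

theorem eq_of_smul_eq {a b : G} {d : s.Dart} (h : a • d = b • d) : a = b := by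
  by_contra hne
  refine s.smul_ne (a := b⁻¹ * a) (fun h1 => hne (inv_mul_eq_one.1 h1).symm) d ?_
  rw [mul_smul, h, inv_smul_smul]

variable {s} {d₀ : s.Dart} {γ : G} {M : ℕ}

theorem rot_pow_mul_eq (hγ : γ • d₀ = (s.rot ^ M) d₀) (q : ℕ) : (s.rot ^ (M * q)) d₀ = γ ^ q • d₀ := by
  induction q with
  | zero => simp
  | succ q ih =>
    rw [mul_add, mul_one, add_comm, pow_add, Equiv.Perm.mul_apply, ih, ← s.smul_rot_pow, ← hγ,
      ← mul_smul, ← pow_succ]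

/-- By minimality of M only multiples of M are rotations realized by G, and G acts freely on darts,
so the element realizing M q is γ^q and no other. -/
theorem rot_pow_eq_smul_iff (hγ : γ • d₀ = (s.rot ^ M) d₀)
    (hmin : ∀ j : ℕ, 0 < j → j < M → ∀ b : G, b • d₀ ≠ (s.rot ^ j) d₀) {q i : ℕ} (hi : i < M)
    (b : G) : (s.rot ^ (M * q + i)) d₀ = b • d₀ ↔ i = 0 ∧ γ ^ q = b := by
  have h1 : (s.rot ^ (M * q + i)) d₀ = γ ^ q • (s.rot ^ i) d₀ := by
    rw [add_comm, pow_add, Equiv.Perm.mul_apply, rot_pow_mul_eq hγ, s.smul_rot_pow]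
  rw [h1]
  constructor
  · intro h
    have hi0 : i = 0 := by
      by_contra hne
      refine hmin i (Nat.pos_of_ne_zero hne) hi ((γ ^ q)⁻¹ * b) ?_
      rw [mul_smul, ← h, inv_smul_smul]
    subst hi0
    exact ⟨rfl, s.eq_of_smul_eq h⟩
  · rintro ⟨rfl, rfl⟩
    simp

/-- The period N is a multiple of the valence M ν of the vertex, and the distribution relation
reduces the sum to one period. There only the multiples M q survive, with coefficient 1/(M ν (1 -
ζ^q)); the factor M cancels. -/
theorem sum_rotCoeff_vertex [Finite G] {N : ℕ} [NeZero N] (hN : s.rot ^ N = 1) (hM : 0 < M)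
    (hγ : γ • d₀ = (s.rot ^ M) d₀)
    (hmin : ∀ j : ℕ, 0 < j → j < M → ∀ b : G, b • d₀ ≠ (s.rot ^ j) d₀) {h : G} (hh : h ≠ 1)
    [DecidableEq s.Dart] :
    (M : ℂ) * ∑ k ∈ Finset.range N, (if (s.rot ^ k) d₀ = h⁻¹ • d₀ then rotCoeff N k else 0) =
      rotSum γ h := by
  classical
  set ν := orderOf γ with hν
  have : NeZero ν := ⟨(orderOf_pos γ).ne'⟩
  have : NeZero M := ⟨hM.ne'⟩
  have hdvd : M * ν ∣ N := by
    have h1 : (s.rot ^ (M * (N / M) + N % M)) d₀ = (1 : G) • d₀ := by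
      rw [Nat.div_add_mod, hN, one_smul]; rfl
    obtain ⟨h2, h3⟩ := (rot_pow_eq_smul_iff hγ hmin (Nat.mod_lt N hM) 1).1 h1
    have h4 := Nat.div_add_mod N M
    rw [h2, add_zero] at h4
    rw [← h4]
    exact Nat.mul_dvd_mul_left M (orderOf_dvd_of_pow_eq_one h3)
  obtain ⟨t, rfl⟩ := hdvd
  have : NeZero t := ⟨by rintro rfl; exact NeZero.ne (M * ν * 0) (mul_zero _)⟩
  have hper : (s.rot ^ (M * ν)) d₀ = d₀ := by
    rw [rot_pow_mul_eq hγ, hν, pow_orderOf_eq_one, one_smul]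
  have hper' : ∀ k i, (s.rot ^ (M * ν * k + i)) d₀ = (s.rot ^ i) d₀ := by
    intro k i
    rw [add_comm, pow_add, Equiv.Perm.mul_apply]
    congr 1
    induction k with
    | zero => simp
    | succ k ih => rw [mul_add, mul_one, pow_add, Equiv.Perm.mul_apply, hper, ih]
  rw [Finset.sum_range_mul, Finset.sum_comm]
  have h1 : ∀ i, ∑ k ∈ Finset.range t, (if (s.rot ^ (M * ν * k + i)) d₀ = h⁻¹ • d₀ then
      rotCoeff (M * ν * t) (M * ν * k + i) else 0) =
      if (s.rot ^ i) d₀ = h⁻¹ • d₀ then rotCoeff (M * ν) i else 0 := by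
    intro i
    simp only [hper']
    split_ifs
    · exact sum_rotCoeff (M * ν) t i
    · simp
  rw [Finset.sum_congr rfl fun i _ => h1 i, Finset.sum_range_mul, Finset.mul_sum, rotSum]
  refine Finset.sum_congr rfl fun q hq => ?_
  rw [Finset.sum_eq_single 0]
  · have h2 := rot_pow_eq_smul_iff hγ hmin hM (q := q) h⁻¹
    rw [if_congr h2 rfl rfl]
    simp only [true_and, add_zero]
    split_ifs with h3
    -- h ≠ 1 excludes the pole of the closed formula.
    · have h4 : unityRoot ν ^ q ≠ 1 := by
        rw [Ne, (unityRoot_primitive ν).pow_eq_one_iff_dvd, hν, orderOf_dvd_iff_pow_eq_one, h3]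
        simpa using hh
      have h5 : unityRoot (M * ν) ^ (M * q) = unityRoot ν ^ q := by
        rw [pow_mul, mul_comm M, unityRoot_mul_pow]
      have hM0 : (M : ℂ) ≠ 0 := Nat.cast_ne_zero.2 hM.ne'
      rw [rotCoeff_eq (by rwa [h5]), rotCoeff_eq h4, h5]
      push_cast
      rw [mul_inv, mul_inv, mul_inv, mul_assoc, mul_inv_cancel_left₀ hM0]
    · simp
  · intro i hi hi0
    rw [if_neg]
    rw [rot_pow_eq_smul_iff hγ hmin (Finset.mem_range.1 hi)]
    exact fun h => hi0 h.1
  · intro h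
    exact absurd (Finset.mem_range.2 hM) h

variable (s)

/-- The dart count is grouped by vertex orbits. The darts over one orbit are x · rot^i d₀ with x in
G and i < M, each once. The contribution does not depend on i, which supplies the factor M of
`sum_rotCoeff_vertex`. -/
theorem trace_unitaryRep_eq_orbitData [Fintype G] {g : ℕ} {ρ : G →* Matrix.unitaryGroup (Fin g) ℂ}
    (hρ : s.IsUnitaryRep ρ) {a : G} (ha : a ≠ 1) :
    Matrix.trace (ρ a : Matrix (Fin g) (Fin g) ℂ) =
      1 - (s.orbitData.map fun c => orbitChar c a).sum := by
  classical
  -- An exponent that kills every permutation of the darts.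
  let N := Fintype.card (Equiv.Perm s.Dart)
  have : NeZero N := ⟨Fintype.card_ne_zero⟩
  have hN : ∀ p : Equiv.Perm s.Dart, p ^ N = 1 := fun p => pow_card_eq_one
  rw [s.trace_unitaryRep hρ hN ha]
  congr 1
  let F : s.Dart → ℂ := fun d =>
    ∑ k ∈ Finset.range N, if a • (s.rot ^ k) d = d then rotCoeff N k else 0
  have h1 : ∑ k ∈ Finset.range N, rotCoeff N k *
      ((Finset.univ.filter fun d : s.Dart => a • (s.rot ^ k) d = d).card : ℂ) = ∑ d, F d := by
    simp only [F]
    rw [Finset.sum_comm]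
    refine Finset.sum_congr rfl fun k _ => ?_
    rw [← Finset.sum_filter, Finset.sum_const, nsmul_eq_mul, mul_comm]
  let _ : Fintype (Quotient s.vertexOrbit) := Fintype.ofFinite _
  have h2 : (s.orbitData.map fun c => orbitChar c a).sum =
      ∑ v : Quotient s.vertexOrbit, orbitSum (s.rotationGenerator v.out) a := by
    rw [orbitData, Multiset.map_map]
    rfl
  rw [h1, h2, ← Finset.sum_fiberwise (s := Finset.univ) (g := fun d => (⟦d⟧ : Quotient s.vertexOrbit))]
  refine Finset.sum_congr rfl fun v _ => ?_
  set d₀ := v.out with hd₀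
  obtain ⟨M, hM, hγ, hmin⟩ := (s.exists_isRotationGenerator d₀).choose_spec
  change s.rotationGenerator d₀ • d₀ = _ at hγ
  set γ := s.rotationGenerator d₀
  have h3 : ∑ p : G × Fin M, F (p.1 • (s.rot ^ (p.2 : ℕ)) d₀) =
      ∑ d ∈ Finset.univ.filter (fun d => (⟦d⟧ : Quotient s.vertexOrbit) = v), F d := by
    refine Finset.sum_bij (fun p _ => p.1 • (s.rot ^ (p.2 : ℕ)) d₀) ?_ ?_ ?_ (fun _ _ => rfl)
    · rintro ⟨x, i⟩ -
      rw [Finset.mem_filter]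
      refine ⟨Finset.mem_univ _, ?_⟩
      rw [← Quotient.out_eq v]
      refine Quotient.sound ⟨x⁻¹, (i : ℕ), ?_⟩
      rw [inv_smul_smul, zpow_natCast]
    · have h4 : ∀ (x y : G) (i j : Fin M), (i : ℕ) ≤ j →
          x • (s.rot ^ (i : ℕ)) d₀ = y • (s.rot ^ (j : ℕ)) d₀ → (x, i) = (y, j) := by
        intro x y i j hij h
        obtain ⟨e, he⟩ := Nat.exists_eq_add_of_le hij
        rw [he, pow_add, Equiv.Perm.mul_apply, s.smul_rot_pow, s.smul_rot_pow,
          (s.rot ^ (i : ℕ)).injective.eq_iff] at h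
        have h5 := (rot_pow_eq_smul_iff (s := s) hγ hmin (q := 0) (i := e)
          (by have := j.2; omega) (y⁻¹ * x)).1 (by
            rw [mul_smul, h, inv_smul_smul, mul_zero, zero_add])
        obtain ⟨rfl, h6⟩ := h5
        rw [pow_zero, eq_comm, inv_mul_eq_one] at h6
        exact Prod.ext h6.symm (Fin.ext he.symm)
      rintro ⟨x, i⟩ - ⟨y, j⟩ - h
      rcases le_total (i : ℕ) j with hij | hij
      · exact h4 x y i j hij h
      · exact (h4 y x j i hij h.symm).symm
    · intro d hd
      have hd' := (Finset.mem_filter.1 hd).2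
      rw [← Quotient.out_eq v] at hd'
      obtain ⟨x, k, hk⟩ := Quotient.exact hd'
      -- The rotation has finite order, so an integer power is a natural one.
      obtain ⟨k', hk'⟩ : ∃ k' : ℕ, s.rot ^ k = s.rot ^ k' := by
        refine ⟨(k % orderOf s.rot).toNat, ?_⟩
        rw [← zpow_natCast, Int.toNat_of_nonneg (Int.emod_nonneg _
          (Int.natCast_ne_zero.2 (orderOf_pos s.rot).ne')), zpow_mod_orderOf]
      refine ⟨(x⁻¹ * γ ^ (k' / M), ⟨k' % M, Nat.mod_lt _ hM⟩), Finset.mem_univ _, ?_⟩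
      change (x⁻¹ * γ ^ (k' / M)) • (s.rot ^ (k' % M)) d₀ = d
      rw [mul_smul, s.smul_rot_pow, ← rot_pow_mul_eq hγ, ← Equiv.Perm.mul_apply, ← pow_add,
        add_comm, Nat.div_add_mod, ← hk']
      exact inv_smul_eq_iff.2 hk.symm
  rw [← h3, Fintype.sum_prod_type, orbitSum]
  refine Finset.sum_congr rfl fun x _ => ?_
  have h4 : ∀ i : Fin M, F (x • (s.rot ^ (i : ℕ)) d₀) = ∑ k ∈ Finset.range N,
      if (s.rot ^ k) d₀ = (x⁻¹ * a * x)⁻¹ • d₀ then rotCoeff N k else 0 := by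
    intro i
    refine Finset.sum_congr rfl fun k _ => if_congr ?_ rfl rfl
    rw [s.smul_rot_pow x, ← Equiv.Perm.mul_apply, ← pow_add, add_comm k, pow_add,
      Equiv.Perm.mul_apply, s.smul_rot_pow, (s.rot ^ (i : ℕ)).injective.eq_iff, ← s.smul_rot_pow,
      mul_inv_rev, mul_inv_rev, inv_inv, mul_smul, mul_smul, eq_inv_smul_iff, eq_inv_smul_iff]
  simp only [h4]
  rw [Finset.sum_const, Finset.card_univ, Fintype.card_fin, nsmul_eq_mul]
  refine sum_rotCoeff_vertex (hN _) hM hγ hmin fun h => ha ?_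
  have : a = x * (x⁻¹ * a * x) * x⁻¹ := by group
  rw [this, h]
  group

end GSurface

/-! ## Virtual characters away from the identity -/

section NullFunctions

variable {G : Type*} [Group G] [Finite G]

theorem ind_trivialChar_mem (K : Subgroup G) : ind K (trivialChar K) ∈ permSubgroup G :=
  AddSubgroup.subset_closure ⟨K, rfl⟩

theorem coe_ind (H : Subgroup G) (χ : RepRing H) : (ind H χ : G → ℂ) = indFun H χ := rfl

theorem ind_trivialChar_apply [Fintype G] (K : Subgroup G) [DecidablePred (· ∈ K)]
    (a : G) :
    (ind K (trivialChar K) : G → ℂ) a =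
      (Nat.card K : ℂ)⁻¹ * ∑ x : G, if x⁻¹ * a * x ∈ K then 1 else 0 := by
  rw [coe_ind, indFun_apply]
  congr 1
  refine Finset.sum_congr rfl fun x _ => ?_
  unfold extendZero
  by_cases h : x⁻¹ * a * x ∈ K
  · rw [if_pos h, dif_pos h]; rfl
  · rw [if_neg h, dif_neg h]

theorem trivialChar_mem : trivialChar G ∈ permSubgroup G := by
  classical
  let _ : Fintype G := Fintype.ofFinite G
  have h : ind ⊤ (trivialChar (⊤ : Subgroup G)) = trivialChar G := by
    refine Subtype.ext (funext fun a => ?_)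
    rw [ind_trivialChar_apply, Subgroup.card_top]
    simp only [Subgroup.mem_top, if_true]
    rw [Finset.sum_const, Finset.card_univ, Nat.card_eq_fintype_card, nsmul_eq_mul, mul_one,
      inv_mul_cancel₀ (Nat.cast_ne_zero.2 Fintype.card_ne_zero)]
    rfl
  rw [← h]
  exact ind_trivialChar_mem ⊤

/-- The mean value of a virtual character is an integer. -/
theorem sum_virtualChar [Fintype G] {χ : G → ℂ} (hχ : χ ∈ RepRing G) :
    ∃ n : ℤ, ∑ a, χ a = n * Nat.card G := by
  have hc : (Nat.card G : ℂ) ≠ 0 := by exact_mod_cast Nat.card_pos.ne'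
  refine AddSubgroup.closure_induction (p := fun (χ : G → ℂ) _ => ∃ n : ℤ, ∑ a, χ a = n * Nat.card G)
    ?_ ?_ ?_ ?_ hχ
  · rintro _ ⟨m, σ, rfl⟩
    have : Invertible (Nat.card G : ℂ) := invertibleOfNonzero hc
    have h := Representation.card_inv_mul_sum_char_eq_finrank (ρ := σ)
    refine ⟨finrank ℂ σ.invariants, ?_⟩
    rw [Int.cast_natCast, ← h]
    field_simp
  · exact ⟨0, by simp⟩
  · rintro χ ψ - - ⟨n, hn⟩ ⟨m, hm⟩
    refine ⟨n + m, ?_⟩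
    simp only [Pi.add_apply, Finset.sum_add_distrib, hn, hm]
    push_cast; ring
  · rintro χ - ⟨n, hn⟩
    refine ⟨-n, ?_⟩
    simp only [Pi.neg_apply, Finset.sum_neg_distrib, hn]
    push_cast; ring

variable (G) in
/-- The functions that agree with an element of `E_G` away from the identity. -/
def nullFunctions : AddSubgroup (G → ℂ) where
  carrier := {f | ∃ e ∈ permSubgroup G, ∀ a, a ≠ 1 → f a = (e : G → ℂ) a}
  zero_mem' := ⟨0, zero_mem _, fun _ _ => rfl⟩
  add_mem' := by
    rintro f f' ⟨e, he, h⟩ ⟨e', he', h'⟩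
    exact ⟨e + e', add_mem he he', fun a ha => congrArg₂ (· + ·) (h a ha) (h' a ha)⟩
  neg_mem' := by
    rintro f ⟨e, he, h⟩
    exact ⟨-e, neg_mem he, fun a ha => congrArg Neg.neg (h a ha)⟩

/-- The difference from an element of E_G is concentrated at 1, and its value there is an integral
multiple of the order of G. It is therefore a multiple of the regular character. -/
theorem mem_permSubgroup_of_mem_nullFunctions {χ : RepRing G}
    (h : (χ : G → ℂ) ∈ nullFunctions G) : χ ∈ permSubgroup G := by
  classical
  let _ : Fintype G := Fintype.ofFinite G
  have hc : (Nat.card G : ℂ) ≠ 0 := by exact_mod_cast Nat.card_pos.ne'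
  obtain ⟨e, he, h⟩ := h
  obtain ⟨n, hn⟩ := sum_virtualChar (χ - e).2
  have h1 : ∀ a, a ≠ 1 → ((χ - e : RepRing G) : G → ℂ) a = 0 := fun a ha => sub_eq_zero.2 (h a ha)
  rw [Finset.sum_eq_single 1 (fun a _ ha => h1 a ha) (by simp)] at hn
  have h2 : χ - e = n • ind ⊥ (trivialChar (⊥ : Subgroup G)) := by
    refine Subtype.ext (funext fun a => ?_)
    have h3 : ((n • ind ⊥ (trivialChar (⊥ : Subgroup G)) : RepRing G) : G → ℂ) a =
        n * (ind ⊥ (trivialChar (⊥ : Subgroup G)) : G → ℂ) a := by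
      rw [← zsmul_eq_mul]; rfl
    rw [h3, ind_trivialChar_apply]
    simp only [Subgroup.mem_bot]
    by_cases ha : a = 1
    · subst ha
      rw [hn]
      simp
    · rw [h1 a ha]
      have h4 : ∀ x : G, x⁻¹ * a * x ≠ 1 := fun x hx => ha (by
        have : a = x * (x⁻¹ * a * x) * x⁻¹ := by group
        rw [this, hx]; group)
      simp [h4]
  have h5 : χ = n • ind ⊥ (trivialChar (⊥ : Subgroup G)) + e := by rw [← h2, sub_add_cancel]
  rw [h5]
  exact add_mem (zsmul_mem (ind_trivialChar_mem ⊥) n) he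

variable (G) in
/-- The class of a virtual character modulo `nullFunctions`. -/
def charClass : RepQuot G →+ (G → ℂ) ⧸ nullFunctions G :=
  QuotientAddGroup.map _ _ (RepRing G).subtype fun e he => ⟨e, he, fun _ _ => rfl⟩

theorem charClass_mk (χ : RepRing G) :
    charClass G (QuotientAddGroup.mk χ) = QuotientAddGroup.mk (χ : G → ℂ) := rfl

theorem charClass_injective : Function.Injective (charClass G) := by
  refine (injective_iff_map_eq_zero _).2 fun x hx => ?_
  obtain ⟨χ, rfl⟩ := QuotientAddGroup.mk_surjective x
  rw [charClass_mk, QuotientAddGroup.eq_zero_iff] at hx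
  exact (QuotientAddGroup.eq_zero_iff _).2 (mem_permSubgroup_of_mem_nullFunctions hx)

theorem indFun_mem_nullFunctions (H : Subgroup G) {f : H → ℂ} (hf : f ∈ nullFunctions H) :
    indFun H f ∈ nullFunctions G := by
  let _ : Fintype G := Fintype.ofFinite G
  obtain ⟨e, he, h⟩ := hf
  refine ⟨ind H e, ?_, fun a ha => ?_⟩
  · have h1 : (QuotientAddGroup.mk (ind H e) : RepQuot G) = indQuot H (QuotientAddGroup.mk e) := rfl
    rw [← QuotientAddGroup.eq_zero_iff, h1, (QuotientAddGroup.eq_zero_iff e).2 he, map_zero]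
  · rw [coe_ind, indFun_apply, indFun_apply]
    congr 1
    refine Finset.sum_congr rfl fun x _ => ?_
    unfold extendZero
    split_ifs with hx
    · refine h _ fun h1 => ha ?_
      have h2 : x⁻¹ * a * x = 1 := congrArg Subtype.val h1
      have : a = x * (x⁻¹ * a * x) * x⁻¹ := by group
      rw [this, h2]; group
    · rfl

/-- Induction of functions modulo `nullFunctions`. -/
def indClass (H : Subgroup G) : (H → ℂ) ⧸ nullFunctions H →+ (G → ℂ) ⧸ nullFunctions G :=
  QuotientAddGroup.map _ _ (indFun H) fun _ hf => indFun_mem_nullFunctions H hf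

theorem indClass_charClass (H : Subgroup G) (x : RepQuot H) :
    indClass H (charClass H x) = charClass G (indQuot H x) := by
  obtain ⟨χ, rfl⟩ := QuotientAddGroup.mk_surjective x
  rfl

end NullFunctions

/-! ### The class of the trace formula on 𝔹_G and its behaviour under induction -/

section OrbitClass

theorem rotSum_eq {G : Type*} [Group G] {γ h : G} {q : ℕ} (hq : q < orderOf γ) (hγ : γ ^ q = h⁻¹) :
    rotSum γ h = rotCoeff (orderOf γ) q := by
  rw [rotSum, Finset.sum_eq_single q]
  · rw [if_pos hγ]
  · intro j hj hne
    rw [if_neg]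
    intro h1
    exact hne (pow_injOn_Iio_orderOf (Finset.mem_range.1 hj) hq (h1.trans hγ.symm))
  · intro h1
    exact absurd (Finset.mem_range.2 hq) h1

theorem rotSum_eq_zero {G : Type*} [Group G] {γ h : G} (hh : h ∉ Subgroup.zpowers γ) :
    rotSum γ h = 0 := by
  refine Finset.sum_eq_zero fun q _ => if_neg fun h1 => hh ?_
  rw [← inv_mem_iff, ← h1]
  exact Subgroup.npow_mem_zpowers γ q

theorem rotSum_one {G : Type*} [Group G] {h : G} (hh : h ≠ 1) : rotSum 1 h = 0 :=
  rotSum_eq_zero (by simpa using hh)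

/-- If h⁻¹ = γ^q then h⁻¹ = (γ⁻¹)^(ν-q), and the two coefficients add up to 1/ν because 1/(1-u) +
1/(1-u⁻¹) = 1. -/
theorem rotSum_add_rotSum_inv {G : Type*} [Group G] [Finite G] {γ h : G} (hh : h ≠ 1)
    [Decidable (h ∈ Subgroup.zpowers γ)] : rotSum γ h + rotSum γ⁻¹ h =
      (orderOf γ : ℂ)⁻¹ * if h ∈ Subgroup.zpowers γ then 1 else 0 := by
  split_ifs with hmem
  · have hpos := orderOf_pos γ
    set ν := orderOf γ with hν
    have : NeZero ν := ⟨hpos.ne'⟩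
    obtain ⟨k, hk⟩ := (mem_powers_iff_mem_zpowers (x := γ)).2 (inv_mem hmem)
    have hk' : γ ^ (k % ν) = h⁻¹ := by rw [hν, pow_mod_orderOf]; exact hk
    set q := k % ν
    have hq : q < ν := Nat.mod_lt _ hpos
    have hq0 : q ≠ 0 := by
      intro h0
      rw [h0, pow_zero, eq_comm, inv_eq_one] at hk'
      exact hh hk'
    have h1 : (γ⁻¹) ^ (ν - q) = h⁻¹ := by
      rw [inv_pow, ← hk', inv_eq_iff_mul_eq_one, ← pow_add, Nat.sub_add_cancel hq.le, hν,
        pow_orderOf_eq_one]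
    rw [rotSum_eq (hν ▸ hq) hk', rotSum_eq (by rw [orderOf_inv]; omega) h1, orderOf_inv, ← hν]
    have h2 : unityRoot ν ^ q * unityRoot ν ^ (ν - q) = 1 := by
      rw [← pow_add, Nat.add_sub_cancel' hq.le, (unityRoot_primitive ν).pow_eq_one]
    have h3 : ∀ l, 0 < l → l < ν → unityRoot ν ^ l ≠ 1 := fun l hl hlν =>
      (unityRoot_primitive ν).pow_ne_one_of_pos_of_lt hl.ne' hlν
    have h4 := h3 q (Nat.pos_of_ne_zero hq0) hq
    have h5 := h3 (ν - q) (by omega) (by omega)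
    rw [rotCoeff_eq h4, rotCoeff_eq h5]
    have hν0 : (ν : ℂ) ≠ 0 := Nat.cast_ne_zero.2 hpos.ne'
    set u := unityRoot ν ^ q
    set w := unityRoot ν ^ (ν - q)
    have h6 : 1 - u ≠ 0 := sub_ne_zero.2 h4.symm
    have h7 : 1 - w ≠ 0 := sub_ne_zero.2 h5.symm
    field_simp
    linear_combination -h2
  · rw [rotSum_eq_zero hmem, rotSum_eq_zero (by rwa [Subgroup.zpowers_inv])]
    simp

theorem conj_ne_one {G : Type*} [Group G] {a : G} (ha : a ≠ 1) (x : G) : x⁻¹ * a * x ≠ 1 := fun h => ha (by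
  have : a = x * (x⁻¹ * a * x) * x⁻¹ := by group
  rw [this, h]; group)

variable {G : Type*} [Group G] [Fintype G]

theorem orbitSum_one_mem : orbitSum (1 : G) ∈ nullFunctions G :=
  ⟨0, zero_mem _, fun _ ha => Finset.sum_eq_zero fun x _ => rotSum_one (conj_ne_one ha x)⟩

theorem orbitSum_add_orbitSum_inv_mem (γ : G) :
    orbitSum γ + orbitSum γ⁻¹ ∈ nullFunctions G := by
  classical
  refine ⟨_, ind_trivialChar_mem (Subgroup.zpowers γ), fun a ha => ?_⟩
  rw [ind_trivialChar_apply, Finset.mul_sum, Nat.card_zpowers]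
  change orbitSum γ a + orbitSum γ⁻¹ a = _
  rw [orbitSum, orbitSum, ← Finset.sum_add_distrib]
  exact Finset.sum_congr rfl fun x _ => rotSum_add_rotSum_inv (conj_ne_one ha x)

variable (G) in
/-- The class of `-∑ orbitChar`. -/
def orbitClass : BGroup G →+ (G → ℂ) ⧸ nullFunctions G :=
  (orbitCon G).lift
    { toFun := fun m => QuotientAddGroup.mk (-((m : Multiset (ConjClasses G)).map orbitChar).sum)
      map_zero' := by
        change QuotientAddGroup.mk (-(Multiset.map orbitChar 0).sum) = _
        rw [Multiset.map_zero, Multiset.sum_zero, neg_zero]; rfl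
      map_add' := fun m m' => by
        change QuotientAddGroup.mk (-(Multiset.map orbitChar ((m : Multiset (ConjClasses G)) + (m' : Multiset (ConjClasses G)))).sum) = _
        rw [Multiset.map_add, Multiset.sum_add, neg_add]; rfl } (by
    refine AddCon.addConGen_le.2 ?_
    rintro x y ⟨rfl, rfl | ⟨γ, rfl⟩⟩
    · rw [AddCon.ker_rel, map_zero]
      change QuotientAddGroup.mk (-(Multiset.map orbitChar {ConjClasses.mk (1 : G)}).sum) = _
      rw [Multiset.map_singleton, Multiset.sum_singleton, orbitChar_mk]
      exact (QuotientAddGroup.eq_zero_iff _).2 (neg_mem orbitSum_one_mem)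
    · rw [AddCon.ker_rel, map_zero]
      change QuotientAddGroup.mk
        (-(Multiset.map orbitChar {ConjClasses.mk γ, ConjClasses.mk γ⁻¹}).sum) = _
      rw [Multiset.insert_eq_cons, Multiset.map_cons, Multiset.map_singleton, Multiset.sum_cons,
        Multiset.sum_singleton, orbitChar_mk, orbitChar_mk]
      exact (QuotientAddGroup.eq_zero_iff _).2 (neg_mem (orbitSum_add_orbitSum_inv_mem γ)))

theorem orbitClass_mk (m : OrbitTuple G) : orbitClass G (BGroup.mk G m) =
    QuotientAddGroup.mk (-((m : Multiset (ConjClasses G)).map orbitChar).sum) := rfl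

/-- The trace formula, read modulo `nullFunctions G`: the representation enters only through its
orbit data. -/
theorem charClass_unitaryChar (s : GSurface G) {g : ℕ} {ρ : G →* Matrix.unitaryGroup (Fin g) ℂ}
    (hρ : s.IsUnitaryRep ρ) (m : OrbitTuple G) (hm : (m : Multiset (ConjClasses G)) = s.orbitData) :
    charClass G (QuotientAddGroup.mk (unitaryChar ρ)) = orbitClass G (BGroup.mk G m) := by
  rw [charClass_mk, orbitClass_mk, hm, QuotientAddGroup.eq_iff_sub_mem]
  -- The constant 1 of the trace formula.
  refine ⟨trivialChar G, trivialChar_mem, fun a ha => ?_⟩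
  have h1 : ∀ M : Multiset (ConjClasses G), (M.map orbitChar).sum a =
      (M.map fun c => orbitChar c a).sum := by
    intro M
    induction M using Multiset.induction with
    | empty => simp
    | cons c M ih => simp [ih]
  change Matrix.trace (ρ a : Matrix (Fin g) (Fin g) ℂ) - -((s.orbitData.map orbitChar).sum a) = 1
  rw [h1, s.trace_unitaryRep_eq_orbitData hρ ha]
  ring

/-- Transitivity of induction. The local term is supported on ⟨γ⟩, which lies in H, and does not
depend on the ambient group; the double sum over H and G counts every term |H| times. -/
theorem indFun_orbitSum (H : Subgroup G) [Fintype H] (γ : H) :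
    indFun H (orbitSum γ) = orbitSum (γ : G) := by
  have hc : (Nat.card H : ℂ) ≠ 0 := by exact_mod_cast Nat.card_pos.ne'
  have h1 : ∀ h : H, rotSum γ h = rotSum (γ : G) h := by
    intro h
    classical
    unfold rotSum
    rw [Subgroup.orderOf_coe]
    refine Finset.sum_congr rfl fun q _ => ?_
    by_cases h3 : γ ^ q = h⁻¹
    · have h4 : (γ : G) ^ q = (h : G)⁻¹ := congrArg Subtype.val h3
      rw [if_pos h3, if_pos h4]
    · have h4 : (γ : G) ^ q ≠ (h : G)⁻¹ := fun h4 => h3 (Subtype.ext h4)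
      rw [if_neg h3, if_neg h4]
  -- If z is outside H, no H-conjugate of z lies in ⟨γ⟩, so the sum already vanishes.
  have h2 : ∀ z : G, extendZero H (orbitSum γ) z = ∑ y : H, rotSum (γ : G) ((y : G)⁻¹ * z * y) := by
    intro z
    unfold extendZero
    split_ifs with hz
    · exact Finset.sum_congr rfl fun y _ => h1 _
    · symm
      refine Finset.sum_eq_zero fun y _ => rotSum_eq_zero fun h => hz ?_
      have h3 : (y : G)⁻¹ * z * y ∈ H := Subgroup.zpowers_le.2 γ.2 h
      have : z = y * ((y : G)⁻¹ * z * y) * (y : G)⁻¹ := by group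
      rw [this]
      exact H.mul_mem (H.mul_mem y.2 h3) (H.inv_mem y.2)
  funext a
  rw [indFun_apply]
  simp only [h2]
  rw [Finset.sum_comm]
  have h3 : ∀ y : H, ∑ x : G, rotSum (γ : G) ((y : G)⁻¹ * (x⁻¹ * a * x) * y) = orbitSum (γ : G) a := by
    intro y
    refine Fintype.sum_equiv (Equiv.mulRight (y : G)) _ _ fun x => ?_
    congr 1
    simp only [Equiv.coe_mulRight]
    group
  simp only [h3]
  rw [Finset.sum_const, Finset.card_univ, nsmul_eq_mul, ← Nat.card_eq_fintype_card,
    inv_mul_cancel_left₀ hc]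

theorem indClass_orbitClass (H : Subgroup G) [Fintype H] (α : BGroup H) :
    indClass H (orbitClass H α) = orbitClass G (BGroup.map H.subtype α) := by
  obtain ⟨m, rfl⟩ := AddCon.mk'_surjective α
  change indClass H (orbitClass H (BGroup.mk H m)) =
    orbitClass G (BGroup.mk G (OrbitTuple.map H.subtype m))
  rw [orbitClass_mk, orbitClass_mk]
  change QuotientAddGroup.mk (indFun H (-_)) = QuotientAddGroup.mk (-(Multiset.map orbitChar
    (Multiset.map (ConjClasses.map H.subtype) (m : Multiset (ConjClasses H)))).sum)
  congr 1
  rw [map_neg, map_multiset_sum, Multiset.map_map, Multiset.map_map]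
  congr 3
  funext c
  obtain ⟨γ, rfl⟩ := ConjClasses.mk_surjective c
  exact indFun_orbitSum H γ

end OrbitClass

/-! ## Realization of orbit data by polygons -/

/-- Labels of the edges of a polygon with the boundary word `∏ X_k Y_k X_k⁻¹ Y_k⁻¹ C_k C_k⁻¹`, with a
potential `P` on the vertices of the commutators. -/
structure PolygonData (K : Type) [Group K] where
  n : ℕ
  X : Fin (n + 1) → K
  Y : Fin (n + 1) → K
  C : Fin (n + 1) → K
  P : Fin (n + 1) → K
  closed : ∀ k, P (k + 1) = P k * (X k * (Y k)⁻¹ * (X k)⁻¹ * Y k * C k)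
  surj : ∀ g, ∃ k, X k = g

namespace PolygonData

variable {K : Type} [Group K] (D : PolygonData K)

/-- The edges of the copies of the polygon. -/
abbrev Edge : Type := K × Fin (D.n + 1) × Fin 6

/-- The element of the group by which an edge is glued. -/
def label (k : Fin (D.n + 1)) : Fin 6 → K :=
  ![D.X k, D.Y k, (D.X k)⁻¹, (D.Y k)⁻¹, D.C k, (D.C k)⁻¹]

/-- The position in the block of the edge that is glued to the given one. -/
def mate : Fin 6 → Fin 6 := ![2, 3, 0, 1, 5, 4]

theorem mate_mate : ∀ i, mate (mate i) = i := by decide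

theorem mate_ne : ∀ i, mate i ≠ i := by decide

theorem label_mate (k : Fin (D.n + 1)) (i : Fin 6) : D.label k (mate i) = (D.label k i)⁻¹ := by
  fin_cases i <;> simp [label, mate]

theorem revFun_revFun (d : D.Edge) :
    ((d.1 * D.label d.2.1 d.2.2 * D.label d.2.1 (mate d.2.2), d.2.1, mate (mate d.2.2)) : D.Edge) =
      d := by
  rw [label_mate, mul_inv_cancel_right, mate_mate]

/-- The gluing of the edges. -/
def rev : Equiv.Perm D.Edge where
  toFun d := (d.1 * D.label d.2.1 d.2.2, d.2.1, mate d.2.2)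
  invFun d := (d.1 * D.label d.2.1 d.2.2, d.2.1, mate d.2.2)
  left_inv := D.revFun_revFun
  right_inv := D.revFun_revFun

theorem rev_apply (x : K) (k : Fin (D.n + 1)) (i : Fin 6) :
    D.rev (x, k, i) = (x * D.label k i, k, mate i) := rfl

/-- The next edge of the polygon. -/
def face : Equiv.Perm D.Edge where
  toFun d := (d.1, if d.2.2 = 5 then d.2.1 + 1 else d.2.1, d.2.2 + 1)
  invFun d := (d.1, if d.2.2 = 0 then d.2.1 - 1 else d.2.1, d.2.2 - 1)
  left_inv := by
    rintro ⟨x, k, i⟩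
    fin_cases i <;> simp
    decide
  right_inv := by
    rintro ⟨x, k, i⟩
    fin_cases i <;> simp
    exact fun h => absurd (by decide) h

/-- The rotation about the vertices of the polygon. -/
def rot : Equiv.Perm D.Edge := D.rev * D.face⁻¹

theorem rot_face (d : D.Edge) : D.rot (D.face d) = D.rev d :=
  congrArg D.rev (D.face.symm_apply_apply d)

theorem face_eq : D.rot⁻¹ * D.rev = D.face := by
  rw [rot, mul_inv_rev, inv_inv, mul_assoc, inv_mul_cancel, mul_one]

theorem rot_zero (x : K) (k : Fin (D.n + 1)) : D.rot (x, k + 1, 0) = (x * (D.C k)⁻¹, k, 4) :=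
  D.rot_face (x, k, 5)

theorem rot_one (x : K) (k : Fin (D.n + 1)) : D.rot (x, k, 1) = (x * D.X k, k, 2) :=
  D.rot_face (x, k, 0)

theorem rot_two (x : K) (k : Fin (D.n + 1)) : D.rot (x, k, 2) = (x * D.Y k, k, 3) :=
  D.rot_face (x, k, 1)

theorem rot_three (x : K) (k : Fin (D.n + 1)) : D.rot (x, k, 3) = (x * (D.X k)⁻¹, k, 0) :=
  D.rot_face (x, k, 2)

theorem rot_four (x : K) (k : Fin (D.n + 1)) : D.rot (x, k, 4) = (x * (D.Y k)⁻¹, k, 1) :=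
  D.rot_face (x, k, 3)

theorem rot_five (x : K) (k : Fin (D.n + 1)) : D.rot (x, k, 5) = (x * D.C k, k, 5) :=
  D.rot_face (x, k, 4)

theorem face_zpow_fst (j : ℤ) (d : D.Edge) : ((D.face ^ j) d).1 = d.1 := by
  have h1 : ∀ d : D.Edge, (D.face d).1 = d.1 := fun d => rfl
  have h2 : ∀ d : D.Edge, (D.face⁻¹ d).1 = d.1 := fun d => rfl
  induction j using Int.induction_on with
  | zero => rfl
  | succ j ih => rw [add_comm (j : ℤ), zpow_add, zpow_one, Equiv.Perm.mul_apply, h1, ih]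
  | pred j ih =>
    rw [sub_eq_add_neg, add_comm (-(j : ℤ)), zpow_add, zpow_neg_one, Equiv.Perm.mul_apply, h2, ih]

/-- The face permutation runs through all edges of one copy. Crossing an edge labelled X k leads
from the copy x to the copy x * X k, and X takes every value. -/
theorem connected (d d' : D.Edge) : ∃ w ∈ Subgroup.closure {D.rot, D.rev}, w d = d' := by
  let R : D.Edge → D.Edge → Prop := fun d d' => ∃ w ∈ Subgroup.closure {D.rot, D.rev}, w d = d'
  have hsymm : ∀ {a b}, R a b → R b a := by
    rintro a b ⟨w, hw, rfl⟩
    exact ⟨w⁻¹, inv_mem hw, w.symm_apply_apply a⟩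
  have htrans : ∀ {a b c}, R a b → R b c → R a c := by
    rintro a b c ⟨w, hw, rfl⟩ ⟨v, hv, rfl⟩
    exact ⟨v * w, mul_mem hv hw, rfl⟩
  have hrot : D.rot ∈ Subgroup.closure {D.rot, D.rev} := Subgroup.subset_closure (Or.inl rfl)
  have hrev : D.rev ∈ Subgroup.closure {D.rot, D.rev} := Subgroup.subset_closure (Or.inr rfl)
  have hface : ∀ a, R a (D.face a) := fun a =>
    ⟨D.face, D.face_eq ▸ mul_mem (inv_mem hrot) hrev, rfl⟩
  have h1 : ∀ x k, R (x, k, 0) (x, k, 1) := fun x k => hface (x, k, 0)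
  have h2 : ∀ x k, R (x, k, 0) (x, k, 2) := fun x k => htrans (h1 x k) (hface (x, k, 1))
  have h3 : ∀ x k, R (x, k, 0) (x, k, 3) := fun x k => htrans (h2 x k) (hface (x, k, 2))
  have h4 : ∀ x k, R (x, k, 0) (x, k, 4) := fun x k => htrans (h3 x k) (hface (x, k, 3))
  have h5 : ∀ x k, R (x, k, 0) (x, k, 5) := fun x k => htrans (h4 x k) (hface (x, k, 4))
  have h6 : ∀ x k, R (x, k, 0) (x, k + 1, 0) := fun x k => htrans (h5 x k) (hface (x, k, 5))
  have hblock : ∀ x k i, R (x, k, 0) (x, k, i) := by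
    intro x k i
    fin_cases i
    exacts [⟨1, one_mem _, rfl⟩, h1 x k, h2 x k, h3 x k, h4 x k, h5 x k]
  have hzero : ∀ x k, R (x, 0, 0) (x, k, 0) := by
    intro x k
    induction k using Fin.induction with
    | zero => exact ⟨1, one_mem _, rfl⟩
    | succ k ih => exact Fin.coeSucc_eq_succ ▸ htrans ih (h6 x _)
  have hface' : ∀ x k i, R (x, 0, 0) (x, k, i) := fun x k i => htrans (hzero x k) (hblock x k i)
  have hgroup : ∀ x y, R (x, 0, 0) (y, 0, 0) := by
    intro x y
    obtain ⟨k, hk⟩ := D.surj (x⁻¹ * y)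
    have h7 : R (x, k, 0) (y, k, 2) := ⟨D.rev, hrev, by
      rw [rev_apply]
      change (x * D.X k, k, (2 : Fin 6)) = _
      rw [hk, mul_inv_cancel_left]⟩
    exact htrans (htrans (hface' x k 0) h7) (hsymm (hface' y k 2))
  obtain ⟨x, k, i⟩ := d
  obtain ⟨y, l, j⟩ := d'
  exact htrans (hsymm (hface' x k i)) (htrans (hgroup x y) (hface' y l j))

variable {G : Type*} [Group G]

/-- The surface obtained from the copies of the polygon. -/
def surface [Finite K] (ψ : G ≃* K) : GSurface G :=
  letI : Fintype K := Fintype.ofFinite K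
  letI act : MulAction G D.Edge :=
    { smul := fun a d => (ψ a * d.1, d.2)
      one_smul := fun d => by
        change (ψ 1 * d.1, d.2) = d
        rw [map_one, one_mul]
      mul_smul := fun a b d => by
        change (ψ (a * b) * d.1, d.2) = (ψ a * (ψ b * d.1), d.2)
        rw [map_mul, mul_assoc] }
  have hface : ∀ (a : G) (d : D.Edge), a • D.face d = D.face (a • d) := fun _ _ => rfl
  have hrev : ∀ (a : G) (d : D.Edge), a • D.rev d = D.rev (a • d) := fun a d =>
    Prod.ext (mul_assoc _ _ _).symm rfl
  { Dart := D.Edge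
    nonemptyDart := ⟨(1, 0, 0)⟩
    rot := D.rot
    rev := D.rev
    rev_rev := D.revFun_revFun
    rev_ne := fun d h => mate_ne d.2.2 (congrArg (fun e : D.Edge => e.2.2) h)
    connected := D.connected
    smul_rot := fun a d => by
      obtain ⟨e, rfl⟩ := D.face.surjective d
      rw [rot_face, hrev, hface, rot_face]
    smul_rev := hrev
    effective := fun a h => by
      have h1 : ψ a * 1 = 1 := congrArg Prod.fst (h (1, 0, 0))
      rwa [mul_one, map_eq_one_iff ψ ψ.injective] at h1
    edge_free := fun a d h => mate_ne d.2.2 (congrArg (fun e : D.Edge => e.2.2) h).symm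
    face_free := fun a d h => by
      rw [face_eq] at h
      obtain ⟨j, hj⟩ := h
      -- A face is one copy of the polygon, and the copies are permuted simply transitively.
      have h1 : d.1 = ψ a * d.1 := (D.face_zpow_fst j d).symm.trans (congrArg Prod.fst hj)
      rwa [eq_comm, mul_eq_right, map_eq_one_iff ψ ψ.injective] at h1 }

end PolygonData

/-! ### Computation of orbit data -/

namespace GSurface

variable {G : Type*} [Group G] {s : GSurface G}

theorem IsRotationGenerator.eq {d : s.Dart} {a b : G} (ha : s.IsRotationGenerator d a)
    (hb : s.IsRotationGenerator d b) : a = b := by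
  obtain ⟨k, hk, hak, hkmin⟩ := ha
  obtain ⟨l, hl, hbl, hlmin⟩ := hb
  have hkl : k = l := by
    rcases lt_trichotomy k l with h | h | h
    · exact absurd hak (hlmin k hk h a)
    · exact h
    · exact absurd hbl (hkmin l hl h b)
  exact s.eq_of_smul_eq (hak.trans (hkl ▸ hbl.symm))

/-- Moving to another dart over the same vertex orbit conjugates the generator, so its conjugacy
class is well defined. -/
theorem IsRotationGenerator.conj {d d' : s.Dart} {a b : G} {k : ℤ}
    (ha : s.IsRotationGenerator d a) (h : b • d = (s.rot ^ k) d') :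
    s.IsRotationGenerator d' (b * a * b⁻¹) := by
  have hcomm : ∀ (j : ℕ) (e : s.Dart), (s.rot ^ k) ((s.rot ^ j) e) = (s.rot ^ j) ((s.rot ^ k) e) := by
    intro j e
    rw [← zpow_natCast, ← Equiv.Perm.mul_apply, ← Equiv.Perm.mul_apply, ← zpow_add, ← zpow_add,
      add_comm]
  obtain ⟨M, hM, haM, hmin⟩ := ha
  refine ⟨M, hM, (s.rot ^ k).injective ?_, fun j hj hjM c hc => hmin j hj hjM (b⁻¹ * c * b) ?_⟩
  · rw [← s.smul_rot_zpow, hcomm, ← h, ← mul_smul, inv_mul_cancel_right, mul_smul, haM,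
      s.smul_rot_pow]
  · rw [mul_smul, mul_smul, h, s.smul_rot_zpow, hc, hcomm, ← h, ← s.smul_rot_pow, inv_smul_smul]

theorem mk_rotationGenerator_out {d : s.Dart} {a : G} (ha : s.IsRotationGenerator d a) :
    ConjClasses.mk (s.rotationGenerator (⟦d⟧ : Quotient s.vertexOrbit).out) = ConjClasses.mk a := by
  obtain ⟨b, k, hb⟩ := Quotient.exact (Quotient.out_eq (⟦d⟧ : Quotient s.vertexOrbit))
  have h1 : s.IsRotationGenerator (⟦d⟧ : Quotient s.vertexOrbit).out
      (s.rotationGenerator (⟦d⟧ : Quotient s.vertexOrbit).out) :=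
    (s.exists_isRotationGenerator _).choose_spec
  exact ConjClasses.mk_eq_mk_iff_isConj.2 (isConj_iff.2 ⟨b, (h1.conj hb).eq ha⟩)

/-- The orbit data, computed from a complete invariant of the vertex orbits. -/
theorem orbitData_eq {ι : Type*} [Fintype ι] (κ : s.Dart → ι)
    (hrot : ∀ d, κ (s.rot d) = κ d) (hsmul : ∀ (a : G) d, κ (a • d) = κ d)
    (hsep : ∀ d d', κ d = κ d' → s.vertexOrbit d d') (hsurj : Function.Surjective κ) (c : ι → G)
    (hc : ∀ i, ∃ d, κ d = i ∧ s.IsRotationGenerator d (c i)) :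
    s.orbitData = Finset.univ.val.map fun i => ConjClasses.mk (c i) := by
  have hpow : ∀ (k : ℤ) d, κ ((s.rot ^ k) d) = κ d := by
    intro k
    induction k using Int.induction_on with
    | zero => exact fun d => rfl
    | succ j ih =>
      intro d
      rw [add_comm (j : ℤ), zpow_add, zpow_one, Equiv.Perm.mul_apply, hrot, ih]
    | pred j ih =>
      intro d
      have h : κ (s.rot⁻¹ d) = κ d := by
        rw [← hrot (s.rot⁻¹ d)]
        exact congrArg κ (s.rot.apply_symm_apply d)
      rw [sub_eq_add_neg, zpow_add, zpow_neg_one, Equiv.Perm.mul_apply, ih, h]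
  let f : Quotient s.vertexOrbit → ι := Quotient.lift κ (by
    rintro d d' ⟨a, k, h⟩
    rw [← hsmul a d, h, hpow])
  let F : Quotient s.vertexOrbit ≃ ι := Equiv.ofBijective f (by
    constructor
    · intro v w h
      induction v using Quotient.inductionOn with | _ d =>
      induction w using Quotient.inductionOn with | _ d' =>
      exact Quotient.sound (hsep d d' h)
    · intro i
      obtain ⟨d, rfl⟩ := hsurj i
      exact ⟨⟦d⟧, rfl⟩)
  let _ : Fintype (Quotient s.vertexOrbit) := Fintype.ofFinite _
  have h1 : ∀ v : Quotient s.vertexOrbit, ConjClasses.mk (s.rotationGenerator v.out) =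
      ConjClasses.mk (c (F v)) := by
    intro v
    obtain ⟨d, hd, hgen⟩ := hc (F v)
    have h2 : v = ⟦d⟧ := F.injective hd.symm
    rw [← mk_rotationGenerator_out hgen, ← h2]
  rw [orbitData, ← Multiset.map_univ_val_equiv F, Multiset.map_map]
  exact Multiset.map_congr rfl fun v _ => h1 v

end GSurface

/-! ### Vertices of the surface glued from polygons -/

namespace PolygonData

variable {K : Type} [Group K] (D : PolygonData K)

/-- The potential on the edges that issue from the vertex of the commutators. -/
def potential (k : Fin (D.n + 1)) : Fin 6 → K :=
  ![D.P k, D.P k * D.X k * (D.Y k)⁻¹ * (D.X k)⁻¹, D.P k * D.X k * (D.Y k)⁻¹, D.P k * D.X k,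
    D.P k * D.X k * (D.Y k)⁻¹ * (D.X k)⁻¹ * D.Y k, 1]

/-- Every step around the vertex of the commutators multiplies the copy and the potential on the
right by the same element, so x * P⁻¹ is preserved. Hence the holonomy around this vertex is
trivial. -/
theorem rot_potential (d : D.Edge) (hd : d.2.2 ≠ 5) : (D.rot d).2.2 ≠ 5 ∧
    (D.rot d).1 * (D.potential (D.rot d).2.1 (D.rot d).2.2)⁻¹ =
      d.1 * (D.potential d.2.1 d.2.2)⁻¹ := by
  obtain ⟨x, k, i⟩ := d
  fin_cases i
  · obtain ⟨l, rfl⟩ : ∃ l, k = l + 1 := ⟨k - 1, (sub_add_cancel k 1).symm⟩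
    have h := D.rot_zero x l
    refine ⟨fun h5 => ?_, ?_⟩
    · exact absurd ((congrArg (fun e : D.Edge => e.2.2) h).symm.trans h5)
        (show (4 : Fin 6) ≠ 5 by decide)
    · refine (congrArg (fun e : D.Edge => e.1 * (D.potential e.2.1 e.2.2)⁻¹) h).trans ?_
      change x * (D.C l)⁻¹ * (D.P l * D.X l * (D.Y l)⁻¹ * (D.X l)⁻¹ * D.Y l)⁻¹ =
        x * (D.P (l + 1))⁻¹
      -- The step between adjacent blocks; `closed` is exactly what it needs, also across the cyclic
      -- seam.
      rw [D.closed]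
      group
  · have h := D.rot_one x k
    refine ⟨fun h5 => ?_, ?_⟩
    · exact absurd ((congrArg (fun e : D.Edge => e.2.2) h).symm.trans h5)
        (show (2 : Fin 6) ≠ 5 by decide)
    · refine (congrArg (fun e : D.Edge => e.1 * (D.potential e.2.1 e.2.2)⁻¹) h).trans ?_
      change x * D.X k * (D.P k * D.X k * (D.Y k)⁻¹)⁻¹ =
        x * (D.P k * D.X k * (D.Y k)⁻¹ * (D.X k)⁻¹)⁻¹
      group
  · have h := D.rot_two x k
    refine ⟨fun h5 => ?_, ?_⟩
    · exact absurd ((congrArg (fun e : D.Edge => e.2.2) h).symm.trans h5)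
        (show (3 : Fin 6) ≠ 5 by decide)
    · refine (congrArg (fun e : D.Edge => e.1 * (D.potential e.2.1 e.2.2)⁻¹) h).trans ?_
      change x * D.Y k * (D.P k * D.X k)⁻¹ = x * (D.P k * D.X k * (D.Y k)⁻¹)⁻¹
      group
  · have h := D.rot_three x k
    refine ⟨fun h5 => ?_, ?_⟩
    · exact absurd ((congrArg (fun e : D.Edge => e.2.2) h).symm.trans h5)
        (show (0 : Fin 6) ≠ 5 by decide)
    · refine (congrArg (fun e : D.Edge => e.1 * (D.potential e.2.1 e.2.2)⁻¹) h).trans ?_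
      change x * (D.X k)⁻¹ * (D.P k)⁻¹ = x * (D.P k * D.X k)⁻¹
      group
  · have h := D.rot_four x k
    refine ⟨fun h5 => ?_, ?_⟩
    · exact absurd ((congrArg (fun e : D.Edge => e.2.2) h).symm.trans h5)
        (show (1 : Fin 6) ≠ 5 by decide)
    · refine (congrArg (fun e : D.Edge => e.1 * (D.potential e.2.1 e.2.2)⁻¹) h).trans ?_
      change x * (D.Y k)⁻¹ * (D.P k * D.X k * (D.Y k)⁻¹ * (D.X k)⁻¹)⁻¹ =
        x * (D.P k * D.X k * (D.Y k)⁻¹ * (D.X k)⁻¹ * D.Y k)⁻¹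
      group
  · exact absurd rfl hd

theorem rot_pow_potential (d : D.Edge) (hd : d.2.2 ≠ 5) (j : ℕ) : ((D.rot ^ j) d).2.2 ≠ 5 ∧
    ((D.rot ^ j) d).1 * (D.potential ((D.rot ^ j) d).2.1 ((D.rot ^ j) d).2.2)⁻¹ =
      d.1 * (D.potential d.2.1 d.2.2)⁻¹ := by
  induction j with
  | zero => exact ⟨hd, rfl⟩
  | succ j ih =>
    rw [pow_succ', Equiv.Perm.mul_apply]
    obtain ⟨h1, h2⟩ := D.rot_potential _ ih.1
    exact ⟨h1, h2.trans ih.2⟩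

/-- The vertex orbit of an edge. -/
def vertexKind (d : D.Edge) : Option (Fin (D.n + 1)) := if d.2.2 = 5 then some d.2.1 else none

theorem vertexKind_rot (d : D.Edge) : D.vertexKind (D.rot d) = D.vertexKind d := by
  by_cases hd : d.2.2 = 5
  · obtain ⟨x, k, i⟩ := d
    obtain rfl : i = 5 := hd
    rw [rot_five]
    rfl
  · rw [vertexKind, vertexKind, if_neg hd, if_neg (D.rot_potential d hd).1]

variable {G : Type*} [Group G] [Finite K] (ψ : G ≃* K)

theorem surface_smul (a : G) (d : (D.surface ψ).Dart) :
    a • d = (show D.Edge from (ψ a * (show D.Edge from d).1, (show D.Edge from d).2)) := rfl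

theorem vertexOrbit_of_vertexKind_eq {d d' : D.Edge} (h : D.vertexKind d = D.vertexKind d') :
    (D.surface ψ).vertexOrbit d d' := by
  let s := D.surface ψ
  let R : D.Edge → D.Edge → Prop := fun d d' => s.vertexOrbit d d'
  have htrans : ∀ {a b c}, R a b → R b c → R a c := fun h h' => s.vertexOrbit.trans h h'
  have hsymm : ∀ {a b}, R a b → R b a := fun h => s.vertexOrbit.symm h
  have hrot : ∀ a, R (D.rot a) a := fun a => ⟨1, 1, one_smul G (show s.Dart from D.rot a)⟩
  have hsmul : ∀ x y e, R (x, e) (y, e) := by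
    intro x y e
    refine ⟨ψ.symm (y * x⁻¹), 0, ?_⟩
    refine (D.surface_smul ψ _ _).trans ?_
    change ((ψ (ψ.symm (y * x⁻¹)) * x, e) : D.Edge) = (y, e)
    rw [MulEquiv.apply_symm_apply, inv_mul_cancel_right]
  have hstep : ∀ {x y e e'}, D.rot (x, e) = (y, e') → ∀ x' y', R (x', e) (y', e') := by
    intro x y e e' h x' y'
    exact htrans (hsmul x' x e) (htrans (hsymm (hrot _)) (h ▸ hsmul y y' e'))
  have h3 : ∀ x y k, R (x, k, 3) (y, k, 0) := fun x y k => hstep (D.rot_three 1 k) x y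
  have h2 : ∀ x y k, R (x, k, 2) (y, k, 0) := fun x y k =>
    htrans (hstep (D.rot_two 1 k) x 1) (h3 1 y k)
  have h1 : ∀ x y k, R (x, k, 1) (y, k, 0) := fun x y k =>
    htrans (hstep (D.rot_one 1 k) x 1) (h2 1 y k)
  have h4 : ∀ x y k, R (x, k, 4) (y, k, 0) := fun x y k =>
    htrans (hstep (D.rot_four 1 k) x 1) (h1 1 y k)
  have h0 : ∀ x y k, R (x, k + 1, 0) (y, k, 0) := fun x y k =>
    htrans (hstep (D.rot_zero 1 k) x 1) (h4 1 y k)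
  have hblock : ∀ x y k i, i ≠ 5 → R (x, k, i) (y, k, 0) := by
    intro x y k i hi
    fin_cases i
    exacts [hsmul x y (k, 0), h1 x y k, h2 x y k, h3 x y k, h4 x y k, absurd rfl hi]
  have hzero : ∀ x y k, R (x, k, 0) (y, 0, 0) := by
    intro x y k
    induction k using Fin.induction with
    | zero => exact hsmul x y (0, 0)
    | succ k ih => exact Fin.coeSucc_eq_succ ▸ htrans (h0 x x _) ih
  have hbig : ∀ x k i, i ≠ 5 → R (x, k, i) (1, 0, 0) := fun x k i hi =>
    htrans (hblock x 1 k i hi) (hzero 1 1 k)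
  obtain ⟨x, k, i⟩ := d
  obtain ⟨y, l, j⟩ := d'
  unfold vertexKind at h
  by_cases hi : i = 5
  · by_cases hj : j = 5
    · subst hi hj
      rw [if_pos rfl, if_pos rfl, Option.some_inj] at h
      obtain rfl : k = l := h
      exact hsmul x y (k, 5)
    · rw [if_pos hi, if_neg hj] at h
      cases h
  · by_cases hj : j = 5
    · rw [if_neg hi, if_pos hj] at h
      cases h
    · exact htrans (hbig x k i hi) (hsymm (hbig y l j hj))

/-- The tip between C and C⁻¹ has a single corner in each copy, so one step of rot is already
realized by a group element. -/
theorem isRotationGenerator_corner (k : Fin (D.n + 1)) :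
    (D.surface ψ).IsRotationGenerator ((1, k, 5) : D.Edge) (ψ.symm (D.C k)) := by
  refine ⟨1, one_pos, ?_, fun j hj hj1 => by omega⟩
  refine (D.surface_smul ψ _ _).trans ?_
  change ((ψ (ψ.symm (D.C k)) * 1, k, 5) : D.Edge) = D.rot (1, k, 5)
  rw [MulEquiv.apply_symm_apply, mul_one, rot_five, one_mul]

theorem isRotationGenerator_big :
    (D.surface ψ).IsRotationGenerator ((1, 0, 0) : D.Edge) 1 := by
  set s := D.surface ψ
  let d : D.Edge := (1, 0, 0)
  refine ⟨s.valence d, s.valence_pos d, ?_, fun j hj hlt b hb => ?_⟩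
  · exact (one_smul G (show s.Dart from d)).trans (s.rot_pow_valence d).symm
  · have h1 : ((ψ b * 1, 0, 0) : D.Edge) = (D.rot ^ j) d := hb
    have h2 := (D.rot_pow_potential d (show (0 : Fin 6) ≠ 5 by decide) j).2
    rw [← h1] at h2
    -- The invariant x * P⁻¹ shows that the rotation can return to this corner only in the same
    -- copy.
    have h3 : ψ b = 1 := by
      have h4 : ψ b * 1 * (D.potential 0 0)⁻¹ = 1 * (D.potential 0 0)⁻¹ := h2
      exact (mul_one _).symm.trans (mul_right_cancel h4)
    rw [h3, one_mul] at h1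
    exact absurd (Nat.le_of_dvd hj ((s.rot_pow_eq_self_iff d j).1 h1.symm)) (not_le.2 hlt)

theorem orbitData_surface : (D.surface ψ).orbitData =
    ConjClasses.mk 1 ::ₘ Finset.univ.val.map fun k => ConjClasses.mk (ψ.symm (D.C k)) := by
  -- `none` stands for the orbit of the commutator vertex, which is regular, and `some k` for the
  -- tip of the block k.
  rw [GSurface.orbitData_eq (s := D.surface ψ) D.vertexKind D.vertexKind_rot (fun a d => rfl)
    (fun d d' h => D.vertexOrbit_of_vertexKind_eq ψ h) ?_
    (fun i => i.elim 1 fun k => ψ.symm (D.C k)) ?_]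
  · rw [univ_option]
    change Multiset.map _ (none ::ₘ Finset.univ.val.map some) = _
    rw [Multiset.map_cons, Multiset.map_map]
    rfl
  · rintro (_ | k)
    · exact ⟨(1, 0, 0), rfl⟩
    · exact ⟨(1, k, 5), rfl⟩
  · rintro (_ | k)
    · exact ⟨((1, 0, 0) : D.Edge), rfl, D.isRotationGenerator_big ψ⟩
    · exact ⟨((1, k, 5) : D.Edge), rfl, D.isRotationGenerator_corner ψ k⟩

end PolygonData

/-- The word `X Y⁻¹ X⁻¹ Y C`. -/
def blockWord {K : Type*} [Group K] (t : K × K × K) : K :=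
  t.1 * t.2.1⁻¹ * t.1⁻¹ * t.2.1 * t.2.2

/-- A commutator ⁅x, y⁆ is the word of the block (x, y⁻¹, 1) and its inverse is ⁅y, x⁆, so no
inverse blocks are needed. -/
theorem exists_list_blockWord {K : Type*} [Group K] {g : K} (hg : g ∈ commutator K) :
    ∃ L : List (K × K × K), (∀ t ∈ L, t.2.2 = 1) ∧ (L.map blockWord).prod = g := by
  have hword : ∀ x y : K, blockWord (x, y⁻¹, 1) = ⁅x, y⁆ := fun x y => by
    simp [blockWord, commutatorElement_def]
  rw [commutator_eq_closure] at hg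
  induction hg using Subgroup.closure_induction'' with
  | one => exact ⟨[], by simp, rfl⟩
  | mem z hz =>
    obtain ⟨x, y, rfl⟩ := hz
    exact ⟨[(x, y⁻¹, 1)], by simp, by simp [hword]⟩
  | inv_mem z hz =>
    obtain ⟨x, y, rfl⟩ := hz
    exact ⟨[(y, x⁻¹, 1)], by simp, by simp [hword]⟩
  | mul a b _ _ iha ihb =>
    obtain ⟨L, h1, h2⟩ := iha
    obtain ⟨M, h3, h4⟩ := ihb
    refine ⟨L ++ M, fun t ht => (List.mem_append.1 ht).elim (h1 t) (h3 t), ?_⟩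
    rw [List.map_append, List.prod_append, h2, h4]

/-- The polygon with the boundary word given by a list of blocks. -/
def PolygonData.ofList {K : Type} [Group K] (t : K × K × K) (L : List (K × K × K))
    (hprod : ((t :: L).map blockWord).prod = 1) (hsurj : ∀ g, ∃ u ∈ t :: L, u.1 = g) :
    PolygonData K where
  n := L.length
  X k := ((t :: L).get k).1
  Y k := ((t :: L).get k).2.1
  C k := ((t :: L).get k).2.2
  P k := (((t :: L).map blockWord).take k).prod
  closed k := by
    have h : (((t :: L).map blockWord).take (k + 1)).prod =
        (((t :: L).map blockWord).take k).prod * blockWord ((t :: L).get k) := by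
      rw [List.prod_take_succ _ _ (by rw [List.length_map]; exact k.2), List.getElem_map]
      rfl
    refine Eq.trans ?_ h
    -- At the last block the index wraps around to 0, and the potential closes up because the whole
    -- product is 1.
    by_cases hk : k = Fin.last L.length
    · subst hk
      have h1 : (((t :: L).map blockWord).take (L.length + 1)).prod = 1 := by
        exact (congrArg List.prod (List.take_of_length_le (by rw [List.length_map]; exact le_rfl))).trans hprod
      rw [Fin.last_add_one, Fin.val_last, h1]
      rfl
    · rw [Fin.val_add_one_of_lt (lt_of_le_of_ne (Fin.le_last k) hk)]
  surj g := by
    obtain ⟨u, hu, rfl⟩ := hsurj g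
    obtain ⟨k, rfl⟩ := List.get_of_mem hu
    exact ⟨k, rfl⟩

/-- Commutator blocks cancel the product of γ, which is where membership in the commutator subgroup
enters. The added tips with C = 1 are harmless in 𝔹_G. -/
theorem exists_polygonData {K : Type} [Group K] [Finite K] (γ : List K)
    (hγ : γ.prod ∈ commutator K) : ∃ (D : PolygonData K) (N : ℕ),
      (Finset.univ.val.map D.C : Multiset K) = (γ : Multiset K) + Multiset.replicate N 1 := by
  obtain ⟨L₁, hL₁, hprod₁⟩ := exists_list_blockWord (inv_mem hγ)
  let _ : Fintype K := Fintype.ofFinite K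
  let L₂ : List (K × K × K) := γ.map fun c => (1, 1, c)
  -- Blocks with trivial word whose X runs through the whole group, to make the surface connected.
  let L₃ : List (K × K × K) := Finset.univ.toList.map fun g => (g, 1, 1)
  have hprod₂ : (L₂.map blockWord).prod = γ.prod := by
    simp [L₂, blockWord, Function.comp_def]
  have hprod₃ : (L₃.map blockWord).prod = 1 := by
    simp [L₃, blockWord, Function.comp_def]
  have hprod : ((L₁ ++ L₂ ++ L₃).map blockWord).prod = 1 := by
    rw [List.map_append, List.map_append, List.prod_append, List.prod_append, hprod₁, hprod₂,
      hprod₃, inv_mul_cancel, one_mul]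
  have hsurj : ∀ g, ∃ u ∈ L₁ ++ L₂ ++ L₃, u.1 = g := fun g =>
    ⟨(g, 1, 1), List.mem_append_right _ (List.mem_map_of_mem (Finset.mem_toList.2 (Finset.mem_univ g))),
      rfl⟩
  have h₁ : L₁.map (fun t => t.2.2) = List.replicate L₁.length 1 :=
    List.eq_replicate_iff.2 ⟨by simp, by simpa using fun a b c h => hL₁ _ h⟩
  have h₂ : L₂.map (fun t => t.2.2) = γ := by simp [L₂, Function.comp_def]
  have h₃ : L₃.map (fun t => t.2.2) = List.replicate L₃.length 1 :=
    List.eq_replicate_iff.2 ⟨by simp, by simp [L₃]⟩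
  have hC : (((L₁ ++ L₂ ++ L₃).map fun t => t.2.2 : List K) : Multiset K) =
      (γ : Multiset K) + Multiset.replicate (L₁.length + L₃.length) 1 := by
    rw [List.map_append, List.map_append, h₁, h₂, h₃, Multiset.replicate_add,
      ← Multiset.coe_replicate, ← Multiset.coe_replicate, ← Multiset.coe_add, ← Multiset.coe_add]
    abel
  obtain ⟨t, L, hL⟩ : ∃ t L, L₁ ++ L₂ ++ L₃ = t :: L := by
    refine List.exists_cons_of_ne_nil fun h => ?_
    obtain ⟨u, hu, -⟩ := hsurj 1
    rw [h] at hu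
    cases hu
  rw [hL] at hprod hsurj hC
  refine ⟨PolygonData.ofList t L hprod hsurj, _, Eq.trans ?_ hC⟩
  change (Finset.univ.val.map fun k : Fin (t :: L).length => ((t :: L).get k).2.2) = _
  rw [Fin.univ_val_map]
  congr 1
  conv_rhs => rw [← List.ofFn_get (t :: L), List.map_ofFn]
  rfl

/-! ### Surjectivity of the orbit data and existence of θ -/

variable {G : Type*} [Group G]

theorem OrbitTuple.mk_add_replicate (m : OrbitTuple G) (N : ℕ) : ∃ m' : OrbitTuple G,
    (m' : Multiset (ConjClasses G)) = (m : Multiset (ConjClasses G)) +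
      Multiset.replicate N (ConjClasses.mk 1) ∧ BGroup.mk G m' = BGroup.mk G m := by
  refine ⟨m + N • trivialTuple, ?_, ?_⟩
  · rw [AddSubmonoid.coe_add]
    exact congrArg _ ((AddSubmonoidClass.coe_nsmul _ N).trans (Multiset.nsmul_singleton _ N))
  · rw [map_add, map_nsmul, BGroup.mk_trivial, nsmul_zero, add_zero]

/-- Every element of `𝔹_G` is the class of the singular orbit data of an action. -/
theorem exists_orbitData [Finite G] (α : BGroup G) : ∃ (s : GSurface G) (m : OrbitTuple G),
    (m : Multiset (ConjClasses G)) = s.orbitData ∧ BGroup.mk G m = α := by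
  obtain ⟨m, rfl⟩ : ∃ m, BGroup.mk G m = α := AddCon.mk'_surjective α
  obtain ⟨γ, hγ⟩ : ∃ γ : List G, ((γ.map ConjClasses.mk : List _) : Multiset (ConjClasses G)) = m := by
    obtain ⟨l, hl⟩ := Quotient.exists_rep (m : Multiset (ConjClasses G))
    obtain ⟨γ, rfl⟩ := List.map_surjective_iff.2 (ConjClasses.mk_surjective (α := G)) l
    exact ⟨γ, hl⟩
  -- Darts live in the lowest universe, so the polygons are labelled by a small copy of G.
  let ψ : G ≃* Shrink.{0} G := Shrink.mulEquiv.symm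
  have hab : Abelianization.of γ.prod = 1 := by
    have h : ((m : Multiset (ConjClasses G)).map (classToAb G)).prod = 1 := m.2
    rw [← hγ, Multiset.map_coe, List.map_map, Multiset.prod_coe] at h
    rw [map_list_prod]
    exact h
  have hcomm : (γ.map ψ).prod ∈ commutator (Shrink.{0} G) := by
    refine (QuotientGroup.eq_one_iff _).1 ?_
    rw [← map_list_prod]
    exact (congrArg (Abelianization.map ψ.toMonoidHom) hab).trans (map_one _)
  obtain ⟨D, N, hD⟩ := exists_polygonData _ hcomm
  -- N trivial classes come from the auxiliary blocks and one from the commutator vertex.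
  obtain ⟨m', h1, h2⟩ := OrbitTuple.mk_add_replicate m (N + 1)
  refine ⟨D.surface ψ, m', ?_, h2⟩
  rw [h1, D.orbitData_surface ψ]
  have h3 : (Finset.univ.val.map fun k => ConjClasses.mk (ψ.symm (D.C k))) =
      (Finset.univ.val.map D.C).map fun x => ConjClasses.mk (ψ.symm x) := by
    rw [Multiset.map_map]
    rfl
  rw [h3, hD, Multiset.map_add, Multiset.map_replicate, map_one, Multiset.map_coe, List.map_map,
    ← hγ, Multiset.replicate_succ, Multiset.add_cons]
  congr 3
  exact (List.map_congr_left fun x _ =>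
    congrArg ConjClasses.mk (ψ.symm_apply_apply x).symm)

/-- The homomorphism `θ` exists, and its values are determined by the orbit classes. -/
theorem exists_isTheta [Fintype G] :
    ∃ θ : BGroup G →+ RepQuot G, IsTheta θ ∧ ∀ α, charClass G (θ α) = orbitClass G α := by
  have h : ∀ α, ∃ x, charClass G x = orbitClass G α := by
    intro α
    obtain ⟨s, m, hm, rfl⟩ := exists_orbitData α
    obtain ⟨g, ρ, hρ⟩ := s.exists_isUnitaryRep
    exact ⟨_, charClass_unitaryChar s hρ m hm⟩
  choose f hf using h
  -- `orbitClass` takes its values in the image of the injective map `charClass`, so it lifts, and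
  -- additivity is inherited.
  let θ : BGroup G →+ RepQuot G :=
    AddMonoidHom.mk' f fun α β => charClass_injective (by rw [map_add, hf, hf, hf, map_add])
  refine ⟨θ, fun α x => ⟨?_, ?_⟩, hf⟩
  · rintro rfl
    obtain ⟨s, m, hm, rfl⟩ := exists_orbitData α
    obtain ⟨g, ρ, hρ⟩ := s.exists_isUnitaryRep
    exact ⟨s, g, ρ, m, hρ, hm, rfl,
      charClass_injective ((charClass_unitaryChar s hρ m hm).trans (hf _).symm)⟩
  · rintro ⟨s, g, ρ, m, hρ, hm, rfl, rfl⟩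
    exact charClass_injective ((hf _).trans (charClass_unitaryChar s hρ m hm).symm)

end GeomRep

end

/-- After `charClass` both composites become the map that induces the local sums from H to G. -/
theorem mainTheorem9 {G : Type*} [Group G] [Finite G] (H : Subgroup G) :
    ∃ (θH : GeomRep.BGroup H →+ GeomRep.RepQuot H) (θG : GeomRep.BGroup G →+ GeomRep.RepQuot G),
      GeomRep.IsTheta θH ∧ GeomRep.IsTheta θG ∧
        θG.comp (GeomRep.BGroup.map H.subtype) = (GeomRep.indQuot H).comp θH := by
  let _ : Fintype G := Fintype.ofFinite G
  let _ : Fintype H := Fintype.ofFinite H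
  obtain ⟨θH, hH, hθH⟩ := GeomRep.exists_isTheta (G := H)
  obtain ⟨θG, hG, hθG⟩ := GeomRep.exists_isTheta (G := G)
  refine ⟨θH, θG, hH, hG, AddMonoidHom.ext fun α => GeomRep.charClass_injective ?_⟩
  rw [AddMonoidHom.comp_apply, AddMonoidHom.comp_apply, hθG, ← GeomRep.indClass_charClass, hθH,
    GeomRep.indClass_orbitClass]
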